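/- Let $N\ge 1$ and let $\Omega\subset\mathbb{R}^N$ be a bounded domain (nonempty, open and connected) with $C^\infty$ boundary. Let $a\in L^\infty(\Omega)$ with $a\ge 0$ a.e. in $\Omega$. Let $u\in H^2(\Omega)\cap H^1_0(\Omega)$ be a weak solution of $$\Delta^2u=a(x)u\ \text{ in }\Omega,\qquad u=\Delta u=0\ \text{ on }\partial\Omega,$$ that is, $$\int_\Omega \Delta u\,\Delta\varphi\,dx=\int_\Omega a\,u\,\varphi\,dx\qquad\text{for all }\varphi\in H^2(\Omega)\cap H^1_0(\Omega).$$ Suppose that $u\ge 0$ a.e. in $\Omega$ and that $u$ is not a.e. equal to $0$ in $\Omega$. Then $-\Delta u>0$ in $\Omega$; precisely, the weak Laplacian of $u$ has a continuous representative in $\Omega$, and this representative satisfies $-\Delta u(x)>0$ for every $x\in\Omega$. -/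

import Mathlib

open MeasureTheory Filter Topology
open scoped ContDiff ENNReal

noncomputable section

namespace Biharm

/-- The Euclidean space `ℝ^N`. -/
abbrev E (N : ℕ) : Type := EuclideanSpace ℝ (Fin N)

/-- The classical partial derivative `∂φ/∂x_i`. -/
def partialDeriv {N : ℕ} (i : Fin N) (φ : E N → ℝ) (x : E N) : ℝ :=
  fderiv ℝ φ x (EuclideanSpace.single i 1)

/-- `Ω` is a bounded domain (nonempty, open, connected) of `ℝ^N` with smooth boundary: near each
boundary point, `Ω` is the sublevel set `{ρ < 0}` of a smooth function `ρ` whose differential does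
not vanish at that point. -/
structure IsSmoothBoundedDomain {N : ℕ} (Ω : Set (E N)) : Prop where
  isOpen : IsOpen Ω
  isConnected : IsConnected Ω
  isBounded : Bornology.IsBounded Ω
  smooth_boundary : ∀ p ∈ frontier Ω, ∃ U : Set (E N), ∃ ρ : E N → ℝ,
    IsOpen U ∧ p ∈ U ∧ ContDiff ℝ ∞ ρ ∧ fderiv ℝ ρ p ≠ 0 ∧ ∀ x ∈ U, (x ∈ Ω ↔ ρ x < 0)

/-- `φ ∈ C_c^∞(Ω)`. -/
structure IsTestFunction {N : ℕ} (Ω : Set (E N)) (φ : E N → ℝ) : Prop where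
  contDiff : ContDiff ℝ ∞ φ
  hasCompactSupport : HasCompactSupport φ
  tsupport_subset : tsupport φ ⊆ Ω

/-- `g` is the weak (distributional) partial derivative `∂u/∂x_i` in `Ω`. -/
structure HasWeakPartial {N : ℕ} (Ω : Set (E N)) (i : Fin N) (u g : E N → ℝ) : Prop where
  locallyIntegrableOn_left : LocallyIntegrableOn u Ω
  locallyIntegrableOn_right : LocallyIntegrableOn g Ω
  integral_eq : ∀ φ : E N → ℝ, IsTestFunction Ω φ →
    ∫ x in Ω, u x * partialDeriv i φ x = - ∫ x in Ω, g x * φ x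

/-- Membership in the Sobolev space `H^k(Ω) = W^{k,2}(Ω)`: `u` is in `L²(Ω)` and, if `k ≥ 1`, has
weak partial derivatives in `H^{k-1}(Ω)`. -/
def MemH {N : ℕ} (Ω : Set (E N)) : ℕ → (E N → ℝ) → Prop
  | 0, u => MemLp u 2 (volume.restrict Ω)
  | k + 1, u => MemLp u 2 (volume.restrict Ω) ∧
      ∀ i : Fin N, ∃ g : E N → ℝ, HasWeakPartial Ω i u g ∧ MemH Ω k g

open scoped Classical in
/-- A representative of the weak partial derivative `∂u/∂x_i` in `Ω`, if `u` has one (it is then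
unique almost everywhere in `Ω`), and `0` otherwise. -/
def weakPartial {N : ℕ} (Ω : Set (E N)) (i : Fin N) (u : E N → ℝ) : E N → ℝ :=
  if h : ∃ g, HasWeakPartial Ω i u g then h.choose else 0

/-- The weak Laplacian `Δu = ∑ i, ∂²u/∂x_i²` in `Ω`. -/
def weakLaplacian {N : ℕ} (Ω : Set (E N)) (u : E N → ℝ) (x : E N) : ℝ :=
  ∑ i : Fin N, weakPartial Ω i (weakPartial Ω i u) x

/-- Membership in `H^1_0(Ω)`, the closure of `C_c^∞(Ω)` in `H^1(Ω)`. -/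
def MemH10 {N : ℕ} (Ω : Set (E N)) (u : E N → ℝ) : Prop :=
  MemH Ω 1 u ∧ ∃ φ : ℕ → E N → ℝ, (∀ n, IsTestFunction Ω (φ n)) ∧
    Tendsto (fun n => eLpNorm (fun x => φ n x - u x) 2 (volume.restrict Ω)) atTop (𝓝 0) ∧
    ∀ i : Fin N, Tendsto (fun n =>
      eLpNorm (fun x => partialDeriv i (φ n) x - weakPartial Ω i u x) 2 (volume.restrict Ω))
      atTop (𝓝 0)

/-- `u ∈ H²(Ω) ∩ H^1_0(Ω)` is a weak solution of the Navier problem `Δ²u = a u` in `Ω`,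
`u = Δu = 0` on `∂Ω`. -/
structure IsWeakSolution {N : ℕ} (Ω : Set (E N)) (a u : E N → ℝ) : Prop where
  memH2 : MemH Ω 2 u
  memH10 : MemH10 Ω u
  integral_eq : ∀ φ : E N → ℝ, MemH Ω 2 φ → MemH10 Ω φ →
    ∫ x in Ω, weakLaplacian Ω u x * weakLaplacian Ω φ x = ∫ x in Ω, a x * u x * φ x

end Biharm

end

/-! Put `w = -Δu`. Testing the weak formulation with smooth `φ` vanishing on `∂Ω` shows that `w` is
only a very weak solution of `-Δw = a u`, `w = 0` on `∂Ω`: `w` lies in `L²` and the boundary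
condition is encoded in the test functions. The proof extracts `w ≥ 0`, continuity and strict
positivity from this.

Nonnegativity (`ae_nonneg_of_veryWeak`). The central fact is that for some `λ > 0` the functions `λφ
- Δφ`, with `φ` smooth and zero on `∂Ω`, are dense in `L²(Ω)`
(`exists_forall_isOrthogonalToRange_ae_eq_zero`). If `v` is orthogonal to them, approximate local
solutions of `λφ - Δφ = g`, cut off and used as test functions, bound the norm of `v` near each
point by `K/√λ` times its full norm; compactness of `closure Ω` and large `λ` give `v = 0`. The
local solutions come from the whole-space resolvent, made odd near the boundary by a reflection
(`isLocallySolvable_of_refl`). By density `w` is an `L²` limit of smooth `φ n`, zero on `∂Ω`, with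
`-Δ(φ n) → a u`, and testing with a smooth negative part of `φ n` gives `w ≥ 0`.

Local boundedness (`IsWeakSolution.locallyEssBounded`). The sum `z = u + w` is nonnegative and
satisfies `-Δz = w + a u ≤ C z`. The radial kernels `kerP` and `kerPsi` satisfy `∂_ε kerP = ε Δ
kerPsi` and `kerPsi ≤ kerP / 2`, so `exp(Cε²/4)` times the mollification of `z` at scale `ε` is
nondecreasing in `ε`. Letting `ε → 0` bounds `z` by its integral, and hence bounds `a u` locally.

Continuity and positivity. With `a u` locally bounded, the mollifications of `w` are Lipschitz in
`ε`, locally uniformly in the centre, so they converge to a continuous representative. Since `a u ≥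
0` they increase as `ε` decreases, so a zero of the representative forces it to vanish nearby; by
connectedness it is positive everywhere or identically zero (`SolvesPoisson.pos_or_eq_zero`). In the
second case `Δu = 0`, and the maximum principle applied to `u` and `-u` gives `u = 0`, which is
excluded. -/

namespace Biharm

/-! ### `L²` norms, density and duality with test functions. -/

/-- The `L²(S)` norm of a real function. -/
noncomputable def l2 {N : ℕ} (S : Set (E N)) (f : E N → ℝ) : ℝ :=
  (eLpNorm f 2 (volume.restrict S)).toReal

/-- Membership in `L²(S)`. -/
abbrev MemL2 {N : ℕ} (S : Set (E N)) (f : E N → ℝ) : Prop := MemLp f 2 (volume.restrict S)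

section L2
variable {N : ℕ} {S T : Set (E N)} {f g : E N → ℝ}

lemma l2_nonneg : 0 ≤ l2 S f := ENNReal.toReal_nonneg

lemma l2_eq_norm_toLp (hf : MemL2 S f) : l2 S f = ‖hf.toLp f‖ := by
  rw [Lp.norm_toLp]; rfl

lemma l2_add_le (hf : MemL2 S f) (hg : MemL2 S g) :
    l2 S (fun x => f x + g x) ≤ l2 S f + l2 S g := by
  have h : l2 S (fun x => f x + g x) = ‖hf.toLp f + hg.toLp g‖ := l2_eq_norm_toLp (hf.add hg)
  rw [h, l2_eq_norm_toLp hf, l2_eq_norm_toLp hg]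
  exact norm_add_le _ _

lemma l2_sub_le (hf : MemL2 S f) (hg : MemL2 S g) :
    l2 S (fun x => f x - g x) ≤ l2 S f + l2 S g := by
  have h : l2 S (fun x => f x - g x) = ‖hf.toLp f - hg.toLp g‖ := l2_eq_norm_toLp (hf.sub hg)
  rw [h, l2_eq_norm_toLp hf, l2_eq_norm_toLp hg]
  exact norm_sub_le _ _

lemma l2_sum_le {ι : Type*} (s : Finset ι) {F : ι → E N → ℝ} (h : ∀ i ∈ s, MemL2 S (F i)) :
    l2 S (fun x => ∑ i ∈ s, F i x) ≤ ∑ i ∈ s, l2 S (F i) := by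
  classical
  induction s using Finset.induction_on with
  | empty => simp [l2]
  | insert a s ha ih =>
    simp only [Finset.sum_insert ha]
    have h2 := memLp_finsetSum s (fun i hi => h i (Finset.mem_insert_of_mem hi))
    refine (l2_add_le (h a (Finset.mem_insert_self _ _)) h2).trans ?_
    gcongr
    exact ih fun i hi => h i (Finset.mem_insert_of_mem hi)

lemma l2_congr (h : ∀ᵐ x ∂(volume.restrict S), f x = g x) : l2 S f = l2 S g := by
  unfold l2; rw [eLpNorm_congr_ae h]

lemma l2_sq (hf : MemL2 S f) : l2 S f ^ 2 = ∫ x in S, f x ^ 2 := by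
  rw [l2_eq_norm_toLp hf, ← real_inner_self_eq_norm_sq, L2.inner_def]
  refine integral_congr_ae ?_
  filter_upwards [hf.coeFn_toLp] with x hx
  simp [hx, sq]

lemma integrable_mul_of_memL2 (hf : MemL2 S f) (hg : MemL2 S g) :
    Integrable (fun x => f x * g x) (volume.restrict S) := hf.integrable_mul hg

lemma abs_integral_mul_le (hf : MemL2 S f) (hg : MemL2 S g) :
    |∫ x in S, f x * g x| ≤ l2 S f * l2 S g := by
  rw [l2_eq_norm_toLp hf, l2_eq_norm_toLp hg]
  refine le_trans (le_of_eq ?_) (abs_real_inner_le_norm (hf.toLp f) (hg.toLp g))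
  rw [L2.inner_def]
  congr 1
  refine integral_congr_ae ?_
  filter_upwards [hf.coeFn_toLp, hg.coeFn_toLp] with x hx hy
  simp [hx, hy, mul_comm]

lemma l2_le_of_abs_le {c : ℝ} (hc : 0 ≤ c) (hg : MemL2 S g)
    (h : ∀ᵐ x ∂(volume.restrict S), |f x| ≤ c * |g x|) : l2 S f ≤ c * l2 S g := by
  unfold l2
  have := eLpNorm_le_mul_eLpNorm_of_ae_le_mul (f := f) (g := g) (c := c)
    (μ := volume.restrict S) h 2
  rw [← ENNReal.toReal_ofReal hc, ← ENNReal.toReal_mul]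
  exact ENNReal.toReal_mono (ENNReal.mul_ne_top ENNReal.ofReal_ne_top hg.2.ne) this

lemma l2_const_mul_le (c : ℝ) (hg : MemL2 S g) : l2 S (fun x => c * g x) ≤ |c| * l2 S g :=
  l2_le_of_abs_le (abs_nonneg c) hg (ae_of_all _ fun x => by rw [abs_mul])

lemma l2_mono_set (hST : S ⊆ T) (hf : MemL2 T f) : l2 S f ≤ l2 T f :=
  ENNReal.toReal_mono hf.2.ne (eLpNorm_mono_measure f (Measure.restrict_mono hST le_rfl))

lemma MemL2.mono_set (hf : MemL2 T f) (hST : S ⊆ T) : MemL2 S f :=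
  hf.mono_measure (Measure.restrict_mono hST le_rfl)

lemma memL2_of_abs_le {c : ℝ} (hg : MemL2 S g) (hf : AEStronglyMeasurable f (volume.restrict S))
    (h : ∀ᵐ x ∂(volume.restrict S), |f x| ≤ c * |g x|) : MemL2 S f :=
  hg.of_le_mul hf h

lemma l2_eq_zero (hf : MemL2 S f) (h : l2 S f = 0) : ∀ᵐ x ∂(volume.restrict S), f x = 0 := by
  have := (ENNReal.toReal_eq_zero_iff _).1 h
  rcases this with h | h
  · exact (eLpNorm_eq_zero_iff hf.1 (by norm_num)).1 h
  · exact absurd h hf.2.ne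

lemma memL2_of_continuous (hS : Bornology.IsBounded S) (hf : Continuous f) : MemL2 S f := by
  have hc : IsCompact (closure S) := hS.isCompact_closure
  obtain ⟨C, hC⟩ := hc.exists_bound_of_continuousOn hf.continuousOn
  have : IsFiniteMeasure (volume.restrict (closure S)) := ⟨by
    rw [Measure.restrict_apply_univ]; exact hc.measure_lt_top⟩
  refine MemLp.mono_measure (Measure.restrict_mono subset_closure le_rfl)
    (MemLp.of_bound hf.aestronglyMeasurable C ?_)
  exact (ae_restrict_iff' isClosed_closure.measurableSet).2 (ae_of_all _ hC)

lemma IsTestFunction.memL2 {g : E N → ℝ} (hg : IsTestFunction S g) : MemL2 T g :=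
  (hg.contDiff.continuous.memLp_of_hasCompactSupport hg.hasCompactSupport).mono_measure
    Measure.restrict_le_self

/-- An `L²` function orthogonal to a linear space of functions with trivial orthogonal complement
is arbitrarily close to that space. -/
lemma exists_l2_sub_lt (V : Set (E N → ℝ)) (hV : ∀ φ ∈ V, MemL2 S φ)
    (hadd : ∀ φ ∈ V, ∀ ψ ∈ V, (fun x => φ x + ψ x) ∈ V)
    (hsmul : ∀ c : ℝ, ∀ φ ∈ V, (fun x => c * φ x) ∈ V) (hne : V.Nonempty)
    (horth : ∀ v, MemL2 S v → (∀ φ ∈ V, ∫ x in S, v x * φ x = 0) →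
      ∀ᵐ x ∂(volume.restrict S), v x = 0)
    (hf : MemL2 S f) {ε : ℝ} (hε : 0 < ε) : ∃ φ ∈ V, l2 S (fun x => f x - φ x) < ε := by
  obtain ⟨φ₀, hφ₀⟩ := hne
  let K : Submodule ℝ (Lp ℝ 2 (volume.restrict S)) :=
    { carrier := {F | ∃ φ ∈ V, F =ᵐ[volume.restrict S] φ}
      zero_mem' := ⟨_, hsmul 0 _ hφ₀, by
        filter_upwards [Lp.coeFn_zero ℝ 2 (volume.restrict S)] with x hx
        rw [hx]; simp⟩
      add_mem' := by
        rintro F G ⟨φ, hφ, hF⟩ ⟨ψ, hψ, hG⟩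
        refine ⟨_, hadd φ hφ ψ hψ, ?_⟩
        filter_upwards [Lp.coeFn_add F G, hF, hG] with x h1 h2 h3
        rw [h1, Pi.add_apply, h2, h3]
      smul_mem' := by
        rintro c F ⟨φ, hφ, hF⟩
        refine ⟨_, hsmul c φ hφ, ?_⟩
        filter_upwards [Lp.coeFn_smul c F, hF] with x h1 h2
        rw [h1, Pi.smul_apply, h2, smul_eq_mul] }
  -- In a Hilbert space a subspace with trivial orthogonal complement is dense.
  have hK : K.topologicalClosure = ⊤ := by
    rw [Submodule.topologicalClosure_eq_top_iff, Submodule.eq_bot_iff]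
    intro v hv
    have h0 := horth v (Lp.memLp v) fun φ hφ => by
      have h1 := (Submodule.mem_orthogonal' K v).1 hv ((hV φ hφ).toLp φ)
        ⟨φ, hφ, (hV φ hφ).coeFn_toLp⟩
      rw [L2.inner_def] at h1
      rw [← h1]
      refine integral_congr_ae ?_
      filter_upwards [(hV φ hφ).coeFn_toLp] with x hx
      simp [hx, mul_comm]
    exact (Lp.eq_zero_iff_ae_eq_zero).2 h0
  have hmem : hf.toLp f ∈ closure (K : Set (Lp ℝ 2 (volume.restrict S))) := by
    rw [← Submodule.topologicalClosure_coe, hK]; trivial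
  obtain ⟨F, ⟨φ, hφ, hF⟩, hd⟩ := Metric.mem_closure_iff.1 hmem ε hε
  refine ⟨φ, hφ, ?_⟩
  have h : l2 S (fun x => f x - φ x) = ‖hf.toLp f - (hV φ hφ).toLp φ‖ :=
    l2_eq_norm_toLp (hf.sub (hV φ hφ))
  rw [h, ← dist_eq_norm]
  convert hd using 2
  exact Lp.ext ((hV φ hφ).coeFn_toLp.trans hF.symm)

lemma exists_isTestFunction_l2_sub_lt (hS : IsOpen S) (hf : MemL2 S f) {ε : ℝ} (hε : 0 < ε) :
    ∃ φ, IsTestFunction S φ ∧ l2 S (fun x => f x - φ x) < ε := by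
  refine exists_l2_sub_lt {φ | IsTestFunction S φ} (fun φ hφ => hφ.memL2) ?_ ?_ ?_ ?_ hf hε
  · intro φ hφ ψ hψ
    exact ⟨hφ.1.add hψ.1, hφ.2.add hψ.2,
      (tsupport_add φ ψ).trans (Set.union_subset hφ.3 hψ.3)⟩
  · intro c φ hφ
    exact ⟨contDiff_const.mul hφ.1, hφ.2.mul_left, (tsupport_mul_subset_right).trans hφ.3⟩
  · exact ⟨fun _ => 0, contDiff_const, HasCompactSupport.zero, by simp [tsupport]⟩
  · intro v hv h
    have hloc : LocallyIntegrableOn v S := by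
      refine MeasureTheory.locallyIntegrableOn_of_locallyIntegrable_restrict ?_
      exact hv.locallyIntegrable (by norm_num)
    have := hS.ae_eq_zero_of_integral_contDiff_smul_eq_zero hloc fun g h1 h2 h3 => by
      rw [← h g ⟨h1, h2, h3⟩, ← setIntegral_eq_integral_of_forall_compl_eq_zero (s := S)]
      · simp [mul_comm]
      · intro x hx
        rw [image_eq_zero_of_notMem_tsupport fun h => hx (h3 h), zero_smul]
    exact (ae_restrict_iff' hS.measurableSet).2 this

/-- The `L²` norm is controlled by duality with test functions. -/
lemma l2_le_of_forall_isTestFunction (hS : IsOpen S) (hf : MemL2 S f) {K : ℝ} (hK : 0 ≤ K)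
    (h : ∀ g, IsTestFunction S g → |∫ x in S, f x * g x| ≤ K * l2 S g) : l2 S f ≤ K := by
  have ha0 : 0 ≤ l2 S f := l2_nonneg
  have key : ∀ ε > 0, l2 S f ^ 2 ≤ K * l2 S f + ε * (K + l2 S f) := by
    intro ε hε
    obtain ⟨g, hg, hgf⟩ := exists_isTestFunction_l2_sub_lt hS hf hε
    have hgL : MemL2 S g := hg.memL2
    have hfg : MemL2 S (fun x => f x - g x) := hf.sub hgL
    -- Split `f² = f g + f (f - g)`, where `g` is a test function within `ε` of `f`.
    have h1 : l2 S f ^ 2 = (∫ x in S, f x * g x) + ∫ x in S, f x * (f x - g x) := by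
      rw [l2_sq hf, ← integral_add (integrable_mul_of_memL2 hf hgL)
        (integrable_mul_of_memL2 hf hfg)]
      congr 1; ext x; ring
    have h2 : l2 S g ≤ l2 S f + ε := by
      have h3 : l2 S g = l2 S (fun x => f x - (f x - g x)) := by simp
      rw [h3]
      exact (l2_sub_le hf hfg).trans (by linarith)
    have h4 := (le_abs_self _).trans (abs_integral_mul_le hf hfg)
    have h5 := (le_abs_self _).trans (h g hg)
    have h6 : l2 S f * l2 S (fun x => f x - g x) ≤ l2 S f * ε := by gcongr
    have h7 : K * l2 S g ≤ K * (l2 S f + ε) := by gcongr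
    nlinarith
  have h2 : l2 S f ^ 2 ≤ K * l2 S f := by
    refine le_of_forall_pos_le_add fun δ hδ => ?_
    have hp : 0 < K + l2 S f + 1 := by linarith
    refine (key (δ / (K + l2 S f + 1)) (by positivity)).trans ?_
    have : δ / (K + l2 S f + 1) * (K + l2 S f) ≤ δ := by
      rw [div_mul_eq_mul_div, div_le_iff₀ hp]; nlinarith
    linarith
  nlinarith

end L2
end Biharm

/-! ### Classical partial derivatives and the Laplacian. -/

namespace Biharm

/-- The classical Laplacian. -/
noncomputable def lap {N : ℕ} (φ : E N → ℝ) (x : E N) : ℝ :=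
  ∑ i : Fin N, partialDeriv i (partialDeriv i φ) x

section Calculus
variable {N : ℕ} {i j : Fin N} {f g : E N → ℝ} {Ω : Set (E N)}

lemma contDiff_partialDeriv (i : Fin N) (hf : ContDiff ℝ ∞ f) :
    ContDiff ℝ ∞ (partialDeriv i f) :=
  (hf.fderiv_right (m := ∞) (by simp)).clm_apply contDiff_const

lemma contDiff_lap (hf : ContDiff ℝ ∞ f) : ContDiff ℝ ∞ (lap f) :=
  ContDiff.sum fun i _ => contDiff_partialDeriv i (contDiff_partialDeriv i hf)

lemma diffAt_of_contDiff (hf : ContDiff ℝ ∞ f) (x : E N) : DifferentiableAt ℝ f x :=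
  (hf.differentiable (by simp)) x

lemma partialDeriv_add (hf : ContDiff ℝ ∞ f) (hg : ContDiff ℝ ∞ g) :
    partialDeriv i (fun x => f x + g x) = fun x => partialDeriv i f x + partialDeriv i g x := by
  ext x; simp [partialDeriv, fderiv_fun_add (diffAt_of_contDiff hf x) (diffAt_of_contDiff hg x)]

lemma partialDeriv_sub (hf : ContDiff ℝ ∞ f) (hg : ContDiff ℝ ∞ g) :
    partialDeriv i (fun x => f x - g x) = fun x => partialDeriv i f x - partialDeriv i g x := by
  ext x; simp [partialDeriv, fderiv_fun_sub (diffAt_of_contDiff hf x) (diffAt_of_contDiff hg x)]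

lemma partialDeriv_mul (hf : ContDiff ℝ ∞ f) (hg : ContDiff ℝ ∞ g) :
    partialDeriv i (fun x => f x * g x) =
      fun x => f x * partialDeriv i g x + g x * partialDeriv i f x := by
  ext x; simp [partialDeriv, fderiv_fun_mul (diffAt_of_contDiff hf x) (diffAt_of_contDiff hg x)]

lemma partialDeriv_const_mul (c : ℝ) (hf : ContDiff ℝ ∞ f) :
    partialDeriv i (fun x => c * f x) = fun x => c * partialDeriv i f x := by
  ext x; simp [partialDeriv, fderiv_const_mul (diffAt_of_contDiff hf x)]

lemma partialDeriv_sum {ι : Type*} (s : Finset ι) {F : ι → E N → ℝ}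
    (hF : ∀ k ∈ s, ContDiff ℝ ∞ (F k)) :
    partialDeriv i (fun x => ∑ k ∈ s, F k x) = fun x => ∑ k ∈ s, partialDeriv i (F k) x := by
  ext x
  simp [partialDeriv, fderiv_fun_sum fun k hk => diffAt_of_contDiff (hF k hk) x]

lemma partialDeriv_comp_real {γ : ℝ → ℝ} (hγ : ContDiff ℝ ∞ γ) (hf : ContDiff ℝ ∞ f) :
    partialDeriv i (fun x => γ (f x)) = fun x => deriv γ (f x) * partialDeriv i f x := by
  ext x
  have h := ((hγ.differentiable (by simp)) (f x)).hasDerivAt.comp_hasFDerivAt x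
    (diffAt_of_contDiff hf x).hasFDerivAt
  have h2 : fderiv ℝ (fun x => γ (f x)) x = deriv γ (f x) • fderiv ℝ f x := h.fderiv
  simp [partialDeriv, h2]

lemma partialDeriv_coord (i j : Fin N) (x : E N) :
    partialDeriv i (fun y : E N => y j) x = if j = i then 1 else 0 := by
  have : (fun y : E N => y j) = EuclideanSpace.proj (𝕜 := ℝ) j := rfl
  rw [partialDeriv, this, ContinuousLinearMap.fderiv]
  simp

lemma contDiff_coord (j : Fin N) : ContDiff ℝ ∞ (fun y : E N => y j) :=
  (EuclideanSpace.proj (𝕜 := ℝ) j).contDiff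

lemma fderiv_apply_eq_sum (x v : E N) :
    fderiv ℝ f x v = ∑ j, v j * partialDeriv j f x := by
  have hv : v = ∑ j, v j • EuclideanSpace.single j (1 : ℝ) := by
    have := (EuclideanSpace.basisFun (Fin N) ℝ).sum_repr v
    simpa using this.symm
  conv_lhs => rw [hv]
  simp [partialDeriv]

lemma partialDeriv_comm (hf : ContDiff ℝ ∞ f) (x : E N) :
    partialDeriv i (partialDeriv j f) x = partialDeriv j (partialDeriv i f) x := by
  have hd : DifferentiableAt ℝ (fderiv ℝ f) x :=
    ((hf.fderiv_right (m := ∞) (by simp)).differentiable (by simp)) x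
  have hsym : IsSymmSndFDerivAt ℝ f x :=
    (hf.contDiffAt).isSymmSndFDerivAt (by
      rw [minSmoothness_of_isRCLikeNormedField]; exact WithTop.coe_le_coe.2 (le_top (a := (2 : ℕ∞))))
  have h1 : ∀ v w : E N, fderiv ℝ (fun y => fderiv ℝ f y v) x w = fderiv ℝ (fderiv ℝ f) x w v := by
    intro v w
    rw [fderiv_clm_apply hd (differentiableAt_const _)]
    simp
  change fderiv ℝ (fun y => fderiv ℝ f y _) x _ = fderiv ℝ (fun y => fderiv ℝ f y _) x _
  rw [h1, h1]
  exact hsym _ _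

lemma lap_add (hf : ContDiff ℝ ∞ f) (hg : ContDiff ℝ ∞ g) :
    lap (fun x => f x + g x) = fun x => lap f x + lap g x := by
  ext x
  simp [lap, partialDeriv_add hf hg,
    partialDeriv_add (contDiff_partialDeriv _ hf) (contDiff_partialDeriv _ hg),
    Finset.sum_add_distrib]

lemma lap_sub (hf : ContDiff ℝ ∞ f) (hg : ContDiff ℝ ∞ g) :
    lap (fun x => f x - g x) = fun x => lap f x - lap g x := by
  ext x
  simp [lap, partialDeriv_sub hf hg,
    partialDeriv_sub (contDiff_partialDeriv _ hf) (contDiff_partialDeriv _ hg),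
    Finset.sum_sub_distrib]

lemma lap_const_mul (c : ℝ) (hf : ContDiff ℝ ∞ f) :
    lap (fun x => c * f x) = fun x => c * lap f x := by
  ext x
  simp [lap, partialDeriv_const_mul c hf, partialDeriv_const_mul c (contDiff_partialDeriv _ hf),
    Finset.mul_sum]

lemma lap_mul (hf : ContDiff ℝ ∞ f) (hg : ContDiff ℝ ∞ g) :
    lap (fun x => f x * g x) = fun x =>
      f x * lap g x + 2 * (∑ i, partialDeriv i f x * partialDeriv i g x) + g x * lap f x := by
  ext x
  simp only [lap, Finset.mul_sum, ← Finset.sum_add_distrib]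
  refine Finset.sum_congr rfl fun i _ => ?_
  rw [partialDeriv_mul hf hg, partialDeriv_add (hf.mul (contDiff_partialDeriv _ hg))
    (hg.mul (contDiff_partialDeriv _ hf)), partialDeriv_mul hf (contDiff_partialDeriv _ hg),
    partialDeriv_mul hg (contDiff_partialDeriv _ hf)]
  ring

lemma IsTestFunction.partialDeriv (hg : IsTestFunction Ω g) (i : Fin N) :
    IsTestFunction Ω (partialDeriv i g) :=
  ⟨contDiff_partialDeriv i hg.1, hg.2.fderiv_apply ℝ _,
    (tsupport_fderiv_apply_subset ℝ _).trans hg.3⟩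

lemma IsTestFunction.mul_left (hg : IsTestFunction Ω g) (hf : ContDiff ℝ ∞ f) :
    IsTestFunction Ω (fun x => f x * g x) :=
  ⟨hf.mul hg.1, hg.2.mul_left, tsupport_mul_subset_right.trans hg.3⟩

lemma IsTestFunction.sum {ι : Type*} (s : Finset ι) {F : ι → E N → ℝ}
    (hF : ∀ k ∈ s, IsTestFunction Ω (F k)) : IsTestFunction Ω (fun x => ∑ k ∈ s, F k x) := by
  classical
  induction s using Finset.induction_on with
  | empty => exact ⟨by simpa using contDiff_const, by simpa using! HasCompactSupport.zero,
      by simp [tsupport]⟩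
  | insert a s ha ih =>
    simp only [Finset.sum_insert ha]
    have h1 := hF a (Finset.mem_insert_self _ _)
    have h2 := ih fun k hk => hF k (Finset.mem_insert_of_mem hk)
    exact ⟨h1.1.add h2.1, h1.2.add h2.2, (tsupport_add _ _).trans (Set.union_subset h1.3 h2.3)⟩

lemma IsTestFunction.lap (hg : IsTestFunction Ω g) : IsTestFunction Ω (lap g) :=
  IsTestFunction.sum _ fun i _ => (hg.partialDeriv i).partialDeriv i

lemma IsTestFunction.eq_zero (hg : IsTestFunction Ω g) {x : E N} (hx : x ∉ Ω) : g x = 0 :=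
  image_eq_zero_of_notMem_tsupport fun h => hx (hg.3 h)

/-- Integration by parts against a test function. -/
lemma setIntegral_mul_partialDeriv (hf : ContDiff ℝ ∞ f) (hg : IsTestFunction Ω g) (i : Fin N) :
    ∫ x in Ω, f x * partialDeriv i g x = - ∫ x in Ω, partialDeriv i f x * g x := by
  rw [setIntegral_eq_integral_of_forall_compl_eq_zero fun x hx => by
      rw [(hg.partialDeriv i).eq_zero hx, mul_zero],
    setIntegral_eq_integral_of_forall_compl_eq_zero fun x hx => by
      rw [hg.eq_zero hx, mul_zero]]
  refine integral_mul_fderiv_eq_neg_fderiv_mul_of_integrable ?_ ?_ ?_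
    (fun x _ => diffAt_of_contDiff hf x) (fun x _ => diffAt_of_contDiff hg.1 x)
  · exact ((contDiff_partialDeriv i hf).continuous.mul
      hg.1.continuous).integrable_of_hasCompactSupport hg.2.mul_left
  · exact (hf.continuous.mul
      (hg.partialDeriv i).1.continuous).integrable_of_hasCompactSupport (hg.partialDeriv i).2.mul_left
  · exact (hf.continuous.mul hg.1.continuous).integrable_of_hasCompactSupport hg.2.mul_left

end Calculus
end Biharm

/-! ### Weak derivatives and Sobolev spaces. -/

namespace Biharm

section Weak
variable {N : ℕ} {i : Fin N} {u u' g g' φ : E N → ℝ} {Ω : Set (E N)}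

lemma locallyIntegrableOn_of_memL2 (hu : MemL2 Ω u) : LocallyIntegrableOn u Ω :=
  locallyIntegrableOn_of_locallyIntegrable_restrict (hu.locallyIntegrable (by norm_num))

lemma integrable_mul_testFunction (hu : LocallyIntegrableOn u Ω) (hφ : IsTestFunction Ω φ) :
    IntegrableOn (fun x => u x * φ x) Ω := by
  have hK : IsCompact (tsupport φ) := hφ.2
  have h1 : IntegrableOn (fun x => u x * φ x) (tsupport φ) :=
    (hu.integrableOn_compact_subset hφ.3 hK).mul_continuousOn hφ.1.continuous.continuousOn hK
  have h2 : Integrable (fun x => u x * φ x) := by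
    rw [← integrableOn_iff_integrable_of_support_subset (s := tsupport φ)]
    · exact h1
    · intro x hx
      by_contra h
      exact hx (by simp [image_eq_zero_of_notMem_tsupport h])
  exact h2.integrableOn

lemma ae_eq_of_forall_testFunction (hΩ : IsOpen Ω) (hg : LocallyIntegrableOn g Ω)
    (hg' : LocallyIntegrableOn g' Ω)
    (h : ∀ φ, IsTestFunction Ω φ → ∫ x in Ω, g x * φ x = ∫ x in Ω, g' x * φ x) :
    ∀ᵐ x ∂(volume.restrict Ω), g x = g' x := by
  have := hΩ.ae_eq_zero_of_integral_contDiff_smul_eq_zero (hg.sub hg') fun φ h1 h2 h3 => by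
    have hφ : IsTestFunction Ω φ := ⟨h1, h2, h3⟩
    rw [← setIntegral_eq_integral_of_forall_compl_eq_zero (s := Ω)
      fun x hx => by rw [hφ.eq_zero hx, zero_smul]]
    rw [← sub_eq_zero.2 (h φ hφ), ← integral_sub (integrable_mul_testFunction hg hφ)
      (integrable_mul_testFunction hg' hφ)]
    congr 1; ext x; simp; ring
  rw [ae_restrict_iff' hΩ.measurableSet]
  filter_upwards [this] with x hx hxΩ
  exact sub_eq_zero.1 (hx hxΩ)

lemma HasWeakPartial.ae_eq (hΩ : IsOpen Ω) (h : HasWeakPartial Ω i u g)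
    (h' : HasWeakPartial Ω i u' g') (huu' : ∀ᵐ x ∂(volume.restrict Ω), u x = u' x) :
    ∀ᵐ x ∂(volume.restrict Ω), g x = g' x := by
  refine ae_eq_of_forall_testFunction hΩ h.2 h'.2 fun φ hφ => ?_
  have h1 := h.3 φ hφ
  have h2 := h'.3 φ hφ
  have h3 : ∫ x in Ω, u x * partialDeriv i φ x = ∫ x in Ω, u' x * partialDeriv i φ x :=
    integral_congr_ae (by filter_upwards [huu'] with x hx; rw [hx])
  linarith

lemma locallyIntegrableOn_congr_ae (hΩ : IsOpen Ω) (h : LocallyIntegrableOn u Ω)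
    (huu' : ∀ᵐ x ∂(volume.restrict Ω), u x = u' x) : LocallyIntegrableOn u' Ω := by
  rw [locallyIntegrableOn_iff hΩ.isLocallyClosed] at h ⊢
  intro K hK hc
  exact (h K hK hc).congr (ae_restrict_of_ae_restrict_of_subset hK huu')

lemma HasWeakPartial.congr_left (hΩ : IsOpen Ω) (h : HasWeakPartial Ω i u g)
    (huu' : ∀ᵐ x ∂(volume.restrict Ω), u x = u' x) : HasWeakPartial Ω i u' g := by
  refine ⟨locallyIntegrableOn_congr_ae hΩ h.1 huu', h.2, fun φ hφ => ?_⟩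
  rw [← h.3 φ hφ]
  exact integral_congr_ae (by filter_upwards [huu'] with x hx; rw [hx])

lemma HasWeakPartial.weakPartial (h : HasWeakPartial Ω i u g) :
    HasWeakPartial Ω i u (weakPartial Ω i u) := by
  have hex : ∃ g, HasWeakPartial Ω i u g := ⟨g, h⟩
  unfold Biharm.weakPartial
  rw [dif_pos hex]
  exact hex.choose_spec

lemma HasWeakPartial.weakPartial_ae_eq (hΩ : IsOpen Ω) (h : HasWeakPartial Ω i u g) :
    ∀ᵐ x ∂(volume.restrict Ω), Biharm.weakPartial Ω i u x = g x :=
  h.weakPartial.ae_eq hΩ h (ae_of_all _ fun _ => rfl)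

lemma hasWeakPartial_of_contDiff (hφ : ContDiff ℝ ∞ φ) (i : Fin N) :
    HasWeakPartial Ω i φ (partialDeriv i φ) :=
  ⟨hφ.continuous.locallyIntegrable.locallyIntegrableOn _,
    (contDiff_partialDeriv i hφ).continuous.locallyIntegrable.locallyIntegrableOn _,
    fun _ hη => setIntegral_mul_partialDeriv hφ hη i⟩

lemma weakPartial_ae_eq_of_contDiff (hΩ : IsOpen Ω) (hφ : ContDiff ℝ ∞ φ) (i : Fin N) :
    ∀ᵐ x ∂(volume.restrict Ω), weakPartial Ω i φ x = partialDeriv i φ x :=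
  (hasWeakPartial_of_contDiff hφ i).weakPartial_ae_eq hΩ

lemma weakLaplacian_ae_eq_of_contDiff (hΩ : IsOpen Ω) (hφ : ContDiff ℝ ∞ φ) :
    ∀ᵐ x ∂(volume.restrict Ω), weakLaplacian Ω φ x = lap φ x := by
  have h : ∀ i : Fin N, ∀ᵐ x ∂(volume.restrict Ω),
      weakPartial Ω i (weakPartial Ω i φ) x = partialDeriv i (partialDeriv i φ) x := by
    intro i
    refine HasWeakPartial.weakPartial_ae_eq hΩ ?_
    refine (hasWeakPartial_of_contDiff (contDiff_partialDeriv i hφ) i).congr_left hΩ ?_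
    filter_upwards [weakPartial_ae_eq_of_contDiff hΩ hφ i] with x hx using hx.symm
  filter_upwards [ae_all_iff.2 h] with x hx
  simp [weakLaplacian, lap, hx]

lemma memH_of_contDiff (hb : Bornology.IsBounded Ω) (k : ℕ) :
    ∀ {φ : E N → ℝ}, ContDiff ℝ ∞ φ → MemH Ω k φ := by
  induction k with
  | zero => intro φ hφ; exact memL2_of_continuous hb hφ.continuous
  | succ k ih =>
    intro φ hφ
    exact ⟨memL2_of_continuous hb hφ.continuous, fun i =>
      ⟨_, hasWeakPartial_of_contDiff hφ i, ih (contDiff_partialDeriv i hφ)⟩⟩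

lemma MemH.memL2 {k : ℕ} (h : MemH Ω k u) : MemL2 Ω u := by
  cases k with
  | zero => exact h
  | succ k => exact h.1

lemma MemH.hasWeakPartial {k : ℕ} (h : MemH Ω (k + 1) u) (i : Fin N) :
    HasWeakPartial Ω i u (weakPartial Ω i u) := by
  obtain ⟨g, hg, -⟩ := h.2 i
  exact hg.weakPartial

lemma MemH.memL2_weakPartial (hΩ : IsOpen Ω) {k : ℕ} (h : MemH Ω (k + 1) u) (i : Fin N) :
    MemL2 Ω (weakPartial Ω i u) := by
  obtain ⟨g, hg, hgk⟩ := h.2 i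
  refine (memLp_congr_ae ?_).1 hgk.memL2
  filter_upwards [hg.weakPartial_ae_eq hΩ] with x hx using hx.symm

/-- `MemH` provides a second derivative of some first derivative `g`, whereas `weakPartial` is a
chosen representative; almost everywhere uniqueness transfers one to the other. -/
lemma MemH.hasWeakPartial_two (hΩ : IsOpen Ω) (h : MemH Ω 2 u) (i : Fin N) :
    HasWeakPartial Ω i (weakPartial Ω i u) (weakPartial Ω i (weakPartial Ω i u)) ∧
      MemL2 Ω (weakPartial Ω i (weakPartial Ω i u)) := by
  obtain ⟨g, hg, hg1⟩ := h.2 i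
  obtain ⟨g2, hg2, hg20⟩ := hg1.2 i
  have h1 : HasWeakPartial Ω i (weakPartial Ω i u) g2 := by
    refine hg2.congr_left hΩ ?_
    filter_upwards [hg.weakPartial_ae_eq hΩ] with x hx using hx.symm
  refine ⟨h1.weakPartial, (memLp_congr_ae ?_).1 hg20.memL2⟩
  filter_upwards [h1.weakPartial_ae_eq hΩ] with x hx using hx.symm

lemma MemH.memL2_weakLaplacian (hΩ : IsOpen Ω) (h : MemH Ω 2 u) :
    MemL2 Ω (weakLaplacian Ω u) :=
  memLp_finsetSum _ fun i _ => (h.hasWeakPartial_two hΩ i).2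

/-- The distributional identity `∫ u Δη = ∫ (Δu) η`. -/
lemma MemH.integral_mul_lap (hΩ : IsOpen Ω) (h : MemH Ω 2 u) {η : E N → ℝ}
    (hη : IsTestFunction Ω η) :
    ∫ x in Ω, u x * lap η x = ∫ x in Ω, weakLaplacian Ω u x * η x := by
  simp only [lap, weakLaplacian, Finset.mul_sum, Finset.sum_mul]
  rw [integral_finsetSum, integral_finsetSum]
  · refine Finset.sum_congr rfl fun i _ => ?_
    rw [(MemH.hasWeakPartial h i).3 _ (hη.partialDeriv i),
      (h.hasWeakPartial_two hΩ i).1.3 _ hη, neg_neg]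
  · exact fun i _ => integrable_mul_of_memL2 (h.hasWeakPartial_two hΩ i).2 hη.memL2
  · exact fun i _ => integrable_mul_of_memL2 h.memL2 ((hη.partialDeriv i).partialDeriv i).memL2

lemma tendsto_integral_mul_of_tendsto_eLpNorm {F : ℕ → E N → ℝ} (hF : ∀ n, MemL2 Ω (F n))
    (hu : MemL2 Ω u) (hg : MemL2 Ω g)
    (h : Tendsto (fun n => eLpNorm (fun x => F n x - u x) 2 (volume.restrict Ω)) atTop (𝓝 0)) :
    Tendsto (fun n => ∫ x in Ω, g x * F n x) atTop (𝓝 (∫ x in Ω, g x * u x)) := by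
  have h0 : Tendsto (fun n => l2 Ω g * l2 Ω (fun x => F n x - u x)) atTop (𝓝 0) := by
    have := ((ENNReal.tendsto_toReal (by norm_num)).comp h).const_mul (l2 Ω g)
    simpa [l2] using this
  refine tendsto_iff_norm_sub_tendsto_zero.2 (squeeze_zero (fun _ => norm_nonneg _) (fun n => ?_) h0)
  have hd : MemL2 Ω (fun x => F n x - u x) := (hF n).sub hu
  rw [← integral_sub (integrable_mul_of_memL2 hg (hF n)) (integrable_mul_of_memL2 hg hu),
    Real.norm_eq_abs]
  simpa only [mul_sub] using abs_integral_mul_le hg hd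

/-- Integration by parts between `H¹` and `H¹₀`. -/
lemma MemH10.integral_mul_weakPartial (hΩ : IsOpen Ω) (hu : MemH10 Ω u)
    (hg : HasWeakPartial Ω i g g') (hgL : MemL2 Ω g) (hgL' : MemL2 Ω g') :
    ∫ x in Ω, g x * weakPartial Ω i u x = - ∫ x in Ω, g' x * u x := by
  obtain ⟨h1, φ, hφ, hc, hd⟩ := hu
  have t1 := tendsto_integral_mul_of_tendsto_eLpNorm (fun n => (hφ n).memL2) h1.memL2 hgL' hc
  have t2 := tendsto_integral_mul_of_tendsto_eLpNorm (fun n => ((hφ n).partialDeriv i).memL2)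
    (h1.memL2_weakPartial hΩ i) hgL (hd i)
  refine tendsto_nhds_unique t2 (t1.neg.congr fun n => ?_)
  rw [hg.3 _ (hφ n)]

end Weak
end Biharm

/-! ### Smooth functions vanishing on the boundary: membership in `H¹₀`, Green, Poincaré. -/

namespace Biharm

/-- Smooth functions vanishing on the boundary of `Ω`. -/
structure IsDirichlet {N : ℕ} (Ω : Set (E N)) (φ : E N → ℝ) : Prop where
  contDiff : ContDiff ℝ ∞ φ
  eq_zero : ∀ x ∈ frontier Ω, φ x = 0

/-- A smooth truncation of the identity, vanishing near the origin. -/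
noncomputable def trunc (s : ℝ) : ℝ := s * Real.smoothTransition (s ^ 2 - 1)

lemma contDiff_trunc : ContDiff ℝ ∞ trunc :=
  contDiff_id.mul (Real.smoothTransition.contDiff.comp ((contDiff_id.pow 2).sub contDiff_const))

lemma trunc_of_abs_le {s : ℝ} (h : |s| ≤ 1) : trunc s = 0 := by
  have : s ^ 2 ≤ 1 := by rw [← sq_abs]; nlinarith [abs_nonneg s]
  simp [trunc, Real.smoothTransition.zero_of_nonpos (sub_nonpos.2 this)]

lemma abs_trunc_le (s : ℝ) : |trunc s| ≤ |s| := by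
  rw [trunc, abs_mul, abs_of_nonneg (Real.smoothTransition.nonneg _)]
  exact mul_le_of_le_one_right (abs_nonneg s) (Real.smoothTransition.le_one _)

lemma trunc_of_two_le_abs {s : ℝ} (h : 2 ≤ |s|) : trunc s = s := by
  have : 1 ≤ s ^ 2 - 1 := by rw [← sq_abs]; nlinarith
  simp [trunc, Real.smoothTransition.one_of_one_le this]

lemma deriv_trunc_of_two_lt_abs {s : ℝ} (h : 2 < |s|) : deriv trunc s = 1 := by
  have : trunc =ᶠ[𝓝 s] id := by
    filter_upwards [(continuous_abs.isOpen_preimage _ isOpen_Ioi).mem_nhds h] with t ht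
    exact trunc_of_two_le_abs (le_of_lt ht)
  rw [this.deriv_eq, deriv_id]

lemma exists_abs_deriv_trunc_le : ∃ C, ∀ s, |deriv trunc s| ≤ C := by
  have hc : Continuous (deriv trunc) := contDiff_trunc.continuous_deriv (by simp)
  obtain ⟨C, hC⟩ := (isCompact_Icc (a := (-2 : ℝ)) (b := 2)).exists_bound_of_continuousOn
    hc.continuousOn
  refine ⟨max C 1, fun s => ?_⟩
  rcases le_or_gt |s| 2 with h | h
  · exact (hC s (abs_le.1 h)).trans (le_max_left _ _)
  · rw [deriv_trunc_of_two_lt_abs h]; simp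

section Dirichlet
variable {N : ℕ} {i : Fin N} {φ ψ : E N → ℝ} {Ω : Set (E N)}

lemma IsDirichlet.mul_contDiff (h : IsDirichlet Ω φ) (hψ : ContDiff ℝ ∞ ψ) :
    IsDirichlet Ω (fun x => φ x * ψ x) :=
  ⟨h.1.mul hψ, fun x hx => by simp [h.2 x hx]⟩

lemma IsDirichlet.add (h : IsDirichlet Ω φ) (h' : IsDirichlet Ω ψ) :
    IsDirichlet Ω (fun x => φ x + ψ x) :=
  ⟨h.1.add h'.1, fun x hx => by simp [h.2 x hx, h'.2 x hx]⟩

lemma IsDirichlet.sub (h : IsDirichlet Ω φ) (h' : IsDirichlet Ω ψ) :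
    IsDirichlet Ω (fun x => φ x - ψ x) :=
  ⟨h.1.sub h'.1, fun x hx => by simp [h.2 x hx, h'.2 x hx]⟩

lemma IsDirichlet.const_mul (c : ℝ) (h : IsDirichlet Ω φ) :
    IsDirichlet Ω (fun x => c * φ x) :=
  ⟨contDiff_const.mul h.1, fun x hx => by simp [h.2 x hx]⟩

/-- Truncating a function that vanishes on the boundary gives a test function. -/
lemma IsDirichlet.isTestFunction_indicator (hΩ : IsOpen Ω) (hb : Bornology.IsBounded Ω)
    (h : IsDirichlet Ω φ) {T : ℝ → ℝ} (hT : ContDiff ℝ ∞ T) {ε : ℝ} (hε : 0 < ε)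
    (hT0 : ∀ s, |s| ≤ ε → T s = 0) :
    IsTestFunction Ω (Ω.indicator fun x => T (φ x)) := by
  have hcl : IsClosed (closure Ω ∩ {x | ε ≤ |φ x|}) :=
    isClosed_closure.inter (isClosed_le continuous_const h.1.continuous.abs)
  have hsub : tsupport (Ω.indicator fun x => T (φ x)) ⊆ closure Ω ∩ {x | ε ≤ |φ x|} := by
    refine closure_minimal (fun x hx => ?_) hcl
    have hxΩ : x ∈ Ω := by
      by_contra hn; exact hx (Set.indicator_of_notMem hn _)
    refine ⟨subset_closure hxΩ, ?_⟩
    by_contra! hn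
    exact hx (by rw [Set.indicator_of_mem hxΩ, hT0 _ (le_of_lt (by simpa using hn))])
  have hsub' : closure Ω ∩ {x | ε ≤ |φ x|} ⊆ Ω := by
    rintro x ⟨hx, hx'⟩
    by_contra hn
    have : x ∈ frontier Ω := by rw [frontier, hΩ.interior_eq]; exact ⟨hx, hn⟩
    have h0 := h.2 x this
    simp only [Set.mem_ofPred_eq, h0, abs_zero] at hx'
    linarith
  refine ⟨?_, ?_, hsub.trans hsub'⟩
  · rw [contDiff_iff_contDiffAt]
    intro x
    by_cases hx : x ∈ Ω
    · refine (hT.comp h.1).contDiffAt.congr_of_eventuallyEq ?_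
      filter_upwards [hΩ.mem_nhds hx] with y hy
      exact Set.indicator_of_mem hy _
    · have hx' : x ∈ (tsupport (Ω.indicator fun x => T (φ x)))ᶜ := fun hm => hx (hsub' (hsub hm))
      refine (contDiffAt_const (c := (0 : ℝ))).congr_of_eventuallyEq ?_
      filter_upwards [(isClosed_tsupport _).isOpen_compl.mem_nhds hx'] with y hy
      exact image_eq_zero_of_notMem_tsupport hy
  · exact hb.isCompact_closure.of_isClosed_subset (isClosed_tsupport _)
      (hsub.trans Set.inter_subset_left)

lemma tendsto_eLpNorm_zero_of_bounded (hb : Bornology.IsBounded Ω) {F : ℕ → E N → ℝ} {C : ℝ}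
    (hF : ∀ n, AEStronglyMeasurable (F n) (volume.restrict Ω))
    (hC : ∀ n, ∀ᵐ x ∂(volume.restrict Ω), |F n x| ≤ C)
    (hlim : ∀ᵐ x ∂(volume.restrict Ω), Tendsto (fun n => F n x) atTop (𝓝 0)) :
    Tendsto (fun n => eLpNorm (F n) 2 (volume.restrict Ω)) atTop (𝓝 0) := by
  have hfin : IsFiniteMeasure (volume.restrict Ω) := ⟨by
    rw [Measure.restrict_apply_univ]; exact hb.measure_lt_top⟩
  have hmem : ∀ n, MemL2 Ω (F n) := fun n => MemLp.of_bound (hF n) C (hC n)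
  have h1 : Tendsto (fun n => ∫ x in Ω, F n x ^ 2) atTop (𝓝 (∫ x in Ω, (0 : ℝ))) := by
    refine tendsto_integral_of_dominated_convergence (fun _ => C ^ 2)
      (fun n => (hF n).pow 2) (integrable_const _) (fun n => ?_) ?_
    · filter_upwards [hC n] with x hx
      rw [Real.norm_eq_abs, abs_pow]
      gcongr
    · filter_upwards [hlim] with x hx
      simpa using hx.pow 2
  have h2 : Tendsto (fun n => l2 Ω (F n)) atTop (𝓝 0) := by
    have h3 := (Real.continuous_sqrt.tendsto _).comp h1
    simp only [integral_zero, Real.sqrt_zero] at h3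
    refine h3.congr fun n => ?_
    rw [Function.comp_apply, ← l2_sq (hmem n), Real.sqrt_sq l2_nonneg]
  have h4 := ENNReal.tendsto_ofReal h2
  rw [ENNReal.ofReal_zero] at h4
  refine h4.congr fun n => ?_
  rw [l2, ENNReal.ofReal_toReal (hmem n).2.ne]

/-- The approximating test functions are truncations of `φ` at small height, so the argument needs
no regularity of the boundary. Convergence of gradients relies on `∇φ = 0` almost everywhere on `{φ
= 0}`. -/
lemma IsDirichlet.memH10 (hΩ : IsOpen Ω) (hb : Bornology.IsBounded Ω) (h : IsDirichlet Ω φ) :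
    MemH10 Ω φ := by
  obtain ⟨C, hC⟩ := exists_abs_deriv_trunc_le
  have hC0 : 0 ≤ C := (abs_nonneg _).trans (hC 0)
  -- Rescaled truncation: zero for `|s| ≤ 1/(n+1)`, the identity for `|s| ≥ 2/(n+1)`, with
  -- derivative bounded independently of `n`.
  let T : ℕ → ℝ → ℝ := fun n s => ((n : ℝ) + 1)⁻¹ * trunc (((n : ℝ) + 1) * s)
  have hn : ∀ n : ℕ, (0 : ℝ) < (n : ℝ) + 1 := fun n => by positivity
  have hT : ∀ n, ContDiff ℝ ∞ (T n) := fun n =>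
    contDiff_const.mul (contDiff_trunc.comp (contDiff_const.mul contDiff_id))
  have hTd : ∀ n s, deriv (T n) s = deriv trunc (((n : ℝ) + 1) * s) := by
    intro n s
    have h1 : HasDerivAt trunc (deriv trunc (((n : ℝ) + 1) * s)) (((n : ℝ) + 1) * s) :=
      ((contDiff_trunc.differentiable (by simp)) _).hasDerivAt
    have h2 : HasDerivAt (fun s : ℝ => ((n : ℝ) + 1) * s) ((n : ℝ) + 1) s := by
      simpa using (hasDerivAt_id s).const_mul ((n : ℝ) + 1)
    have h3 := (h1.comp s h2).const_mul (((n : ℝ) + 1)⁻¹)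
    have h4 : deriv (T n) s = _ := h3.deriv
    rw [h4]; field_simp [(hn n).ne']
  have hT0 : ∀ (n : ℕ) (s : ℝ), |s| ≤ ((n : ℝ) + 1)⁻¹ → T n s = 0 := by
    intro n s hs
    have : |((n : ℝ) + 1) * s| ≤ 1 := by
      rw [abs_mul, abs_of_pos (hn n)]
      calc ((n : ℝ) + 1) * |s| ≤ ((n : ℝ) + 1) * ((n : ℝ) + 1)⁻¹ := by
            have := hn n; gcongr
        _ = 1 := mul_inv_cancel₀ (hn n).ne'
    simp [T, trunc_of_abs_le this]
  have hTle : ∀ n s, |T n s| ≤ |s| := by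
    intro n s
    have := abs_trunc_le (((n : ℝ) + 1) * s)
    simp only [T]
    rw [abs_mul, abs_of_pos (inv_pos.2 (hn n)), inv_mul_le_iff₀ (hn n)]
    rwa [abs_mul, abs_of_pos (hn n)] at this
  have hbig : ∀ s : ℝ, s ≠ 0 → ∀ᶠ n : ℕ in atTop, 2 < |((n : ℝ) + 1) * s| := by
    intro s hs
    have h1 : Tendsto (fun n : ℕ => ((n : ℝ) + 1) * |s|) atTop atTop :=
      (tendsto_natCast_atTop_atTop.atTop_add tendsto_const_nhds).atTop_mul_const (abs_pos.2 hs)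
    filter_upwards [h1.eventually_gt_atTop 2] with n h2
    rwa [abs_mul, abs_of_pos (hn n)]
  have hTlim : ∀ s, Tendsto (fun n => T n s) atTop (𝓝 s) := by
    intro s
    by_cases hs : s = 0
    · have : ∀ n, T n s = s := fun n => by
        rw [hs]; exact hT0 n 0 (by simp; exact (hn n).le)
      simp [this]
    · refine tendsto_const_nhds.congr' ?_
      filter_upwards [hbig s hs] with n h2
      simp only [T]
      rw [trunc_of_two_le_abs h2.le, inv_mul_cancel_left₀ (hn n).ne']
  let F : ℕ → E N → ℝ := fun n => Ω.indicator fun x => T n (φ x)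
  have hF : ∀ n, IsTestFunction Ω (F n) := fun n =>
    h.isTestFunction_indicator hΩ hb (hT n) (inv_pos.2 (hn n)) (hT0 n)
  have hFΩ : ∀ n, ∀ x ∈ Ω, F n x = T n (φ x) := fun n x hx => Set.indicator_of_mem hx _
  have hFd : ∀ n i, ∀ x ∈ Ω, partialDeriv i (F n) x =
      deriv trunc (((n : ℝ) + 1) * φ x) * partialDeriv i φ x := by
    intro n i x hx
    have he : F n =ᶠ[𝓝 x] fun x => T n (φ x) := by
      filter_upwards [hΩ.mem_nhds hx] with y hy using hFΩ n y hy
    rw [partialDeriv, he.fderiv_eq, ← hTd]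
    exact congrFun (partialDeriv_comp_real (hT n) h.1) x
  have hcpt : IsCompact (closure Ω) := hb.isCompact_closure
  have hbd : ∀ f : E N → ℝ, Continuous f → ∃ M, 0 ≤ M ∧ ∀ x ∈ Ω, |f x| ≤ M := by
    intro f hf
    obtain ⟨M, hM⟩ := hcpt.exists_bound_of_continuousOn hf.continuousOn
    exact ⟨max M 0, le_max_right _ _, fun x hx =>
      (hM x (subset_closure hx)).trans (le_max_left _ _)⟩
  have hae : ∀ {p : E N → Prop}, (∀ x ∈ Ω, p x) → ∀ᵐ x ∂(volume.restrict Ω), p x := fun hp =>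
    (ae_restrict_iff' hΩ.measurableSet).2 (ae_of_all _ hp)
  -- the gradient vanishes almost everywhere on the zero set
  have hzero : ∀ i, ∀ᵐ x ∂(volume.restrict Ω), φ x = 0 → partialDeriv i φ x = 0 := by
    intro i
    classical
    -- Letting `n → ∞` in the integration by parts for `F n` shows that `G` is also a weak
    -- derivative of `φ`; uniqueness then identifies it with the classical one.
    let G : E N → ℝ := {x | φ x = 0}ᶜ.indicator (partialDeriv i φ)
    have hms : MeasurableSet {x | φ x = 0} :=
      (isClosed_eq h.1.continuous continuous_const).measurableSet
    obtain ⟨M, hM0, hM⟩ := hbd _ (contDiff_partialDeriv i h.1).continuous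
    have hGL : MemL2 Ω G :=
      (memL2_of_continuous hb (contDiff_partialDeriv i h.1).continuous).indicator hms.compl
    have hG : HasWeakPartial Ω i φ G := by
      refine ⟨locallyIntegrableOn_of_memL2 (memL2_of_continuous hb h.1.continuous),
        locallyIntegrableOn_of_memL2 hGL, fun η hη => ?_⟩
      have t1 : Tendsto (fun n => ∫ x in Ω, F n x * partialDeriv i η x) atTop
          (𝓝 (∫ x in Ω, φ x * partialDeriv i η x)) := by
        have hint := integrable_mul_of_memL2 (memL2_of_continuous hb h.1.continuous)
          ((hη.partialDeriv i).memL2 (T := Ω))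
        refine tendsto_integral_of_dominated_convergence _
          (fun n => ((hF n).1.continuous.mul (hη.partialDeriv i).1.continuous).aestronglyMeasurable)
          hint.norm (fun n => hae fun x hx => ?_) (hae fun x hx => ?_)
        · rw [norm_mul, norm_mul, hFΩ n x hx]
          gcongr
          exact hTle n _
        · refine Tendsto.mul_const _ ?_
          simpa only [hFΩ _ x hx] using hTlim (φ x)
      have t2 : Tendsto (fun n => ∫ x in Ω, partialDeriv i (F n) x * η x) atTop
          (𝓝 (∫ x in Ω, G x * η x)) := by
        have hint := integrable_mul_of_memL2
          (memL2_of_continuous hb (contDiff_partialDeriv i h.1).continuous) (hη.memL2 (T := Ω))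
        refine tendsto_integral_of_dominated_convergence _
          (fun n => (((hF n).partialDeriv i).1.continuous.mul hη.1.continuous).aestronglyMeasurable)
          (hint.norm.const_mul C) (fun n => hae fun x hx => ?_) (hae fun x hx => ?_)
        · rw [hFd n i x hx, norm_mul, norm_mul, norm_mul, mul_assoc]
          gcongr
          exact hC _
        · refine Tendsto.mul_const _ ?_
          simp only [hFd _ i x hx]
          by_cases hx0 : φ x = 0
          · have hev : deriv trunc 0 = 0 := by
              have : trunc =ᶠ[𝓝 0] fun _ => (0 : ℝ) := by
                filter_upwards [Metric.closedBall_mem_nhds (0 : ℝ) one_pos] with t ht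
                exact trunc_of_abs_le (by simpa using ht)
              rw [this.deriv_eq, deriv_const]
            simp [G, hx0, hev]
          · have : G x = 1 * partialDeriv i φ x := by simp [G, hx0]
            rw [this]
            refine Tendsto.mul_const _ (tendsto_const_nhds.congr' ?_)
            filter_upwards [hbig _ hx0] with n h2
            rw [deriv_trunc_of_two_lt_abs h2]
      refine tendsto_nhds_unique t1 (t2.neg.congr fun n => ?_)
      rw [setIntegral_mul_partialDeriv (hF n).1 hη]
    filter_upwards [hG.ae_eq hΩ (hasWeakPartial_of_contDiff h.1 i) (ae_of_all _ fun _ => rfl)]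
      with x hx hx0
    rw [← hx]; simp [G, hx0]
  refine ⟨memH_of_contDiff hb 1 h.1, F, hF, ?_, fun i => ?_⟩
  · obtain ⟨M, hM0, hM⟩ := hbd _ h.1.continuous
    refine tendsto_eLpNorm_zero_of_bounded (C := M + M) hb
      (fun n => ((hF n).1.continuous.sub h.1.continuous).aestronglyMeasurable)
      (fun n => hae fun x hx => ?_) (hae fun x hx => ?_)
    · refine (abs_sub _ _).trans (add_le_add ?_ (hM x hx))
      rw [hFΩ n x hx]
      exact (hTle n _).trans (hM x hx)
    · simp only [hFΩ _ x hx]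
      simpa using (hTlim (φ x)).sub_const (φ x)
  · obtain ⟨M, hM0, hM⟩ := hbd _ (contDiff_partialDeriv i h.1).continuous
    have hkey : Tendsto (fun n => eLpNorm (fun x => partialDeriv i (F n) x - partialDeriv i φ x) 2
        (volume.restrict Ω)) atTop (𝓝 0) := by
      refine tendsto_eLpNorm_zero_of_bounded (C := C * M + M) hb
        (fun n => ((contDiff_partialDeriv i (hF n).1).continuous.sub
          (contDiff_partialDeriv i h.1).continuous).aestronglyMeasurable)
        (fun n => hae fun x hx => ?_) ?_
      · refine (abs_sub _ _).trans (add_le_add ?_ (hM x hx))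
        rw [hFd n i x hx, abs_mul]
        exact mul_le_mul (hC _) (hM x hx) (abs_nonneg _) hC0
      · filter_upwards [hzero i, hae fun x hx => hx] with x hx0 hx
        simp only [hFd _ i x hx]
        by_cases h0 : φ x = 0
        · simp [hx0 h0]
        · refine tendsto_const_nhds.congr' ?_
          filter_upwards [hbig _ h0] with n h2
          rw [deriv_trunc_of_two_lt_abs h2, one_mul, sub_self]
    refine hkey.congr fun n => eLpNorm_congr_ae ?_
    filter_upwards [weakPartial_ae_eq_of_contDiff hΩ h.1 i] with x hx
    rw [hx]

lemma IsDirichlet.integral_mul_partialDeriv (hΩ : IsOpen Ω) (hb : Bornology.IsBounded Ω)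
    (h : IsDirichlet Ω φ) (hψ : ContDiff ℝ ∞ ψ) (i : Fin N) :
    ∫ x in Ω, ψ x * partialDeriv i φ x = - ∫ x in Ω, partialDeriv i ψ x * φ x := by
  rw [← (h.memH10 hΩ hb).integral_mul_weakPartial hΩ (hasWeakPartial_of_contDiff hψ i)
    (memL2_of_continuous hb hψ.continuous)
    (memL2_of_continuous hb (contDiff_partialDeriv i hψ).continuous)]
  refine integral_congr_ae ?_
  filter_upwards [weakPartial_ae_eq_of_contDiff hΩ h.1 i] with x hx
  rw [hx]

/-- Green's identity. -/
lemma IsDirichlet.integral_mul_lap (hΩ : IsOpen Ω) (hb : Bornology.IsBounded Ω)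
    (h : IsDirichlet Ω φ) (hψ : ContDiff ℝ ∞ ψ) :
    ∫ x in Ω, φ x * lap ψ x = - ∑ i, ∫ x in Ω, partialDeriv i ψ x * partialDeriv i φ x := by
  simp only [lap, Finset.mul_sum]
  rw [integral_finsetSum, ← Finset.sum_neg_distrib]
  · refine Finset.sum_congr rfl fun i _ => ?_
    rw [h.integral_mul_partialDeriv hΩ hb (contDiff_partialDeriv i hψ) i, neg_neg]
    congr 1; ext x; ring
  · exact fun i _ => integrable_mul_of_memL2 (memL2_of_continuous hb h.1.continuous)
      (memL2_of_continuous hb (contDiff_partialDeriv i (contDiff_partialDeriv i hψ)).continuous)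

/-- Poincaré's inequality. -/
lemma exists_l2_le_mul_l2_partialDeriv (hΩ : IsOpen Ω) (hb : Bornology.IsBounded Ω) (i : Fin N) :
    ∃ C, 0 ≤ C ∧ ∀ φ, IsDirichlet Ω φ → l2 Ω φ ≤ C * l2 Ω (partialDeriv i φ) := by
  obtain ⟨R, hR⟩ := hb.exists_norm_le
  refine ⟨2 * |R|, by positivity, fun φ h => ?_⟩
  have hL := memL2_of_continuous hb h.1.continuous
  have hdL := memL2_of_continuous hb (contDiff_partialDeriv i h.1).continuous
  have hxL : MemL2 Ω (fun x => (-2 * x i) * partialDeriv i φ x) :=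
    memL2_of_continuous hb ((continuous_const.mul (contDiff_coord i).continuous).mul
      (contDiff_partialDeriv i h.1).continuous)
  -- Since `∂_i x_i = 1`, integrating `φ²` by parts gives `∫ φ² = -2 ∫ x_i φ ∂_i φ`, and `x_i` is
  -- bounded on `Ω`.
  have h1 := (h.mul_contDiff h.1).integral_mul_partialDeriv hΩ hb (contDiff_coord i) i
  rw [partialDeriv_mul h.1 h.1] at h1
  have h2 : l2 Ω φ ^ 2 = ∫ x in Ω, φ x * ((-2 * x i) * partialDeriv i φ x) := by
    rw [l2_sq hL]
    have : ∫ x in Ω, φ x ^ 2 = ∫ x in Ω, partialDeriv i (fun y : E N => y i) x * (φ x * φ x) := by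
      congr 1; ext x; rw [partialDeriv_coord]; simp [sq]
    rw [this, ← neg_eq_iff_eq_neg.2 h1, ← integral_neg]
    congr 1; ext x; ring
  have h3 := (le_abs_self _).trans (abs_integral_mul_le hL hxL)
  rw [← h2] at h3
  have h4 : l2 Ω (fun x => (-2 * x i) * partialDeriv i φ x) ≤ 2 * |R| * l2 Ω (partialDeriv i φ) := by
    refine l2_le_of_abs_le (by positivity) hdL
      ((ae_restrict_iff' hΩ.measurableSet).2 (ae_of_all _ fun x hx => ?_))
    rw [abs_mul, abs_mul]
    have : |x i| ≤ |R| := ((PiLp.norm_apply_le x i).trans (hR x hx)).trans (le_abs_self R)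
    have h5 : |(-2 : ℝ)| = 2 := by norm_num
    rw [h5]
    gcongr
  have h0 : 0 ≤ l2 Ω φ := l2_nonneg
  rcases h0.eq_or_lt with h6 | h6
  · rw [← h6]; have := l2_nonneg (S := Ω) (f := partialDeriv i φ); positivity
  · have h7 := h3.trans (mul_le_mul_of_nonneg_left h4 h0)
    rw [sq] at h7
    exact le_of_mul_le_mul_left h7 h6

end Dirichlet
end Biharm

/-! ### The resolvent of the Laplacian on the whole space. -/

namespace Biharm

section Resolvent
open SchwartzMap LineDeriv Laplacian
variable {N : ℕ}

lemma fourierMultiplierCLM_add {g₁ g₂ : E N → ℝ} (h₁ : g₁.HasTemperateGrowth)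
    (h₂ : g₂.HasTemperateGrowth) (f : 𝓢(E N, ℂ)) :
    fourierMultiplierCLM ℂ (g₁ + g₂) f =
      fourierMultiplierCLM ℂ g₁ f + fourierMultiplierCLM ℂ g₂ f := by
  simp [fourierMultiplierCLM_apply, smulLeftCLM_add h₁ h₂, FourierTransform.fourierInv_add]

lemma exists_schwartz_resolvent {lam : ℝ} (hlam : 0 < lam) (f : 𝓢(E N, ℂ)) :
    ∃ F : 𝓢(E N, ℂ), lam • F - Δ F = f := by
  -- The Fourier symbol of `(λ - Δ)⁻¹`.
  let m : E N → ℝ := fun ξ => (lam + (2 * Real.pi) ^ 2 * ‖ξ‖ ^ 2)⁻¹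
  have hpos : ∀ ξ : E N, 0 < lam + (2 * Real.pi) ^ 2 * ‖ξ‖ ^ 2 := fun ξ => by positivity
  have hm : m.HasTemperateGrowth := by
    -- With this scaling `m ξ = λ⁻¹ (1 + ‖c ξ‖²)⁻¹`, a dilation of a function known to have
    -- temperate growth.
    let c : ℝ := 2 * Real.pi / √lam
    have h1 := (Function.hasTemperateGrowth_one_add_norm_sq_rpow (E N) (-1)).comp
      (ContinuousLinearMap.hasTemperateGrowth (c • ContinuousLinearMap.id ℝ (E N)))
    have h2 := (Function.HasTemperateGrowth.const (E := E N) lam⁻¹).mul h1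
    convert! h2 using 1
    ext ξ
    simp only [m, c, Real.rpow_neg_one]
    simp only [Pi.mul_apply, Function.comp_apply, _root_.smul_apply,
      ContinuousLinearMap.id_apply, norm_smul, mul_pow, Real.norm_eq_abs, sq_abs, div_pow,
      Real.sq_sqrt hlam.le]
    rw [← mul_inv]
    congr 1
    field_simp
  have hn : (fun ξ : E N => ‖ξ‖ ^ 2).HasTemperateGrowth :=
    Function.hasTemperateGrowth_norm_sq (E N)
  refine ⟨fourierMultiplierCLM ℂ m f, ?_⟩
  rw [laplacian_eq_fourierMultiplierCLM]
  have e1 : fourierMultiplierCLM ℂ (fun ξ : E N => ‖ξ‖ ^ 2) (fourierMultiplierCLM ℂ m f) =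
      fourierMultiplierCLM ℂ ((fun ξ : E N => ‖ξ‖ ^ 2) * m) f :=
    fourierMultiplierCLM_fourierMultiplierCLM_apply hn hm f
  have e2 : lam • fourierMultiplierCLM ℂ m f + (2 * Real.pi) ^ 2 •
      fourierMultiplierCLM ℂ ((fun ξ : E N => ‖ξ‖ ^ 2) * m) f = f := by
    rw [← _root_.smul_apply, ← _root_.smul_apply,
      ← fourierMultiplierCLM_smul hm, ← fourierMultiplierCLM_smul (hn.mul hm)]
    rw [← fourierMultiplierCLM_add
      (g₁ := lam • m) (g₂ := (2 * Real.pi) ^ 2 • ((fun ξ : E N => ‖ξ‖ ^ 2) * m))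
      ((Function.HasTemperateGrowth.const (E := E N) lam).mul hm)
      ((Function.HasTemperateGrowth.const (E := E N) ((2 * Real.pi) ^ 2)).mul (hn.mul hm))]
    have h5 : (lam • m + (2 * Real.pi) ^ 2 • ((fun ξ : E N => ‖ξ‖ ^ 2) * m)) = fun _ => (1 : ℝ) := by
      ext ξ
      simp only [m, Pi.add_apply, Pi.smul_apply, Pi.mul_apply, smul_eq_mul]
      have := (hpos ξ).ne'
      field_simp
    rw [h5, fourierMultiplierCLM_const]
    simp
  rw [e1]
  rw [← sub_eq_zero] at e2 ⊢
  rw [← e2, neg_smul, sub_neg_eq_add]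

lemma coe_lineDerivOp (Φ : 𝓢(E N, ℝ)) (i : Fin N) :
    (⇑(∂_{EuclideanSpace.single i (1 : ℝ)} Φ : 𝓢(E N, ℝ)) : E N → ℝ) = partialDeriv i Φ := by
  ext x; rw [lineDerivOp_apply_eq_fderiv]; rfl

lemma schwartz_laplacian_eq_lap (Φ : 𝓢(E N, ℝ)) (x : E N) : (Δ Φ) x = lap Φ x := by
  rw [laplacian_eq_sum (EuclideanSpace.basisFun (Fin N) ℝ), _root_.sum_apply]
  simp only [EuclideanSpace.basisFun_apply]
  refine Finset.sum_congr rfl fun i _ => ?_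
  rw [coe_lineDerivOp, coe_lineDerivOp]

lemma exists_real_schwartz_resolvent {lam : ℝ} (hlam : 0 < lam) {g : E N → ℝ}
    (hg : ContDiff ℝ ∞ g) (hc : HasCompactSupport g) :
    ∃ Φ : 𝓢(E N, ℝ), ∀ x, lam * Φ x - lap Φ x = g x := by
  have hgC : ContDiff ℝ ∞ (fun x => (g x : ℂ)) := Complex.ofRealCLM.contDiff.comp hg
  have hcC : HasCompactSupport (fun x => (g x : ℂ)) := hc.comp_left (g := fun r : ℝ => (r : ℂ)) rfl
  obtain ⟨F, hF⟩ := exists_schwartz_resolvent hlam (hcC.toSchwartzMap hgC)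
  refine ⟨postcompCLM Complex.reCLM F, fun x => ?_⟩
  have h1 := congrArg (fun G : 𝓢(E N, ℂ) => (G x).re) hF
  have h2 : ∀ (v : E N) (G : 𝓢(E N, ℂ)),
      ∂_{v} (postcompCLM Complex.reCLM G) = postcompCLM Complex.reCLM (∂_{v} G) := by
    intro v G
    ext y
    rw [lineDerivOp_apply_eq_fderiv, postcompCLM_apply, lineDerivOp_apply_eq_fderiv]
    have h3 := (Complex.reCLM.hasFDerivAt (x := G y)).comp y (G.differentiableAt (x := y)).hasFDerivAt
    have h4 : fderiv ℝ (⇑(postcompCLM Complex.reCLM G)) y = Complex.reCLM.comp (fderiv ℝ (⇑G) y) :=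
      h3.fderiv
    rw [h4]; rfl
  have h3 : Δ (postcompCLM Complex.reCLM F) = postcompCLM Complex.reCLM (Δ F) := by
    rw [laplacian_eq_sum (stdOrthonormalBasis ℝ (E N)),
      laplacian_eq_sum (stdOrthonormalBasis ℝ (E N)), map_sum]
    simp only [h2]
  rw [← schwartz_laplacian_eq_lap, h3, postcompCLM_apply, postcompCLM_apply]
  simpa using h1

/-- The resolvent of the Laplacian on `ℝ^N`, with its `H²` estimate. -/
lemma exists_resolvent {lam : ℝ} (hlam : 0 < lam) {g : E N → ℝ}
    (hg : ContDiff ℝ ∞ g) (hc : HasCompactSupport g) :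
    ∃ Φ : E N → ℝ, ContDiff ℝ ∞ Φ ∧ (∀ x, lam * Φ x - lap Φ x = g x) ∧
      (MemL2 Set.univ Φ ∧ lam * l2 Set.univ Φ ≤ l2 Set.univ g) ∧
      (∀ i, MemL2 Set.univ (partialDeriv i Φ) ∧
        √lam * l2 Set.univ (partialDeriv i Φ) ≤ l2 Set.univ g) ∧
      ∀ i j, MemL2 Set.univ (partialDeriv i (partialDeriv j Φ)) ∧
        l2 Set.univ (partialDeriv i (partialDeriv j Φ)) ≤ l2 Set.univ g := by
  obtain ⟨Φ, hΦ⟩ := exists_real_schwartz_resolvent hlam hg hc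
  have hsm : ContDiff ℝ ∞ (Φ : E N → ℝ) := Φ.smooth ⊤
  have hL : ∀ F : 𝓢(E N, ℝ), MemL2 Set.univ F := fun F => by
    simpa [MemL2] using F.memLp 2 volume
  let D : Fin N → 𝓢(E N, ℝ) := fun i => ∂_{EuclideanSpace.single i (1 : ℝ)} Φ
  let D2 : Fin N → Fin N → 𝓢(E N, ℝ) := fun i j => ∂_{EuclideanSpace.single i (1 : ℝ)} (D j)
  have hD : ∀ i, (⇑(D i) : E N → ℝ) = partialDeriv i Φ := fun i => coe_lineDerivOp Φ i
  have hD2 : ∀ i j, (⇑(D2 i j) : E N → ℝ) = partialDeriv i (partialDeriv j Φ) := fun i j => by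
    rw [← hD]; exact coe_lineDerivOp _ i
  have hcomm : ∀ i j, D2 i j = D2 j i := fun i j => by
    ext x; rw [hD2, hD2, partialDeriv_comm hsm]
  have ibp : ∀ (F G : 𝓢(E N, ℝ)) (i : Fin N),
      ∫ x, F x * (∂_{EuclideanSpace.single i (1 : ℝ)} G) x =
        - ∫ x, (∂_{EuclideanSpace.single i (1 : ℝ)} F) x * G x := fun F G i =>
    integral_mul_lineDerivOp_right_eq_neg_left F G _
  have hint : ∀ F G : 𝓢(E N, ℝ), Integrable (fun x => F x * G x) := fun F G => by
    simpa using integrable_mul_of_memL2 (hL F) (hL G)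
  have hsq : ∀ F : 𝓢(E N, ℝ), l2 Set.univ F ^ 2 = ∫ x, F x * F x := fun F => by
    rw [l2_sq (hL F)]; simp [sq]
  have hlap : ∀ x, lap Φ x = ∑ i, D2 i i x := fun x => by simp only [lap, ← hD2]
  have h1 : ∫ x, Φ x * lap Φ x = - ∑ i, l2 Set.univ (D i) ^ 2 := by
    simp only [hlap, Finset.mul_sum]
    rw [integral_finsetSum _ fun i _ => hint _ _, ← Finset.sum_neg_distrib]
    exact Finset.sum_congr rfl fun i _ => by rw [hsq]; exact ibp _ _ _
  -- Two integrations by parts and the symmetry of second derivatives turn `∫ ∂_iiΦ ∂_jjΦ` into `∫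
  -- (∂_ijΦ)²`.
  have h2 : ∫ x, lap Φ x * lap Φ x = ∑ i, ∑ j, l2 Set.univ (D2 i j) ^ 2 := by
    simp only [hlap, Finset.sum_mul_sum]
    rw [integral_finsetSum _ fun i _ => integrable_finsetSum _ fun j _ => hint _ _]
    refine Finset.sum_congr rfl fun i _ => ?_
    rw [integral_finsetSum _ fun j _ => hint _ _]
    refine Finset.sum_congr rfl fun j _ => ?_
    have e1 : ∫ x, D2 i i x * D2 j j x =
        - ∫ x, (∂_{EuclideanSpace.single j (1 : ℝ)} (D2 i i)) x * D j x := ibp _ _ _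
    have e2 : ∂_{EuclideanSpace.single j (1 : ℝ)} (D2 i i) =
        ∂_{EuclideanSpace.single i (1 : ℝ)} (D2 j i) := by
      ext x
      rw [coe_lineDerivOp, coe_lineDerivOp, partialDeriv_comm ((D i).smooth ⊤), coe_lineDerivOp,
        coe_lineDerivOp, hD2]
    have e3 := ibp (D j) (D2 j i) i
    rw [e1, e2, hsq]
    have e4 : ∫ x, (∂_{EuclideanSpace.single i (1 : ℝ)} (D2 j i)) x * D j x =
        ∫ x, D j x * (∂_{EuclideanSpace.single i (1 : ℝ)} (D2 j i)) x := by
      congr 1; ext x; ring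
    rw [e4, e3, neg_neg]
    change ∫ x, D2 i j x * D2 j i x = _
    rw [hcomm j i]
  have hgL : MemL2 Set.univ g := by
    simpa [MemL2] using hg.continuous.memLp_of_hasCompactSupport (p := 2) (μ := volume) hc
  have hlapint : Integrable (fun x => Φ x * lap Φ x) := by
    simp only [hlap, Finset.mul_sum]
    exact integrable_finsetSum _ fun i _ => hint _ _
  have hlapint2 : Integrable (fun x => lap Φ x * lap Φ x) := by
    simp only [hlap, Finset.sum_mul_sum]
    exact integrable_finsetSum _ fun i _ => integrable_finsetSum _ fun j _ => hint _ _
  -- Square `g = λΦ - ΔΦ` and integrate. Every term on the right is nonnegative, so each of the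
  -- three estimates follows by discarding the other terms.
  have key : l2 Set.univ g ^ 2 = lam ^ 2 * l2 Set.univ Φ ^ 2 +
      2 * lam * ∑ i, l2 Set.univ (D i) ^ 2 + ∑ i, ∑ j, l2 Set.univ (D2 i j) ^ 2 := by
    have e : ∀ x, g x ^ 2 = lam ^ 2 * (Φ x * Φ x) + (-2 * lam) * (Φ x * lap Φ x) +
        lap Φ x * lap Φ x := fun x => by rw [← hΦ x]; ring
    rw [l2_sq hgL, Measure.restrict_univ]
    simp only [e]
    have i1 := ((hint Φ Φ).const_mul (lam ^ 2)).add (hlapint.const_mul (-2 * lam))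
    simp only [Pi.add_def] at i1
    rw [integral_add i1 hlapint2,
      integral_add ((hint Φ Φ).const_mul _) (hlapint.const_mul _), integral_const_mul,
      integral_const_mul, h1, h2, hsq]
    ring
  have g0 : 0 ≤ l2 Set.univ g := l2_nonneg
  have s1 : 0 ≤ ∑ i, l2 Set.univ (D i) ^ 2 := Finset.sum_nonneg fun i _ => sq_nonneg _
  have s2 : 0 ≤ ∑ i, ∑ j, l2 Set.univ (D2 i j) ^ 2 :=
    Finset.sum_nonneg fun i _ => Finset.sum_nonneg fun j _ => sq_nonneg _
  refine ⟨Φ, hsm, hΦ, ⟨hL Φ, ?_⟩, fun i => ?_, fun i j => ?_⟩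
  · refine abs_le_of_sq_le_sq' ?_ g0 |>.2
    rw [mul_pow]
    have := mul_nonneg hlam.le s1
    nlinarith
  · rw [← hD]
    refine ⟨hL _, abs_le_of_sq_le_sq' ?_ g0 |>.2⟩
    rw [mul_pow, Real.sq_sqrt hlam.le]
    have e : l2 Set.univ (D i) ^ 2 ≤ ∑ i, l2 Set.univ (D i) ^ 2 :=
      Finset.single_le_sum (f := fun i => l2 Set.univ (D i) ^ 2) (fun i _ => sq_nonneg _)
        (Finset.mem_univ i)
    have e' := mul_le_mul_of_nonneg_left e hlam.le
    have := mul_nonneg hlam.le s1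
    have := sq_nonneg (lam * l2 Set.univ Φ)
    nlinarith
  · rw [← hD2]
    refine ⟨hL _, abs_le_of_sq_le_sq' ?_ g0 |>.2⟩
    have e : l2 Set.univ (D2 i j) ^ 2 ≤ ∑ j, l2 Set.univ (D2 i j) ^ 2 :=
      Finset.single_le_sum (f := fun j => l2 Set.univ (D2 i j) ^ 2) (fun i _ => sq_nonneg _)
        (Finset.mem_univ j)
    have e2 : ∑ j, l2 Set.univ (D2 i j) ^ 2 ≤ ∑ i, ∑ j, l2 Set.univ (D2 i j) ^ 2 :=
      Finset.single_le_sum (f := fun i => ∑ j, l2 Set.univ (D2 i j) ^ 2)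
        (fun i _ => Finset.sum_nonneg fun j _ => sq_nonneg _) (Finset.mem_univ i)
    have := mul_nonneg hlam.le s1
    have := sq_nonneg (lam * l2 Set.univ Φ)
    nlinarith

end Resolvent
end Biharm

/-! ### Change of variables and reflection across the boundary. -/

namespace Biharm

section Comp
variable {N : ℕ}

lemma IsTestFunction.l2_eq_univ {S : Set (E N)} {g : E N → ℝ}
    (hg : IsTestFunction S g) : l2 S g = l2 Set.univ g := by
  unfold l2
  rw [Measure.restrict_univ, eLpNorm_restrict_eq_of_support_subset]
  exact fun x hx => hg.3 (subset_tsupport _ hx)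

/-- Composition with a change of variables whose Jacobian is bounded below. -/
lemma memL2_comp_and_l2_comp_le {U : Set (E N)} (hU : MeasurableSet U) {R : E N → E N}
    (hR : Continuous R) {R' : E N → E N →L[ℝ] E N} (hR' : ∀ x ∈ U, HasFDerivAt R (R' x) x)
    (hinj : Set.InjOn R U) (hdet : ∀ x ∈ U, 1 / 4 ≤ |(R' x).det|) {F : E N → ℝ}
    (hF : Continuous F) (hFL : MemL2 Set.univ F) :
    MemL2 U (fun x => F (R x)) ∧ l2 U (fun x => F (R x)) ≤ 2 * l2 Set.univ F := by
  have h2 : ∀ (S : Set (E N)) (f : E N → ℝ), eLpNorm f 2 (volume.restrict S) ^ (2 : ℝ) =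
      ∫⁻ x in S, ‖f x‖ₑ ^ (2 : ℝ) := fun S f => by
    simpa using eLpNorm_nnreal_pow_eq_lintegral (f := f) (μ := volume.restrict S)
      (p := (2 : NNReal)) (by norm_num)
  have hle : eLpNorm (fun x => F (R x)) 2 (volume.restrict U) ^ (2 : ℝ) ≤
      (2 * eLpNorm F 2 (volume.restrict Set.univ)) ^ (2 : ℝ) := by
    rw [ENNReal.mul_rpow_of_nonneg _ _ (by norm_num : (0 : ℝ) ≤ 2), h2, h2]
    calc ∫⁻ x in U, ‖F (R x)‖ₑ ^ (2 : ℝ)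
        ≤ ∫⁻ x in U, 4 * (ENNReal.ofReal |(R' x).det| * ‖F (R x)‖ₑ ^ (2 : ℝ)) := by
          refine setLIntegral_mono' hU fun x hx => ?_
          rw [← mul_assoc]
          -- The Jacobian bound `1/4` costs a factor `4` in the squared norm, hence `2` in the norm.
          have h4 : (1 : ℝ≥0∞) ≤ 4 * ENNReal.ofReal |(R' x).det| := by
            have : (4 : ℝ≥0∞) = ENNReal.ofReal 4 := by norm_num
            rw [this, ← ENNReal.ofReal_mul (by norm_num), ← ENNReal.ofReal_one]
            exact ENNReal.ofReal_le_ofReal (by linarith [hdet x hx])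
          calc ‖F (R x)‖ₑ ^ (2 : ℝ) = 1 * ‖F (R x)‖ₑ ^ (2 : ℝ) := (one_mul _).symm
            _ ≤ _ := by gcongr
      _ = 4 * ∫⁻ x in R '' U, ‖F x‖ₑ ^ (2 : ℝ) := by
          rw [lintegral_const_mul' _ _ (by norm_num),
            lintegral_image_eq_lintegral_abs_det_fderiv_mul volume hU
              (fun x hx => (hR' x hx).hasFDerivWithinAt) hinj]
      _ ≤ 2 ^ (2 : ℝ) * ∫⁻ x in Set.univ, ‖F x‖ₑ ^ (2 : ℝ) := by
          have : (4 : ℝ≥0∞) = 2 ^ (2 : ℝ) := by norm_num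
          rw [this]
          gcongr
          exact Set.subset_univ _
  have hle' := (ENNReal.rpow_le_rpow_iff (by norm_num : (0 : ℝ) < 2)).1 hle
  have htop : 2 * eLpNorm F 2 (volume.restrict Set.univ) ≠ ⊤ :=
    ENNReal.mul_ne_top (by simp) hFL.2.ne
  refine ⟨⟨(hF.comp hR).aestronglyMeasurable, hle'.trans_lt htop.lt_top⟩, ?_⟩
  have := ENNReal.toReal_mono htop hle'
  simpa [l2] using this

end Comp

section Reflection
variable {N : ℕ}

/-- The reflection across the level sets of `ρ` in the direction `d`. -/
noncomputable def refl (ρ : E N → ℝ) (c : ℝ) (d : E N) (x : E N) : E N := x - (c * ρ x) • d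

/-- The Jacobian matrix of `refl`. -/
noncomputable def reflJac (ρ : E N → ℝ) (c : ℝ) (d : E N) (i j : Fin N) (x : E N) : ℝ :=
  (if j = i then 1 else 0) - c * d j * partialDeriv i ρ x

variable {ρ : E N → ℝ} {c : ℝ} {d : E N}

lemma contDiff_refl (hρ : ContDiff ℝ ∞ ρ) : ContDiff ℝ ∞ (refl ρ c d) :=
  contDiff_id.sub ((contDiff_const.mul hρ).smul contDiff_const)

lemma contDiff_reflJac (hρ : ContDiff ℝ ∞ ρ) (i j : Fin N) :
    ContDiff ℝ ∞ (reflJac ρ c d i j) :=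
  contDiff_const.sub (contDiff_const.mul (contDiff_partialDeriv i hρ))

lemma hasFDerivAt_refl (hρ : ContDiff ℝ ∞ ρ) (x : E N) :
    HasFDerivAt (refl ρ c d)
      (ContinuousLinearMap.id ℝ (E N) - (c • fderiv ℝ ρ x).smulRight d) x := by
  have h := (diffAt_of_contDiff hρ x).hasFDerivAt
  exact (hasFDerivAt_id x).sub ((h.const_mul c).smul_const d)

lemma partialDeriv_comp_refl (hρ : ContDiff ℝ ∞ ρ) {Φ : E N → ℝ} (hΦ : ContDiff ℝ ∞ Φ)
    (i : Fin N) :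
    partialDeriv i (fun x => Φ (refl ρ c d x)) =
      fun x => ∑ j, reflJac ρ c d i j x * partialDeriv j Φ (refl ρ c d x) := by
  ext x
  have h := (diffAt_of_contDiff hΦ (refl ρ c d x)).hasFDerivAt.comp x (hasFDerivAt_refl hρ x)
  have h' : fderiv ℝ (fun x => Φ (refl ρ c d x)) x = _ := h.fderiv
  rw [partialDeriv, h', ContinuousLinearMap.comp_apply, fderiv_apply_eq_sum]
  refine Finset.sum_congr rfl fun j _ => ?_
  congr 1
  simp [reflJac, partialDeriv]
  ring

/-- The second-order coefficients form a Gram matrix of the Jacobian. Where it is close to the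
identity, composition with `refl` commutes with the Laplacian up to a small second-order term and a
first-order term. -/
lemma lap_comp_refl (hρ : ContDiff ℝ ∞ ρ) {Φ : E N → ℝ} (hΦ : ContDiff ℝ ∞ Φ) (x : E N) :
    lap (fun x => Φ (refl ρ c d x)) x =
      ∑ j, ∑ k, (∑ i, reflJac ρ c d i j x * reflJac ρ c d i k x) *
        partialDeriv k (partialDeriv j Φ) (refl ρ c d x) +
      ∑ j, (∑ i, partialDeriv i (reflJac ρ c d i j) x) * partialDeriv j Φ (refl ρ c d x) := by
  have hd : ∀ j, ContDiff ℝ ∞ (fun x => partialDeriv j Φ (refl ρ c d x)) := fun j =>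
    (contDiff_partialDeriv j hΦ).comp (contDiff_refl hρ)
  have h : ∀ i, partialDeriv i (partialDeriv i (fun x => Φ (refl ρ c d x))) x =
      ∑ j, (∑ k, reflJac ρ c d i j x * reflJac ρ c d i k x *
        partialDeriv k (partialDeriv j Φ) (refl ρ c d x) +
        partialDeriv i (reflJac ρ c d i j) x * partialDeriv j Φ (refl ρ c d x)) := by
    intro i
    rw [partialDeriv_comp_refl hρ hΦ,
      partialDeriv_sum _ fun j _ => (contDiff_reflJac hρ i j).mul (hd j)]
    refine Finset.sum_congr rfl fun j _ => ?_
    rw [partialDeriv_mul (contDiff_reflJac hρ i j) (hd j),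
      partialDeriv_comp_refl hρ (contDiff_partialDeriv j hΦ)]
    simp only [Finset.mul_sum]
    congr 1
    · exact Finset.sum_congr rfl fun k _ => by ring
    · ring
  simp only [lap, h, Finset.sum_add_distrib, Finset.sum_mul]
  congr 1
  · rw [Finset.sum_comm]
    exact Finset.sum_congr rfl fun j _ => Finset.sum_comm
  · rw [Finset.sum_comm]

/-- At a point where `d` is the gradient of `ρ`, the reflection is a linear isometry to first
order. -/
lemma sum_reflJac_mul_reflJac {p : E N} (hd : ∀ i, d i = partialDeriv i ρ p)
    (hc : c * ∑ i, d i ^ 2 = 2) (j k : Fin N) :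
    ∑ i, reflJac ρ c d i j p * reflJac ρ c d i k p = if j = k then 1 else 0 := by
  simp only [reflJac, ← hd]
  have : ∀ i, ((if j = i then (1 : ℝ) else 0) - c * d j * d i) *
      ((if k = i then 1 else 0) - c * d k * d i) =
      (if j = i then (if k = i then 1 else 0) else 0) - (if j = i then c * d k * d i else 0) -
        (if k = i then c * d j * d i else 0) + c * d j * d k * (c * d i ^ 2) := by
    intro i; split_ifs <;> ring
  simp only [this, Finset.sum_add_distrib, Finset.sum_sub_distrib, ← Finset.mul_sum, hc]
  simp [eq_comm]
  ring

/-- At `p` the derivative of `refl` is a Householder reflection, since `c Dρ(d) = 2`. Being an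
involution, it is invertible with determinant `±1`. -/
lemma fderiv_refl_involutive {p : E N} (hd : ∀ i, d i = partialDeriv i ρ p)
    (hc : c * ∑ i, d i ^ 2 = 2) :
    (ContinuousLinearMap.id ℝ (E N) - (c • fderiv ℝ ρ p).smulRight d).comp
      (ContinuousLinearMap.id ℝ (E N) - (c • fderiv ℝ ρ p).smulRight d) =
      ContinuousLinearMap.id ℝ (E N) := by
  have hdd : c * fderiv ℝ ρ p d = 2 := by
    rw [fderiv_apply_eq_sum, ← hc]
    congr 1
    exact Finset.sum_congr rfl fun i _ => by rw [← hd]; ring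
  ext1 v
  simp only [ContinuousLinearMap.comp_apply, sub_apply, ContinuousLinearMap.id_apply,
    ContinuousLinearMap.smulRight_apply, smul_apply, map_sub, map_smul, smul_eq_mul, hdd]
  module

end Reflection
end Biharm

/-! ### Approximate local solvability of `λφ - Δφ = g`. -/

namespace Biharm

section Local
variable {N : ℕ} {Ω U : Set (E N)}

/-- Approximate solvability of `λφ - Δφ = g` in `Ω ∩ U` by smooth functions vanishing on
`∂Ω ∩ U`, uniformly for large `λ`. -/
def IsLocallySolvable (Ω U : Set (E N)) (C lam₀ : ℝ) : Prop :=
  ∀ lam ≥ lam₀, ∀ g, IsTestFunction (Ω ∩ U) g → ∃ φ : E N → ℝ, ContDiff ℝ ∞ φ ∧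
    (∀ x ∈ frontier Ω ∩ U, φ x = 0) ∧
    l2 (Ω ∩ U) (fun x => lam * φ x - lap φ x - g x) ≤ 1 / 2 * l2 (Ω ∩ U) g ∧
    √lam * l2 (Ω ∩ U) φ ≤ C * l2 (Ω ∩ U) g ∧
    ∀ i, √lam * l2 (Ω ∩ U) (partialDeriv i φ) ≤ C * l2 (Ω ∩ U) g

lemma sqrt_le_self_of_one_le {lam : ℝ} (h : 1 ≤ lam) : √lam ≤ lam := by
  rw [Real.sqrt_le_left (by linarith)]
  nlinarith

/-- With `U = Ω` there is no boundary condition to meet, and the whole-space resolvent solves the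
equation exactly. -/
lemma isLocallySolvable_interior (hΩ : IsOpen Ω) : IsLocallySolvable Ω Ω 1 1 := by
  intro lam hlam g hg
  rw [Set.inter_self] at hg ⊢
  obtain ⟨Φ, hΦ, heq, h0, h1, -⟩ := exists_resolvent (by linarith : (0 : ℝ) < lam) hg.1 hg.2
  have hmono : ∀ f, MemL2 Set.univ f → l2 Ω f ≤ l2 Set.univ f := fun f hf =>
    l2_mono_set (Set.subset_univ _) hf
  refine ⟨Φ, hΦ, fun x hx => ?_, ?_, ?_, fun i => ?_⟩
  · rw [frontier, hΩ.interior_eq] at hx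
    exact absurd hx.2 hx.1.2
  · have : (fun x => lam * Φ x - lap Φ x - g x) = fun _ => (0 : ℝ) := by
      ext x; rw [heq, sub_self]
    rw [this]
    have h : l2 Ω (fun _ => (0 : ℝ)) = 0 := by simp [l2]
    rw [h]
    have := l2_nonneg (S := Ω) (f := g)
    positivity
  · rw [one_mul, hg.l2_eq_univ]
    calc √lam * l2 Ω Φ ≤ lam * l2 Set.univ Φ :=
          mul_le_mul (sqrt_le_self_of_one_le hlam) (hmono _ h0.1) l2_nonneg (by linarith)
      _ ≤ _ := h0.2
  · rw [one_mul, hg.l2_eq_univ]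
    exact (mul_le_mul_of_nonneg_left (hmono _ (h1 i).1) (Real.sqrt_nonneg _)).trans (h1 i).2

variable {ρ : E N → ℝ} {c : ℝ} {d : E N}

/-- The construction of local solutions by reflection. -/
lemma isLocallySolvable_of_refl (hΩ : IsOpen Ω) (hU : IsOpen U) (hρ : ContDiff ℝ ∞ ρ)
    (hbdry : ∀ x ∈ frontier Ω ∩ U, ρ x = 0)
    (hout : ∀ x ∈ Ω ∩ U, refl ρ c d x ∉ Ω) (hinj : Set.InjOn (refl ρ c d) U)
    (hdet : ∀ x ∈ U, 1 / 4 ≤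
      |(ContinuousLinearMap.id ℝ (E N) - (c • fderiv ℝ ρ x).smulRight d).det|)
    {M : ℝ} (hM : 0 ≤ M) (hA : ∀ x ∈ U, ∀ i j, |reflJac ρ c d i j x| ≤ M)
    (hb : ∀ x ∈ U, ∀ j, |∑ i, partialDeriv i (reflJac ρ c d i j) x| ≤ M)
    (hB : ∀ x ∈ U, ∀ j k, |(if j = k then 1 else 0) -
      ∑ i, reflJac ρ c d i j x * reflJac ρ c d i k x| ≤ 1 / (8 * ((N : ℝ) ^ 2 + 1))) :
    IsLocallySolvable Ω U (3 + 2 * N * M) ((8 * N * M + 1) ^ 2) := by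
  intro lam hlam g hg
  have hNM : (0 : ℝ) ≤ N * M := by positivity
  have hlam1 : 1 ≤ lam := by
    refine le_trans ?_ hlam
    nlinarith
  have hsq : 8 * N * M + 1 ≤ √lam := Real.le_sqrt_of_sq_le hlam
  have hsq0 : 0 < √lam := by linarith
  obtain ⟨Φ, hΦ, heq, h0, h1, h2⟩ := exists_resolvent (by linarith : (0 : ℝ) < lam) hg.1 hg.2
  set G := l2 Set.univ g with hG
  have hG0 : 0 ≤ G := l2_nonneg
  have hms : MeasurableSet (Ω ∩ U) := (hΩ.inter hU).measurableSet
  have hmono : ∀ f, MemL2 Set.univ f → l2 (Ω ∩ U) f ≤ l2 Set.univ f := fun f hf =>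
    l2_mono_set (Set.subset_univ _) hf
  have hcomp : ∀ f, Continuous f → MemL2 Set.univ f →
      MemL2 (Ω ∩ U) (fun x => f (refl ρ c d x)) ∧
        l2 (Ω ∩ U) (fun x => f (refl ρ c d x)) ≤ 2 * l2 Set.univ f := fun f hf hfL =>
    memL2_comp_and_l2_comp_le hms (contDiff_refl hρ).continuous
      (fun x _ => hasFDerivAt_refl hρ x) (hinj.mono Set.inter_subset_right)
      (fun x hx => hdet x hx.2) hf hfL
  have hc0 := hcomp Φ hΦ.continuous h0.1
  have hc1 := fun j => hcomp _ (contDiff_partialDeriv j hΦ).continuous (h1 j).1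
  have hc2 := fun k j => hcomp _
    (contDiff_partialDeriv k (contDiff_partialDeriv j hΦ)).continuous (h2 k j).1
  have hae : ∀ {p : E N → Prop}, (∀ x ∈ Ω ∩ U, p x) → ∀ᵐ x ∂(volume.restrict (Ω ∩ U)), p x :=
    fun hp => (ae_restrict_iff' hms).2 (ae_of_all _ hp)
  have hHsm : ContDiff ℝ ∞ (fun x => Φ (refl ρ c d x)) := hΦ.comp (contDiff_refl hρ)
  have hgG : l2 (Ω ∩ U) g = G := hg.l2_eq_univ
  -- Odd reflection of the whole-space solution: it vanishes where `ρ = 0`, because `refl` fixes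
  -- those points.
  refine ⟨fun x => Φ x - Φ (refl ρ c d x), hΦ.sub hHsm, fun x hx => ?_, ?_, ?_, fun i => ?_⟩
  · simp [refl, hbdry x hx]
  · rw [lap_sub hΦ hHsm, hgG]
    have herr : ∀ x ∈ Ω ∩ U, lam * (Φ x - Φ (refl ρ c d x)) -
        (lap Φ x - lap (fun x => Φ (refl ρ c d x)) x) - g x =
        (∑ j, (∑ i, partialDeriv i (reflJac ρ c d i j) x) * partialDeriv j Φ (refl ρ c d x)) -
        ∑ j, ∑ k, ((if j = k then 1 else 0) - ∑ i, reflJac ρ c d i j x * reflJac ρ c d i k x) *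
          partialDeriv k (partialDeriv j Φ) (refl ρ c d x) := by
      intro x hx
      have e1 := heq x
      have e2 := heq (refl ρ c d x)
      -- The reflected point lies outside `Ω`, where `g` vanishes, so the reflected term contributes
      -- nothing to the right-hand side; the error comes only from the change of variables.
      rw [hg.eq_zero fun h => hout x hx h.1] at e2
      have e3 : lap Φ (refl ρ c d x) = ∑ j, ∑ k, (if j = k then 1 else 0) *
          partialDeriv k (partialDeriv j Φ) (refl ρ c d x) := by
        simp [lap]
      rw [lap_comp_refl hρ hΦ]
      simp only [sub_mul, Finset.sum_sub_distrib]
      rw [← e3]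
      linarith
    rw [l2_congr (hae herr)]
    have m1 : ∀ j, MemL2 (Ω ∩ U) (fun x => (∑ i, partialDeriv i (reflJac ρ c d i j) x) *
        partialDeriv j Φ (refl ρ c d x)) := fun j =>
      memL2_of_abs_le (c := M) (hc1 j).1
        ((continuous_finsetSum _ fun i _ => (contDiff_partialDeriv i
          (contDiff_reflJac hρ i j)).continuous).mul
          ((contDiff_partialDeriv j hΦ).comp (contDiff_refl hρ)).continuous).aestronglyMeasurable
        (hae fun x hx => by rw [abs_mul]; gcongr; exact hb x hx.2 j)
    have n1 : ∀ j, l2 (Ω ∩ U) (fun x => (∑ i, partialDeriv i (reflJac ρ c d i j) x) *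
        partialDeriv j Φ (refl ρ c d x)) ≤ M * (2 * (G / √lam)) := fun j => by
      refine (l2_le_of_abs_le hM (hc1 j).1
        (hae fun x hx => by rw [abs_mul]; gcongr; exact hb x hx.2 j)).trans ?_
      gcongr
      refine (hc1 j).2.trans ?_
      gcongr
      rw [le_div_iff₀ hsq0, mul_comm]
      exact (h1 j).2
    have m2 : ∀ j k, MemL2 (Ω ∩ U) (fun x => ((if j = k then 1 else 0) -
        ∑ i, reflJac ρ c d i j x * reflJac ρ c d i k x) *
          partialDeriv k (partialDeriv j Φ) (refl ρ c d x)) := fun j k =>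
      memL2_of_abs_le (c := 1 / (8 * ((N : ℝ) ^ 2 + 1))) (hc2 k j).1
        ((continuous_const.sub (continuous_finsetSum _ fun i _ =>
          ((contDiff_reflJac hρ i j).mul (contDiff_reflJac hρ i k)).continuous)).mul
          ((contDiff_partialDeriv k (contDiff_partialDeriv j hΦ)).comp
            (contDiff_refl hρ)).continuous).aestronglyMeasurable
        (hae fun x hx => by rw [abs_mul]; gcongr; exact hB x hx.2 j k)
    have n2 : ∀ j k, l2 (Ω ∩ U) (fun x => ((if j = k then 1 else 0) -
        ∑ i, reflJac ρ c d i j x * reflJac ρ c d i k x) *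
          partialDeriv k (partialDeriv j Φ) (refl ρ c d x)) ≤
        1 / (8 * ((N : ℝ) ^ 2 + 1)) * (2 * G) := fun j k => by
      refine (l2_le_of_abs_le (c := 1 / (8 * ((N : ℝ) ^ 2 + 1))) (by positivity) (hc2 k j).1
        (hae fun x hx => by rw [abs_mul]; gcongr; exact hB x hx.2 j k)).trans ?_
      gcongr
      refine (hc2 k j).2.trans ?_
      gcongr
      exact (h2 k j).2
    refine (l2_sub_le (memLp_finsetSum _ fun j _ => m1 j)
      (memLp_finsetSum _ fun j _ => memLp_finsetSum _ fun k _ => m2 j k)).trans ?_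
    have s1 := (l2_sum_le Finset.univ fun j _ => m1 j).trans (Finset.sum_le_sum fun j _ => n1 j)
    have s2 := (l2_sum_le Finset.univ fun j _ => memLp_finsetSum Finset.univ fun k _ => m2 j k).trans
      (Finset.sum_le_sum fun j _ => (l2_sum_le Finset.univ fun k _ => m2 j k).trans
        (Finset.sum_le_sum fun k _ => n2 j k))
    simp only [Finset.sum_const, Finset.card_univ, Fintype.card_fin, nsmul_eq_mul] at s1 s2
    -- First-order error: each derivative of `Φ` has norm at most `G/√λ`, and `√λ ≥ 8NM + 1` brings
    -- the sum below `G/4`.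
    have t1 : (N : ℝ) * (M * (2 * (G / √lam))) ≤ 1 / 4 * G := by
      have : (N : ℝ) * (M * (2 * (G / √lam))) = (2 * (N * M) * G) / √lam := by ring
      rw [this, div_le_iff₀ hsq0]
      nlinarith
    -- Second-order error: the tolerance `1/(8(N²+1))` absorbs the `N²` terms and the factor `2`
    -- from the change of variables, leaving the other `G/4`.
    have t2 : (N : ℝ) * (N * (1 / (8 * ((N : ℝ) ^ 2 + 1)) * (2 * G))) ≤ 1 / 4 * G := by
      have : (N : ℝ) * (N * (1 / (8 * ((N : ℝ) ^ 2 + 1)) * (2 * G))) =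
          (N ^ 2 * (2 * G)) / (8 * ((N : ℝ) ^ 2 + 1)) := by ring
      rw [this, div_le_iff₀ (by positivity)]
      nlinarith
    linarith
  · rw [hgG]
    have e1 : l2 (Ω ∩ U) (fun x => Φ x - Φ (refl ρ c d x)) ≤ 3 * l2 Set.univ Φ := by
      refine (l2_sub_le (h0.1.mono_set (Set.subset_univ _)) hc0.1).trans ?_
      linarith [hmono _ h0.1, hc0.2]
    calc √lam * l2 (Ω ∩ U) (fun x => Φ x - Φ (refl ρ c d x)) ≤ lam * (3 * l2 Set.univ Φ) :=
          mul_le_mul (sqrt_le_self_of_one_le hlam1) e1 l2_nonneg (by linarith)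
      _ = 3 * (lam * l2 Set.univ Φ) := by ring
      _ ≤ 3 * G := by gcongr; exact h0.2
      _ ≤ (3 + 2 * N * M) * G := by gcongr; nlinarith
  · rw [hgG, partialDeriv_sub hΦ hHsm, partialDeriv_comp_refl hρ hΦ]
    have m1 : ∀ j, MemL2 (Ω ∩ U) (fun x => reflJac ρ c d i j x *
        partialDeriv j Φ (refl ρ c d x)) := fun j =>
      memL2_of_abs_le (c := M) (hc1 j).1
        ((contDiff_reflJac hρ i j).continuous.mul
          ((contDiff_partialDeriv j hΦ).comp (contDiff_refl hρ)).continuous).aestronglyMeasurable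
        (hae fun x hx => by rw [abs_mul]; gcongr; exact hA x hx.2 i j)
    have n1 : ∀ j, l2 (Ω ∩ U) (fun x => reflJac ρ c d i j x *
        partialDeriv j Φ (refl ρ c d x)) ≤ M * (2 * (G / √lam)) := fun j => by
      refine (l2_le_of_abs_le hM (hc1 j).1
        (hae fun x hx => by rw [abs_mul]; gcongr; exact hA x hx.2 i j)).trans ?_
      gcongr
      refine (hc1 j).2.trans ?_
      gcongr
      rw [le_div_iff₀ hsq0, mul_comm]
      exact (h1 j).2
    have s1 := (l2_sum_le Finset.univ fun j _ => m1 j).trans (Finset.sum_le_sum fun j _ => n1 j)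
    simp only [Finset.sum_const, Finset.card_univ, Fintype.card_fin, nsmul_eq_mul] at s1
    have s2 := (l2_sub_le ((h1 i).1.mono_set (Set.subset_univ (Ω ∩ U)))
      (memLp_finsetSum Finset.univ fun j _ => m1 j))
    have s3 : l2 (Ω ∩ U) (partialDeriv i Φ) ≤ G / √lam := by
      rw [le_div_iff₀ hsq0, mul_comm]
      exact (mul_le_mul_of_nonneg_left (hmono _ (h1 i).1) (Real.sqrt_nonneg _)).trans (h1 i).2
    have s4 := mul_le_mul_of_nonneg_left (s2.trans (add_le_add s3 s1)) hsq0.le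
    refine s4.trans ?_
    have : √lam * (G / √lam + N * (M * (2 * (G / √lam)))) = (1 + 2 * N * M) * G := by
      field_simp
    rw [this]
    nlinarith

set_option maxHeartbeats 800000 in
/-- Local solvability near a boundary point. -/
lemma exists_isLocallySolvable_of_mem_frontier (hΩ : IsSmoothBoundedDomain Ω) {p : E N}
    (hp : p ∈ frontier Ω) :
    ∃ U : Set (E N), IsOpen U ∧ p ∈ U ∧ ∃ C lam₀, 0 ≤ C ∧ IsLocallySolvable Ω U C lam₀ := by
  obtain ⟨U₀, ρ, hU₀, hpU₀, hρ, hρp, hiff⟩ := hΩ.smooth_boundary p hp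
  have hbdry : ∀ x ∈ frontier Ω ∩ U₀, ρ x = 0 := by
    rintro x ⟨hx, hxU⟩
    have hx' := hx
    rw [frontier, hΩ.isOpen.interior_eq] at hx'
    refine le_antisymm ?_ (not_lt.1 fun h => hx'.2 ((hiff x hxU).2 h))
    by_contra! hpos
    obtain ⟨y, hy, hyΩ⟩ := mem_closure_iff.1 hx'.1 (U₀ ∩ {y | 0 < ρ y})
      (hU₀.inter (isOpen_lt continuous_const hρ.continuous)) ⟨hxU, hpos⟩
    have := (hiff y hy.1).1 hyΩ
    have h2 : 0 < ρ y := hy.2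
    linarith
  -- `d` is the gradient of `ρ` at `p` and `c = 2/|d|²` below, so that to first order `refl` is the
  -- orthogonal reflection across the tangent hyperplane.
  let d : E N := WithLp.toLp 2 fun i => partialDeriv i ρ p
  have hd : ∀ i, d i = partialDeriv i ρ p := fun i => rfl
  set K := ∑ i, d i ^ 2 with hK
  have hK0 : 0 < K := by
    refine lt_of_le_of_ne (Finset.sum_nonneg fun i _ => sq_nonneg _) fun h => hρp ?_
    have h0 : ∀ i, partialDeriv i ρ p = 0 := fun i => by
      have := (Finset.sum_eq_zero_iff_of_nonneg fun i _ => sq_nonneg (d i)).1 h.symm i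
        (Finset.mem_univ i)
      simpa [hd] using this
    ext v
    rw [fderiv_apply_eq_sum]
    simp [h0]
  let c : ℝ := 2 / K
  have hc : c * ∑ i, d i ^ 2 = 2 := div_mul_cancel₀ _ hK0.ne'
  have hc0 : 0 < c := div_pos two_pos hK0
  have hdp : c * fderiv ℝ ρ p d = 2 := by
    rw [fderiv_apply_eq_sum, ← hc]
    congr 1
    exact Finset.sum_congr rfl fun i _ => by rw [← hd]; ring
  have hρ0 : ρ p = 0 := hbdry p ⟨hp, hpU₀⟩
  have hRp : refl ρ c d p = p := by simp [refl, hρ0]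
  have hRc : Continuous (refl ρ c d) := (contDiff_refl hρ).continuous
  have hRt : Tendsto (refl ρ c d) (𝓝 p) (𝓝 p) := by
    have := hRc.tendsto p; rwa [hRp] at this
  -- the reflection exchanges the two sides of the boundary
  have ev1 : ∀ᶠ x in 𝓝 p, x ∈ Ω → refl ρ c d x ∉ Ω := by
    have hs : HasStrictFDerivAt ρ (fderiv ℝ ρ p) p :=
      (hρ.contDiffAt).hasStrictFDerivAt (by simp)
    -- To first order `ρ(refl x) = -ρ(x)`. This tolerance keeps the error below `|ρ(x)|`, so `ρ(x) <
    -- 0` forces `ρ(refl x) ≥ 0`.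
    have hε : 0 < (1 / (c * (‖d‖ + 1)) : ℝ) := by positivity
    have h1 := (hs.isLittleO.bound hε)
    have h2 : Tendsto (fun x => (refl ρ c d x, x)) (𝓝 p) (𝓝 (p, p)) :=
      hRt.prodMk_nhds tendsto_id
    filter_upwards [h2.eventually h1, hRt.eventually (hU₀.mem_nhds hpU₀), hU₀.mem_nhds hpU₀]
      with x hx hRx hxU hxΩ hcon
    have hρx : ρ x < 0 := (hiff x hxU).1 hxΩ
    have hρR : ρ (refl ρ c d x) < 0 := (hiff _ hRx).1 hcon
    have hdiff : refl ρ c d x - x = -((c * ρ x) • d) := by simp [refl]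
    simp only [hdiff, map_neg, map_smul, smul_eq_mul, norm_neg, norm_smul] at hx
    have e1 : c * ρ x * fderiv ℝ ρ p d = 2 * ρ x := by rw [← hdp]; ring
    rw [e1, norm_mul, Real.norm_of_nonneg hc0.le] at hx
    have e2 : 1 / (c * (‖d‖ + 1)) * (c * ‖ρ x‖ * ‖d‖) ≤ ‖ρ x‖ := by
      rw [div_mul_eq_mul_div, div_le_iff₀ (by positivity)]
      have := norm_nonneg (ρ x)
      nlinarith [mul_nonneg hc0.le this]
    have e3 := hx.trans e2
    rw [Real.norm_eq_abs, Real.norm_eq_abs, abs_of_neg hρx, abs_le] at e3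
    linarith [e3.1]
  have hstrict : HasStrictFDerivAt (refl ρ c d)
      (ContinuousLinearMap.id ℝ (E N) - (c • fderiv ℝ ρ p).smulRight d) p :=
    ((contDiff_refl hρ).contDiffAt).hasStrictFDerivAt' (hasFDerivAt_refl hρ p) (by simp)
  have hinvol := fderiv_refl_involutive (ρ := ρ) hd hc
  set A := ContinuousLinearMap.id ℝ (E N) - (c • fderiv ℝ ρ p).smulRight d with hA
  have hAA : ∀ v, A (A v) = v := fun v => by
    have := congrArg (fun L => L v) hinvol
    simpa using this
  -- The involution `A` is its own inverse, so the inverse function theorem makes `refl` injective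
  -- near `p`.
  let Ae : E N ≃L[ℝ] E N := ContinuousLinearEquiv.equivOfInverse A A hAA hAA
  have hstrict' : HasStrictFDerivAt (refl ρ c d) (Ae : E N →L[ℝ] E N) p := hstrict
  let e := hstrict'.toOpenPartialHomeomorph (refl ρ c d)
  have ev2 : ∀ᶠ x in 𝓝 p, x ∈ e.source :=
    e.open_source.mem_nhds hstrict'.mem_toOpenPartialHomeomorph_source
  have hinj : Set.InjOn (refl ρ c d) e.source := by
    have := e.injOn
    rwa [hstrict'.toOpenPartialHomeomorph_coe] at this
  have hfc : Continuous fun x =>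
      ContinuousLinearMap.id ℝ (E N) - (c • fderiv ℝ ρ x).smulRight d := by
    have h1 : Continuous (fderiv ℝ ρ) := hρ.continuous_fderiv (by simp)
    have h2 : Continuous fun x => (c • fderiv ℝ ρ x).smulRight d :=
      ((ContinuousLinearMap.smulRightL ℝ (E N) (E N)).flip d).continuous.comp (h1.const_smul c)
    exact continuous_const.sub h2
  have ev3 : ∀ᶠ x in 𝓝 p, 1 / 4 <
      |(ContinuousLinearMap.id ℝ (E N) - (c • fderiv ℝ ρ x).smulRight d).det| := by
    have hcont : Continuous fun x =>
        |(ContinuousLinearMap.id ℝ (E N) - (c • fderiv ℝ ρ x).smulRight d).det| :=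
      (ContinuousLinearMap.continuous_det.comp hfc).abs
    have hdet1 : A.det * A.det = 1 := by
      have h1 := congrArg ContinuousLinearMap.det hinvol
      simp only [ContinuousLinearMap.det, ContinuousLinearMap.toLinearMap_comp, LinearMap.det_comp]
        at h1 ⊢
      rw [h1]; simp
    have hdetp : |A.det| = 1 := by
      have : |A.det| * |A.det| = 1 := by rw [← abs_mul, hdet1, abs_one]
      nlinarith [abs_nonneg A.det]
    refine (hcont.tendsto p).eventually (lt_mem_nhds ?_)
    rw [← hA, hdetp]; norm_num
  have ev4 : ∀ᶠ x in 𝓝 p, ∀ j k, |(if j = k then (1 : ℝ) else 0) -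
      ∑ i, reflJac ρ c d i j x * reflJac ρ c d i k x| < 1 / (8 * ((N : ℝ) ^ 2 + 1)) := by
    refine eventually_all.2 fun j => eventually_all.2 fun k => ?_
    have hcont : Continuous fun x => |(if j = k then (1 : ℝ) else 0) -
        ∑ i, reflJac ρ c d i j x * reflJac ρ c d i k x| :=
      (continuous_const.sub (continuous_finsetSum _ fun i _ =>
        ((contDiff_reflJac hρ i j).mul (contDiff_reflJac hρ i k)).continuous)).abs
    refine (hcont.tendsto p).eventually (gt_mem_nhds ?_)
    rw [sum_reflJac_mul_reflJac hd hc, sub_self, abs_zero]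
    positivity
  have hloc : ∀ f : E N → ℝ, Continuous f → ∀ᶠ x in 𝓝 p, |f x| < |f p| + 1 := fun f hf =>
    (hf.abs.tendsto p).eventually (gt_mem_nhds (lt_add_one _))
  -- The sum dominates each coefficient at `p` plus one, hence by continuity each coefficient near
  -- `p`.
  let M : ℝ := (∑ i, ∑ j, (|reflJac ρ c d i j p| + 1)) +
    ∑ j, (|∑ i, partialDeriv i (reflJac ρ c d i j) p| + 1)
  have hM0 : 0 ≤ M := by positivity
  have hM1 : ∀ i j, |reflJac ρ c d i j p| + 1 ≤ M := fun i j => by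
    have h1 : |reflJac ρ c d i j p| + 1 ≤ ∑ j, (|reflJac ρ c d i j p| + 1) :=
      Finset.single_le_sum (f := fun j => |reflJac ρ c d i j p| + 1) (fun _ _ => by positivity)
        (Finset.mem_univ j)
    have h2 : ∑ j, (|reflJac ρ c d i j p| + 1) ≤ ∑ i, ∑ j, (|reflJac ρ c d i j p| + 1) :=
      Finset.single_le_sum (f := fun i => ∑ j, (|reflJac ρ c d i j p| + 1))
        (fun _ _ => by positivity) (Finset.mem_univ i)
    have h3 : 0 ≤ ∑ j, (|∑ i, partialDeriv i (reflJac ρ c d i j) p| + 1) := by positivity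
    linarith
  have hM2 : ∀ j, |∑ i, partialDeriv i (reflJac ρ c d i j) p| + 1 ≤ M := fun j => by
    have h1 := Finset.single_le_sum
      (f := fun j => |∑ i, partialDeriv i (reflJac ρ c d i j) p| + 1) (fun _ _ => by positivity)
      (Finset.mem_univ j)
    have h3 : 0 ≤ ∑ i, ∑ j, (|reflJac ρ c d i j p| + 1) := by positivity
    linarith
  have ev5 : ∀ᶠ x in 𝓝 p, ∀ i j, |reflJac ρ c d i j x| ≤ M :=
    eventually_all.2 fun i => eventually_all.2 fun j => by
      filter_upwards [hloc _ (contDiff_reflJac (c := c) (d := d) hρ i j).continuous] with x hx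
      exact hx.le.trans (hM1 i j)
  have ev6 : ∀ᶠ x in 𝓝 p, ∀ j, |∑ i, partialDeriv i (reflJac ρ c d i j) x| ≤ M :=
    eventually_all.2 fun j => by
      filter_upwards [hloc _ (continuous_finsetSum Finset.univ fun i _ =>
        (contDiff_partialDeriv i (contDiff_reflJac (c := c) (d := d) hρ i j)).continuous)] with x hx
      exact hx.le.trans (hM2 j)
  obtain ⟨U, hUsub', hUo, hpU⟩ := eventually_nhds_iff.1 ((hU₀.eventually_mem hpU₀).and
    (ev1.and (ev2.and (ev3.and (ev4.and (ev5.and ev6))))))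
  have hUsub := fun {x} => hUsub' x
  refine ⟨U, hUo, hpU, _, _, ?_, isLocallySolvable_of_refl (ρ := ρ) (c := c) (d := d) hΩ.isOpen hUo
    hρ (fun x hx => hbdry x ⟨hx.1, (hUsub hx.2).1⟩) (fun x hx => (hUsub hx.2).2.1 hx.1)
    (hinj.mono fun x hx => (hUsub hx).2.2.1) (fun x hx => (hUsub hx).2.2.2.1.le) hM0
    (fun x hx => (hUsub hx).2.2.2.2.2.1) (fun x hx => (hUsub hx).2.2.2.2.2.2)
    (fun x hx j k => ((hUsub hx).2.2.2.2.1 j k).le)⟩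
  positivity

end Local
end Biharm

/-! ### Density of the range of `λ - Δ`. -/

namespace Biharm

section Density
variable {N : ℕ} {Ω : Set (E N)}

lemma l2_union_le {S T : Set (E N)} {f : E N → ℝ} (hS : MemL2 S f) (hT : MemL2 T f) :
    l2 (S ∪ T) f ≤ l2 S f + l2 T f := by
  have h2 : ∀ S : Set (E N), eLpNorm f 2 (volume.restrict S) ^ (2 : ℝ) =
      ∫⁻ x in S, ‖f x‖ₑ ^ (2 : ℝ) := fun S => by
    simpa using eLpNorm_nnreal_pow_eq_lintegral (f := f) (μ := volume.restrict S)
      (p := (2 : NNReal)) (by norm_num)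
  have hle : eLpNorm f 2 (volume.restrict (S ∪ T)) ^ (2 : ℝ) ≤
      (eLpNorm f 2 (volume.restrict S) + eLpNorm f 2 (volume.restrict T)) ^ (2 : ℝ) := by
    calc eLpNorm f 2 (volume.restrict (S ∪ T)) ^ (2 : ℝ)
        ≤ eLpNorm f 2 (volume.restrict S) ^ (2 : ℝ) + eLpNorm f 2 (volume.restrict T) ^ (2 : ℝ) := by
          rw [h2, h2, h2]; exact lintegral_union_le _ _ _
      _ ≤ _ := ENNReal.add_rpow_le_rpow_add _ _ (by norm_num)
  have := ENNReal.toReal_mono (ENNReal.add_ne_top.2 ⟨hS.2.ne, hT.2.ne⟩)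
    ((ENNReal.rpow_le_rpow_iff (by norm_num : (0 : ℝ) < 2)).1 hle)
  rwa [ENNReal.toReal_add hS.2.ne hT.2.ne] at this

/-- `v` is orthogonal to the range of `λ - Δ` on smooth functions vanishing on the boundary. -/
def IsOrthogonalToRange (Ω : Set (E N)) (lam : ℝ) (v : E N → ℝ) : Prop :=
  ∀ φ, IsDirichlet Ω φ → ∫ x in Ω, v x * (lam * φ x - lap φ x) = 0

/-- By duality the norm of `χ v` is tested against `g`. Solving `λφ - Δφ ≈ g` locally and using `χ
φ` in the orthogonality relation removes the main term. What remains is the commutator of `Δ` with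
the cutoff, of order `1/√λ`, and the solvability error, at most half the norm of `χ v`, which is
absorbed on the left. -/
lemma IsLocallySolvable.exists_l2_le (hΩ : IsOpen Ω) (hb : Bornology.IsBounded Ω)
    {U : Set (E N)} (hU : IsOpen U) {C lam₀ : ℝ} (hC : 0 ≤ C)
    (hsol : IsLocallySolvable Ω U C lam₀) {p : E N} (hp : p ∈ U) :
    ∃ S ∈ 𝓝 p, ∃ K, 0 ≤ K ∧ ∀ lam ≥ max lam₀ 1, ∀ v, MemL2 Ω v → IsOrthogonalToRange Ω lam v →
      l2 (Ω ∩ S) v ≤ K / √lam * l2 Ω v := by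
  obtain ⟨r, hr, hrU⟩ := Metric.isOpen_iff.1 hU p hp
  let χ : ContDiffBump p := ⟨r / 4, r / 2, by positivity, by linarith⟩
  have hχ : IsTestFunction U χ := by
    refine ⟨χ.contDiff, χ.hasCompactSupport, ?_⟩
    rw [χ.tsupport_eq]
    exact (Metric.closedBall_subset_ball (by simp only [χ]; linarith)).trans hrU
  have hbd : ∀ f : E N → ℝ, IsTestFunction U f → ∃ M, ∀ x, |f x| ≤ M := fun f hf =>
    hf.2.exists_bound_of_continuous hf.1.continuous
  choose M1 hM1 using fun i => hbd _ (hχ.partialDeriv i)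
  obtain ⟨M2, hM2⟩ := hbd _ hχ.lap
  have hM10 : ∀ i, 0 ≤ M1 i := fun i => (abs_nonneg _).trans (hM1 i p)
  have hM20 : 0 ≤ M2 := (abs_nonneg _).trans (hM2 p)
  let K₀ : ℝ := ∑ i, 2 * M1 i * C + M2 * C
  have hK₀ : 0 ≤ K₀ := add_nonneg
    (Finset.sum_nonneg fun i _ => mul_nonneg (mul_nonneg zero_le_two (hM10 i)) hC)
    (mul_nonneg hM20 hC)
  refine ⟨Metric.ball p (r / 4), Metric.ball_mem_nhds _ (by positivity), 2 * K₀, by positivity,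
    fun lam hlam v hv horth => ?_⟩
  have hlam1 : 1 ≤ lam := (le_max_right _ _).trans hlam
  have hsq0 : 0 < √lam := Real.sqrt_pos.2 (by linarith)
  have hSU : Metric.ball p (r / 4) ⊆ U := (Metric.ball_subset_ball (by linarith)).trans hrU
  have hO : IsOpen (Ω ∩ U) := hΩ.inter hU
  have hOb : Bornology.IsBounded (Ω ∩ U) := hb.subset Set.inter_subset_left
  have hvO : MemL2 (Ω ∩ U) v := hv.mono_set Set.inter_subset_left
  have hχv : MemL2 (Ω ∩ U) (fun x => χ x * v x) :=
    memL2_of_abs_le (c := 1) hvO (χ.continuous.aestronglyMeasurable.mul hvO.1)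
      (ae_of_all _ fun x => by
        rw [abs_mul, abs_of_nonneg χ.nonneg]
        exact mul_le_mul_of_nonneg_right χ.le_one (abs_nonneg _))
  have hmain : l2 (Ω ∩ U) (fun x => χ x * v x) ≤
      K₀ / √lam * l2 Ω v + 1 / 2 * l2 (Ω ∩ U) (fun x => χ x * v x) := by
    have hv0 : 0 ≤ l2 Ω v := l2_nonneg
    have hh0 : 0 ≤ l2 (Ω ∩ U) (fun x => χ x * v x) := l2_nonneg
    refine l2_le_of_forall_isTestFunction hO hχv (by positivity) fun g hg => ?_
    obtain ⟨φ, hφ, hφ0, he, hn0, hn1⟩ := hsol lam ((le_max_left _ _).trans hlam) g hg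
    have hG0 : 0 ≤ l2 (Ω ∩ U) g := l2_nonneg
    -- On `∂Ω` the product vanishes thanks to `φ` inside `U` and thanks to `χ` outside `U`.
    have hψ : IsDirichlet Ω (fun x => χ x * φ x) := by
      refine ⟨χ.contDiff.mul hφ, fun x hx => ?_⟩
      by_cases hxU : x ∈ U
      · rw [hφ0 x ⟨hx, hxU⟩, mul_zero]
      · rw [hχ.eq_zero hxU, zero_mul]
    have hψt : IsTestFunction U (fun x => χ x * φ x) := by
      have := hχ.mul_left hφ
      simpa only [mul_comm] using this
    have horth' := horth _ hψ
    rw [setIntegral_eq_of_subset_of_forall_sdiff_eq_zero hΩ.measurableSet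
      (Set.inter_subset_left : Ω ∩ U ⊆ Ω) fun x hx => by
        have hxU : x ∉ U := fun h => hx.2 ⟨hx.1, h⟩
        rw [hψt.eq_zero hxU, hψt.lap.eq_zero hxU]; simp] at horth'
    have mφ : MemL2 (Ω ∩ U) φ := memL2_of_continuous hOb hφ.continuous
    have mdφ : ∀ i, MemL2 (Ω ∩ U) (partialDeriv i φ) := fun i =>
      memL2_of_continuous hOb (contDiff_partialDeriv i hφ).continuous
    have me : MemL2 (Ω ∩ U) (fun x => lam * φ x - lap φ x - g x) :=
      memL2_of_continuous hOb (((continuous_const.mul hφ.continuous).sub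
        (contDiff_lap hφ).continuous).sub hg.1.continuous)
    -- The commutator `Δ(χφ) - χΔφ`, which involves no second derivatives of `φ`.
    let W : E N → ℝ := fun x => (∑ i, 2 * (partialDeriv i χ x * partialDeriv i φ x)) +
      φ x * lap χ x
    have hWc : Continuous W := (continuous_finsetSum _ fun i _ => continuous_const.mul
        ((hχ.partialDeriv i).1.continuous.mul (contDiff_partialDeriv i hφ).continuous)).add
      (hφ.continuous.mul hχ.lap.1.continuous)
    have mW : MemL2 (Ω ∩ U) W := memL2_of_continuous hOb hWc
    have mψ : MemL2 (Ω ∩ U) (fun x => lam * (χ x * φ x) - lap (fun x => χ x * φ x) x) :=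
      memL2_of_continuous hOb ((continuous_const.mul hψ.1.continuous).sub
        (contDiff_lap hψ.1).continuous)
    have hid : ∀ x, χ x * v x * g x = v x * (lam * (χ x * φ x) - lap (fun x => χ x * φ x) x) +
        v x * W x - χ x * v x * (lam * φ x - lap φ x - g x) := by
      intro x
      rw [lap_mul χ.contDiff hφ]
      simp only [W, ← Finset.mul_sum]
      ring
    have hint : ∫ x in Ω ∩ U, χ x * v x * g x = (∫ x in Ω ∩ U, v x * W x) -
        ∫ x in Ω ∩ U, χ x * v x * (lam * φ x - lap φ x - g x) := by
      simp only [hid]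
      have i1 := integrable_mul_of_memL2 hvO mψ
      have i2 := integrable_mul_of_memL2 hvO mW
      have i12 : Integrable (fun x => v x * (lam * (χ x * φ x) - lap (fun x => χ x * φ x) x) +
        v x * W x) (volume.restrict (Ω ∩ U)) := i1.add i2
      rw [integral_sub i12 (integrable_mul_of_memL2 hχv me), integral_add i1 i2, horth', zero_add]
    have hWn : l2 (Ω ∩ U) W ≤ K₀ / √lam * l2 (Ω ∩ U) g := by
      have m1 : ∀ i, MemL2 (Ω ∩ U) (fun x => 2 * (partialDeriv i χ x * partialDeriv i φ x)) :=
        fun i => memL2_of_continuous hOb (continuous_const.mul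
          ((hχ.partialDeriv i).1.continuous.mul (contDiff_partialDeriv i hφ).continuous))
      have m2 : MemL2 (Ω ∩ U) (fun x => φ x * lap χ x) :=
        memL2_of_continuous hOb (hφ.continuous.mul hχ.lap.1.continuous)
      have n1 : ∀ i, l2 (Ω ∩ U) (fun x => 2 * (partialDeriv i χ x * partialDeriv i φ x)) ≤
          2 * M1 i * (C * l2 (Ω ∩ U) g / √lam) := fun i => by
        refine (l2_le_of_abs_le (c := 2 * M1 i) (by have := hM10 i; positivity) (mdφ i)
          (ae_of_all _ fun x => ?_)).trans ?_
        · rw [abs_mul, abs_mul, abs_two, mul_assoc]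
          gcongr
          exact hM1 i x
        · have := hM10 i
          gcongr
          rw [le_div_iff₀ hsq0, mul_comm]
          exact hn1 i
      have n2 : l2 (Ω ∩ U) (fun x => φ x * lap χ x) ≤ M2 * (C * l2 (Ω ∩ U) g / √lam) := by
        refine (l2_le_of_abs_le (c := M2) hM20 mφ (ae_of_all _ fun x => ?_)).trans ?_
        · rw [abs_mul, mul_comm]
          gcongr
          exact hM2 x
        · gcongr
          rw [le_div_iff₀ hsq0, mul_comm]
          exact hn0
      refine (l2_add_le (memLp_finsetSum _ fun i _ => m1 i) m2).trans ?_
      refine (add_le_add ((l2_sum_le _ fun i _ => m1 i).trans (Finset.sum_le_sum fun i _ => n1 i))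
        n2).trans (le_of_eq ?_)
      simp only [K₀, ← Finset.sum_mul]
      ring
    have b1 := abs_integral_mul_le hvO mW
    have b2 := abs_integral_mul_le hχv me
    have b3 : l2 (Ω ∩ U) v ≤ l2 Ω v := l2_mono_set Set.inter_subset_left hv
    rw [hint]
    calc _ ≤ _ := abs_sub _ _
      _ ≤ l2 (Ω ∩ U) v * l2 (Ω ∩ U) W + l2 (Ω ∩ U) (fun x => χ x * v x) *
          l2 (Ω ∩ U) (fun x => lam * φ x - lap φ x - g x) := add_le_add b1 b2
      _ ≤ l2 Ω v * (K₀ / √lam * l2 (Ω ∩ U) g) + l2 (Ω ∩ U) (fun x => χ x * v x) *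
          (1 / 2 * l2 (Ω ∩ U) g) := add_le_add
            (mul_le_mul b3 hWn l2_nonneg hv0) (mul_le_mul_of_nonneg_left he hh0)
      _ = _ := by ring
  have hfin : l2 (Ω ∩ Metric.ball p (r / 4)) v ≤ l2 (Ω ∩ U) (fun x => χ x * v x) := by
    have h1 : l2 (Ω ∩ Metric.ball p (r / 4)) v =
        l2 (Ω ∩ Metric.ball p (r / 4)) (fun x => χ x * v x) := by
      refine l2_congr ((ae_restrict_iff' (hΩ.inter Metric.isOpen_ball).measurableSet).2
        (ae_of_all _ fun x hx => ?_))
      rw [χ.one_of_mem_closedBall (Metric.ball_subset_closedBall hx.2), one_mul]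
    rw [h1]
    exact l2_mono_set (Set.inter_subset_inter_right _ hSU) hχv
  have : 2 * K₀ / √lam * l2 Ω v = 2 * (K₀ / √lam * l2 Ω v) := by ring
  linarith

/-- For large `λ` the range of `λ - Δ` on smooth functions vanishing on `∂Ω` is dense. -/
lemma exists_forall_isOrthogonalToRange_ae_eq_zero (hΩ : IsSmoothBoundedDomain Ω) :
    ∃ lam > 0, ∀ v, MemL2 Ω v → IsOrthogonalToRange Ω lam v →
      ∀ᵐ x ∂(volume.restrict Ω), v x = 0 := by
  -- Compactness induction: the local bounds pass to subsets and add up over unions, so finitely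
  -- many neighbourhoods yield one on `closure Ω`.
  have hcov := hΩ.isBounded.isCompact_closure.induction_on
    (p := fun S => ∃ K lam₀, 0 ≤ K ∧ ∀ lam ≥ lam₀, ∀ v, MemL2 Ω v → IsOrthogonalToRange Ω lam v →
      l2 (Ω ∩ S) v ≤ K / √lam * l2 Ω v) ?_ ?_ ?_ ?_
  · obtain ⟨K, lam₀, hK, h⟩ := hcov
    -- This makes `K/√λ ≤ 1/2`: the norm of `v` is at most half of itself.
    let lam := max lam₀ ((2 * K + 1) ^ 2)
    have hsq : 2 * K + 1 ≤ √lam := Real.le_sqrt_of_sq_le (le_max_right _ _)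
    refine ⟨lam, lt_of_lt_of_le (by positivity) (le_max_right _ _), fun v hv horth => ?_⟩
    have h1 := h lam (le_max_left _ _) v hv horth
    rw [Set.inter_eq_self_of_subset_left subset_closure] at h1
    refine l2_eq_zero hv (le_antisymm ?_ l2_nonneg)
    have h2 : K / √lam ≤ 1 / 2 := by
      rw [div_le_iff₀ (by linarith)]; linarith
    have h3 : 0 ≤ l2 Ω v := l2_nonneg
    nlinarith
  · exact ⟨0, 0, le_rfl, fun lam _ v _ _ => by simp [l2]⟩
  · rintro S T hST ⟨K, lam₀, hK, h⟩
    exact ⟨K, lam₀, hK, fun lam hl v hv ho => (l2_mono_set (Set.inter_subset_inter_right _ hST)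
      (hv.mono_set Set.inter_subset_left)).trans (h lam hl v hv ho)⟩
  · rintro S T ⟨K, lam₀, hK, h⟩ ⟨K', lam₀', hK', h'⟩
    refine ⟨K + K', max lam₀ lam₀', by positivity, fun lam hl v hv ho => ?_⟩
    rw [Set.inter_union_distrib_left]
    refine (l2_union_le (hv.mono_set Set.inter_subset_left)
      (hv.mono_set Set.inter_subset_left)).trans ?_
    refine (add_le_add (h lam ((le_max_left _ _).trans hl) v hv ho)
      (h' lam ((le_max_right _ _).trans hl) v hv ho)).trans (le_of_eq (by ring))
  · intro p hp
    have : ∃ U : Set (E N), IsOpen U ∧ p ∈ U ∧ ∃ C lam₀, 0 ≤ C ∧ IsLocallySolvable Ω U C lam₀ := by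
      by_cases hpΩ : p ∈ Ω
      · exact ⟨Ω, hΩ.isOpen, hpΩ, 1, 1, zero_le_one, isLocallySolvable_interior hΩ.isOpen⟩
      · refine exists_isLocallySolvable_of_mem_frontier hΩ ?_
        rw [frontier, hΩ.isOpen.interior_eq]
        exact ⟨hp, hpΩ⟩
    obtain ⟨U, hU, hpU, C, lam₀, hC, hsol⟩ := this
    obtain ⟨S, hS, K, hK, h⟩ := hsol.exists_l2_le hΩ.isOpen hΩ.isBounded hU hC hpU
    exact ⟨S, mem_nhdsWithin_of_mem_nhds hS, K, _, hK, h⟩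

/-- Triviality of the orthogonal complement and density of the range are recorded for the same `λ`:
density produces approximations, and the other identifies their limit. -/
lemma exists_isDirichlet_l2_sub_lt (hΩ : IsSmoothBoundedDomain Ω) :
    ∃ lam > 0, (∀ v, MemL2 Ω v → IsOrthogonalToRange Ω lam v →
      ∀ᵐ x ∂(volume.restrict Ω), v x = 0) ∧ ∀ f, MemL2 Ω f → ∀ ε > 0, ∃ φ, IsDirichlet Ω φ ∧
      l2 Ω (fun x => f x - (lam * φ x - lap φ x)) < ε := by
  obtain ⟨lam, hlam, h⟩ := exists_forall_isOrthogonalToRange_ae_eq_zero hΩ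
  refine ⟨lam, hlam, h, fun f hf ε hε => ?_⟩
  have hden := exists_l2_sub_lt
    {F : E N → ℝ | ∃ φ, IsDirichlet Ω φ ∧ F = fun x => lam * φ x - lap φ x} ?_ ?_ ?_ ?_ ?_ hf hε
  · obtain ⟨_, ⟨φ, hφ, rfl⟩, hlt⟩ := hden
    exact ⟨φ, hφ, hlt⟩
  · rintro _ ⟨φ, hφ, rfl⟩
    exact memL2_of_continuous hΩ.isBounded ((continuous_const.mul hφ.1.continuous).sub
      (contDiff_lap hφ.1).continuous)
  · rintro _ ⟨φ, hφ, rfl⟩ _ ⟨ψ, hψ, rfl⟩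
    refine ⟨_, hφ.add hψ, ?_⟩
    ext x; rw [lap_add hφ.1 hψ.1]; ring
  · rintro c _ ⟨φ, hφ, rfl⟩
    refine ⟨_, hφ.const_mul c, ?_⟩
    ext x; rw [lap_const_mul c hφ.1]; ring
  · exact ⟨_, fun _ => 0, ⟨contDiff_const, fun _ _ => rfl⟩, rfl⟩
  · exact fun v hv horth => h v hv fun φ hφ => horth _ ⟨φ, hφ, rfl⟩

end Density
end Biharm

/-! ### The weak maximum principle for very weak solutions. -/

namespace Biharm

/-- A smooth nondecreasing function vanishing exactly on `[0, ∞)`. -/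
noncomputable def negTrunc (s : ℝ) : ℝ := ∫ t in (0 : ℝ)..s, Real.smoothTransition (-t)

lemma continuous_smoothTransition_neg : Continuous fun t : ℝ => Real.smoothTransition (-t) :=
  Real.smoothTransition.continuous.comp continuous_neg

lemma deriv_negTrunc : deriv negTrunc = fun s => Real.smoothTransition (-s) := by
  ext s; exact continuous_smoothTransition_neg.deriv_integral _ 0 s

lemma contDiff_negTrunc : ContDiff ℝ ∞ negTrunc := by
  rw [contDiff_infty_iff_deriv, deriv_negTrunc]
  exact ⟨fun s => (continuous_smoothTransition_neg.integral_hasStrictDerivAt 0 s).hasDerivAt.differentiableAt,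
    Real.smoothTransition.contDiff.comp contDiff_neg⟩

lemma abs_negTrunc_sub_le (s t : ℝ) : |negTrunc s - negTrunc t| ≤ |s - t| := by
  have hi : ∀ a b : ℝ, IntervalIntegrable (fun t : ℝ => Real.smoothTransition (-t)) volume a b :=
    fun a b => continuous_smoothTransition_neg.intervalIntegrable a b
  rw [negTrunc, negTrunc, intervalIntegral.integral_interval_sub_left (hi _ _) (hi _ _)]
  have := intervalIntegral.norm_integral_le_of_norm_le_const (a := t) (b := s) (C := 1)
    (f := fun t : ℝ => Real.smoothTransition (-t)) fun x _ => by
      rw [Real.norm_of_nonneg (Real.smoothTransition.nonneg _)]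
      exact Real.smoothTransition.le_one _
  simpa using this

lemma negTrunc_zero : negTrunc 0 = 0 := by simp [negTrunc]

lemma abs_negTrunc_le (s : ℝ) : |negTrunc s| ≤ |s| := by
  simpa [negTrunc_zero] using abs_negTrunc_sub_le s 0

lemma negTrunc_nonpos (s : ℝ) : negTrunc s ≤ 0 := by
  rcases le_total 0 s with h | h
  · refine le_of_eq (intervalIntegral.integral_zero_ae (ae_of_all _ fun t ht => ?_))
    rw [Set.uIoc_of_le h] at ht
    exact Real.smoothTransition.zero_of_nonpos (by linarith [ht.1])
  · rw [negTrunc, intervalIntegral.integral_symm, neg_nonpos]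
    exact intervalIntegral.integral_nonneg h fun t _ => Real.smoothTransition.nonneg _

lemma nonneg_of_negTrunc_eq_zero {s : ℝ} (h : negTrunc s = 0) : 0 ≤ s := by
  by_contra! hs
  have : 0 < ∫ t in s..0, Real.smoothTransition (-t) :=
    intervalIntegral.intervalIntegral_pos_of_pos_on
      (continuous_smoothTransition_neg.intervalIntegrable _ _)
      (fun t ht => Real.smoothTransition.pos_of_pos (by linarith [ht.2])) hs
  rw [negTrunc, intervalIntegral.integral_symm] at h
  linarith

section Positivity
variable {N : ℕ} {Ω : Set (E N)} {φ ψ : E N → ℝ}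

lemma IsDirichlet.integral_mul_lap_comm (hΩ : IsOpen Ω) (hb : Bornology.IsBounded Ω)
    (hφ : IsDirichlet Ω φ) (hψ : IsDirichlet Ω ψ) :
    ∫ x in Ω, φ x * lap ψ x = ∫ x in Ω, lap φ x * ψ x := by
  have h : ∫ x in Ω, lap φ x * ψ x = ∫ x in Ω, ψ x * lap φ x := by
    congr 1; ext x; ring
  rw [h, hφ.integral_mul_lap hΩ hb hψ.1, hψ.integral_mul_lap hΩ hb hφ.1]
  congr 1
  refine Finset.sum_congr rfl fun i _ => ?_
  congr 1; ext x; ring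

/-- The energy estimate for `λ - Δ`. -/
lemma IsDirichlet.mul_l2_le (hΩ : IsOpen Ω) (hb : Bornology.IsBounded Ω)
    (hφ : IsDirichlet Ω φ) (lam : ℝ) :
    lam * l2 Ω φ ≤ l2 Ω (fun x => lam * φ x - lap φ x) := by
  have mφ : MemL2 Ω φ := memL2_of_continuous hb hφ.1.continuous
  have ml : MemL2 Ω (lap φ) := memL2_of_continuous hb (contDiff_lap hφ.1).continuous
  have mF : MemL2 Ω (fun x => lam * φ x - lap φ x) := (mφ.const_mul lam).sub ml
  have h1 : ∫ x in Ω, φ x * (lam * φ x - lap φ x) =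
      lam * l2 Ω φ ^ 2 - ∫ x in Ω, φ x * lap φ x := by
    rw [l2_sq mφ, ← integral_const_mul, ← integral_sub]
    · congr 1; ext x; ring
    · simpa only [sq] using (integrable_mul_of_memL2 mφ mφ).const_mul lam
    · exact integrable_mul_of_memL2 mφ ml
  rw [hφ.integral_mul_lap hΩ hb hφ.1] at h1
  have h2 : 0 ≤ ∑ i, ∫ x in Ω, partialDeriv i φ x * partialDeriv i φ x :=
    Finset.sum_nonneg fun i _ => integral_nonneg fun x => mul_self_nonneg _
  have h3 := (le_abs_self _).trans (abs_integral_mul_le mφ mF)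
  have h0 : 0 ≤ l2 Ω φ := l2_nonneg
  rcases h0.eq_or_lt with h6 | h6
  · rw [← h6, mul_zero]; exact l2_nonneg
  · refine le_of_mul_le_mul_left ?_ h6
    nlinarith

/-- Test `-Δφ = f - (f + Δφ)` with the smooth negative part of `φ`. As `f ≥ 0` contributes with a
favourable sign, only the residual `f + Δφ` remains, and Poincaré's inequality passes from the
gradient to the function. -/
lemma exists_forall_l2_negTrunc_le (hΩ : IsOpen Ω) (hb : Bornology.IsBounded Ω) (i : Fin N) :
    ∃ C, 0 ≤ C ∧ ∀ φ f, IsDirichlet Ω φ → MemL2 Ω f → (∀ᵐ x ∂(volume.restrict Ω), 0 ≤ f x) →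
      l2 Ω (fun x => negTrunc (φ x)) ^ 2 ≤ C * (l2 Ω (fun x => f x + lap φ x) * l2 Ω φ) := by
  obtain ⟨C, hC, hP⟩ := exists_l2_le_mul_l2_partialDeriv hΩ hb i
  refine ⟨C ^ 2, by positivity, fun φ f hφ hf hf0 => ?_⟩
  have hβ : IsDirichlet Ω (fun x => negTrunc (φ x)) :=
    ⟨contDiff_negTrunc.comp hφ.1, fun x hx => by simp [hφ.2 x hx, negTrunc_zero]⟩
  have mβ : MemL2 Ω (fun x => negTrunc (φ x)) := memL2_of_continuous hb hβ.1.continuous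
  have mφ : MemL2 Ω φ := memL2_of_continuous hb hφ.1.continuous
  have ml : MemL2 Ω (lap φ) := memL2_of_continuous hb (contDiff_lap hφ.1).continuous
  have mfl : MemL2 Ω (fun x => f x + lap φ x) := hf.add ml
  have mdβ : ∀ j, MemL2 Ω (partialDeriv j fun x => negTrunc (φ x)) := fun j =>
    memL2_of_continuous hb (contDiff_partialDeriv j hβ.1).continuous
  have mdφ : ∀ j, MemL2 Ω (partialDeriv j φ) := fun j =>
    memL2_of_continuous hb (contDiff_partialDeriv j hφ.1).continuous
  have hdβ : ∀ j x, partialDeriv j (fun x => negTrunc (φ x)) x =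
      Real.smoothTransition (-φ x) * partialDeriv j φ x := fun j x => by
    rw [partialDeriv_comp_real contDiff_negTrunc hφ.1, deriv_negTrunc]
  have h1 : ∑ j, l2 Ω (partialDeriv j fun x => negTrunc (φ x)) ^ 2 ≤
      - ∫ x in Ω, negTrunc (φ x) * lap φ x := by
    rw [hβ.integral_mul_lap hΩ hb hφ.1, neg_neg]
    refine Finset.sum_le_sum fun j _ => ?_
    rw [l2_sq (mdβ j)]
    refine integral_mono ?_ (integrable_mul_of_memL2 (mdφ j) (mdβ j)) fun x => ?_
    · simpa only [sq] using integrable_mul_of_memL2 (mdβ j) (mdβ j)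
    · simp only [hdβ]
      have h2 := Real.smoothTransition.nonneg (-φ x)
      have h3 := Real.smoothTransition.le_one (-φ x)
      -- The derivative of `negTrunc` lies in `[0, 1]`, so `|∇ negTrunc(φ)|² ≤ ∇φ · ∇ negTrunc(φ)`.
      have h4 : Real.smoothTransition (-φ x) ^ 2 ≤ Real.smoothTransition (-φ x) := by nlinarith
      have h5 := mul_le_mul_of_nonneg_right h4 (sq_nonneg (partialDeriv j φ x))
      nlinarith
  have h2 : - ∫ x in Ω, negTrunc (φ x) * lap φ x =
      (∫ x in Ω, negTrunc (φ x) * f x) - ∫ x in Ω, negTrunc (φ x) * (f x + lap φ x) := by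
    rw [← integral_sub (integrable_mul_of_memL2 mβ hf) (integrable_mul_of_memL2 mβ mfl),
      ← integral_neg]
    congr 1; ext x; ring
  have h3 : ∫ x in Ω, negTrunc (φ x) * f x ≤ 0 := by
    refine integral_nonpos_of_ae ?_
    filter_upwards [hf0] with x hx
    exact mul_nonpos_of_nonpos_of_nonneg (negTrunc_nonpos _) hx
  have h4 := (neg_le_abs _).trans (abs_integral_mul_le mβ mfl)
  have h5 : l2 Ω (fun x => negTrunc (φ x)) ≤ l2 Ω φ := by
    simpa using l2_le_of_abs_le (c := 1) zero_le_one mφ (f := fun x => negTrunc (φ x))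
      (ae_of_all _ fun x => by simpa using abs_negTrunc_le (φ x))
  have h6 : l2 Ω (partialDeriv i fun x => negTrunc (φ x)) ^ 2 ≤
      ∑ j, l2 Ω (partialDeriv j fun x => negTrunc (φ x)) ^ 2 :=
    Finset.single_le_sum (f := fun j => l2 Ω (partialDeriv j fun x => negTrunc (φ x)) ^ 2)
      (fun _ _ => sq_nonneg _) (Finset.mem_univ i)
  have h7 : l2 Ω (fun x => negTrunc (φ x)) * l2 Ω (fun x => f x + lap φ x) ≤
      l2 Ω φ * l2 Ω (fun x => f x + lap φ x) := mul_le_mul_of_nonneg_right h5 l2_nonneg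
  calc l2 Ω (fun x => negTrunc (φ x)) ^ 2
      ≤ (C * l2 Ω (partialDeriv i fun x => negTrunc (φ x))) ^ 2 :=
        pow_le_pow_left₀ l2_nonneg (hP _ hβ) 2
    _ = C ^ 2 * l2 Ω (partialDeriv i fun x => negTrunc (φ x)) ^ 2 := by ring
    _ ≤ _ := by gcongr; linarith

/-- Very weak solutions are limits of smooth functions vanishing on the boundary. -/
lemma exists_seq_isDirichlet (hΩ : IsSmoothBoundedDomain Ω) {w f : E N → ℝ}
    (hw : MemL2 Ω w) (hf : MemL2 Ω f)
    (h : ∀ φ, IsDirichlet Ω φ → ∫ x in Ω, w x * lap φ x = - ∫ x in Ω, f x * φ x) :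
    ∃ φ : ℕ → E N → ℝ, (∀ n, IsDirichlet Ω (φ n)) ∧
      Tendsto (fun n => l2 Ω (fun x => φ n x - w x)) atTop (𝓝 0) ∧
      Tendsto (fun n => l2 Ω (fun x => f x + lap (φ n) x)) atTop (𝓝 0) := by
  obtain ⟨lam, hlam, horth, hdense⟩ := exists_isDirichlet_l2_sub_lt hΩ
  have ho := hΩ.isOpen
  have hb := hΩ.isBounded
  -- Formally `λw - Δw = f + λw`; the `φ n` solve this equation up to `1/(n+1)`.
  have mF : MemL2 Ω (fun x => f x + lam * w x) := hf.add (hw.const_mul lam)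
  choose φ hφ hlt using fun n : ℕ => hdense _ mF (1 / ((n : ℝ) + 1)) (by positivity)
  have mφ : ∀ n, MemL2 Ω (φ n) := fun n => memL2_of_continuous hb (hφ n).1.continuous
  have ml : ∀ n, MemL2 Ω (lap (φ n)) := fun n =>
    memL2_of_continuous hb (contDiff_lap (hφ n).1).continuous
  have mA : ∀ n, MemL2 Ω (fun x => lam * φ n x - lap (φ n) x) := fun n =>
    ((mφ n).const_mul lam).sub (ml n)
  have mR : ∀ n, MemL2 Ω (fun x => f x + lam * w x - (lam * φ n x - lap (φ n) x)) := fun n =>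
    mF.sub (mA n)
  -- The energy estimate bounds `λ` times the distance of two terms by the sum of their residuals.
  have hcauchy : CauchySeq fun n => (mφ n).toLp (φ n) := by
    refine cauchySeq_of_le_tendsto_0 (fun n : ℕ => 2 / lam * (1 / ((n : ℝ) + 1))) ?_ ?_
    · intro n m k hn hm
      have hd := (hφ n).sub (hφ m)
      have e1 : dist ((mφ n).toLp (φ n)) ((mφ m).toLp (φ m)) = l2 Ω (fun x => φ n x - φ m x) := by
        rw [dist_eq_norm]
        exact (l2_eq_norm_toLp ((mφ n).sub (mφ m))).symm
      have e2 := hd.mul_l2_le ho hb lam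
      have e3 : (fun x => lam * (φ n x - φ m x) - lap (fun x => φ n x - φ m x) x) = fun x =>
          (f x + lam * w x - (lam * φ m x - lap (φ m) x)) -
            (f x + lam * w x - (lam * φ n x - lap (φ n) x)) := by
        ext x; rw [lap_sub (hφ n).1 (hφ m).1]; ring
      rw [e3] at e2
      have e4 := e2.trans (l2_sub_le (mR m) (mR n))
      have e5 : ∀ j, k ≤ j → l2 Ω (fun x => f x + lam * w x - (lam * φ j x - lap (φ j) x)) ≤
          1 / ((k : ℝ) + 1) := fun j hj => (hlt j).le.trans (by gcongr)
      have e6 := e4.trans (add_le_add (e5 m hm) (e5 n hn))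
      rw [e1, div_mul_eq_mul_div, le_div_iff₀ hlam]
      linarith
    · simpa using (tendsto_one_div_add_atTop_nhds_zero_nat (𝕜 := ℝ)).const_mul (2 / lam)
  obtain ⟨W, hW⟩ := cauchySeq_tendsto_of_complete hcauchy
  have mW : MemL2 Ω W := Lp.memLp W
  have hlim : Tendsto (fun n => l2 Ω (fun x => φ n x - W x)) atTop (𝓝 0) := by
    refine (tendsto_iff_dist_tendsto_zero.1 hW).congr fun n => ?_
    have e1 : l2 Ω (fun x => φ n x - W x) = ‖(mφ n).toLp (φ n) - mW.toLp W‖ :=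
      l2_eq_norm_toLp ((mφ n).sub mW)
    rw [e1, dist_eq_norm, Lp.toLp_coeFn W mW]
  have htend : ∀ {F : ℕ → E N → ℝ} {G g : E N → ℝ}, (∀ n, MemL2 Ω (F n)) → MemL2 Ω G →
      MemL2 Ω g → Tendsto (fun n => l2 Ω (fun x => F n x - G x)) atTop (𝓝 0) →
      Tendsto (fun n => ∫ x in Ω, F n x * g x) atTop (𝓝 (∫ x in Ω, G x * g x)) := by
    intro F G g hF hG hg hFG
    have h0 : Tendsto (fun n => l2 Ω (fun x => F n x - G x) * l2 Ω g) atTop (𝓝 0) := by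
      simpa using hFG.mul_const (l2 Ω g)
    refine tendsto_iff_norm_sub_tendsto_zero.2
      (squeeze_zero (fun _ => norm_nonneg _) (fun n => ?_) h0)
    have hd : MemL2 Ω (fun x => F n x - G x) := (hF n).sub hG
    rw [← integral_sub (integrable_mul_of_memL2 (hF n) hg) (integrable_mul_of_memL2 hG hg),
      Real.norm_eq_abs]
    simpa only [sub_mul] using abs_integral_mul_le hd hg
  have h1n : Tendsto (fun n : ℕ => 1 / ((n : ℝ) + 1)) atTop (𝓝 0) :=
    tendsto_one_div_add_atTop_nhds_zero_nat
  have hRlim : Tendsto (fun n => l2 Ω (fun x => f x + lam * w x - (lam * φ n x - lap (φ n) x)))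
      atTop (𝓝 0) := squeeze_zero (fun _ => l2_nonneg) (fun n => (hlt n).le) h1n
  have hAlim : Tendsto (fun n => l2 Ω (fun x => (lam * φ n x - lap (φ n) x) -
      (f x + lam * w x))) atTop (𝓝 0) := by
    refine hRlim.congr fun n => ?_
    simp only [l2]
    congr 1
    exact eLpNorm_sub_comm (fun x => f x + lam * w x) (fun x => lam * φ n x - lap (φ n) x) _ _
  -- By symmetry of `λ - Δ`, both `W` and `w` pair with `λψ - Δψ` to the integral of `(f + λw) ψ`;
  -- hence `W - w` is orthogonal to the range.
  have hWw : ∀ᵐ x ∂(volume.restrict Ω), W x - w x = 0 := by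
    refine horth (fun x => W x - w x) (mW.sub hw) fun ψ hψ => ?_
    have mψ : MemL2 Ω ψ := memL2_of_continuous hb hψ.1.continuous
    have mlψ : MemL2 Ω (lap ψ) := memL2_of_continuous hb (contDiff_lap hψ.1).continuous
    have mB : MemL2 Ω (fun x => lam * ψ x - lap ψ x) := (mψ.const_mul lam).sub mlψ
    have t1 := htend mφ mW mB hlim
    have t2 := htend mA mF mψ hAlim
    have hsym : ∀ n, ∫ x in Ω, φ n x * (lam * ψ x - lap ψ x) =
        ∫ x in Ω, (lam * φ n x - lap (φ n) x) * ψ x := by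
      intro n
      have i1 : ∫ x in Ω, φ n x * (lam * ψ x - lap ψ x) =
          (∫ x in Ω, lam * (φ n x * ψ x)) - ∫ x in Ω, φ n x * lap ψ x := by
        rw [← integral_sub ((integrable_mul_of_memL2 (mφ n) mψ).const_mul lam)
          (integrable_mul_of_memL2 (mφ n) mlψ)]
        congr 1; ext x; ring
      have i2 : ∫ x in Ω, (lam * φ n x - lap (φ n) x) * ψ x =
          (∫ x in Ω, lam * (φ n x * ψ x)) - ∫ x in Ω, lap (φ n) x * ψ x := by
        rw [← integral_sub ((integrable_mul_of_memL2 (mφ n) mψ).const_mul lam)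
          (integrable_mul_of_memL2 (ml n) mψ)]
        congr 1; ext x; ring
      rw [i1, i2, (hφ n).integral_mul_lap_comm ho hb hψ]
    have e1 : ∫ x in Ω, W x * (lam * ψ x - lap ψ x) = ∫ x in Ω, (f x + lam * w x) * ψ x :=
      tendsto_nhds_unique t1 (t2.congr fun n => (hsym n).symm)
    have e2 : ∫ x in Ω, w x * (lam * ψ x - lap ψ x) = ∫ x in Ω, (f x + lam * w x) * ψ x := by
      have i1 : ∫ x in Ω, w x * (lam * ψ x - lap ψ x) =
          (∫ x in Ω, lam * (w x * ψ x)) - ∫ x in Ω, w x * lap ψ x := by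
        rw [← integral_sub ((integrable_mul_of_memL2 hw mψ).const_mul lam)
          (integrable_mul_of_memL2 hw mlψ)]
        congr 1; ext x; ring
      rw [i1, h ψ hψ, sub_neg_eq_add, ← integral_add
        ((integrable_mul_of_memL2 hw mψ).const_mul lam) (integrable_mul_of_memL2 hf mψ)]
      congr 1; ext x; ring
    simp only [sub_mul]
    rw [integral_sub (integrable_mul_of_memL2 mW mB) (integrable_mul_of_memL2 hw mB), e1, e2,
      sub_self]
  have hlim' : Tendsto (fun n => l2 Ω (fun x => φ n x - w x)) atTop (𝓝 0) := by
    refine hlim.congr fun n => l2_congr ?_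
    filter_upwards [hWw] with x hx
    rw [sub_eq_zero.1 hx]
  refine ⟨φ, hφ, hlim', ?_⟩
  have hsum : Tendsto (fun n => l2 Ω (fun x => f x + lam * w x - (lam * φ n x - lap (φ n) x)) +
      |lam| * l2 Ω (fun x => φ n x - w x)) atTop (𝓝 0) := by
    simpa using hRlim.add (hlim'.const_mul |lam|)
  refine squeeze_zero (fun _ => l2_nonneg) (fun n => ?_) hsum
  have md : MemL2 Ω (fun x => φ n x - w x) := (mφ n).sub hw
  have e : (fun x => f x + lap (φ n) x) = fun x =>
      (f x + lam * w x - (lam * φ n x - lap (φ n) x)) + lam * (φ n x - w x) := by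
    ext x; ring
  rw [e]
  exact (l2_add_le (mR n) (md.const_mul lam)).trans (add_le_add le_rfl (l2_const_mul_le lam md))

/-- The maximum principle for very weak solutions of `-Δw = f`, `w = 0` on `∂Ω`. -/
lemma ae_nonneg_of_veryWeak (hN : 1 ≤ N) (hΩ : IsSmoothBoundedDomain Ω) {w f : E N → ℝ}
    (hw : MemL2 Ω w) (hf : MemL2 Ω f) (hf0 : ∀ᵐ x ∂(volume.restrict Ω), 0 ≤ f x)
    (h : ∀ φ, IsDirichlet Ω φ → ∫ x in Ω, w x * lap φ x = - ∫ x in Ω, f x * φ x) :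
    ∀ᵐ x ∂(volume.restrict Ω), 0 ≤ w x := by
  obtain ⟨φ, hφ, hlim, hlap⟩ := exists_seq_isDirichlet hΩ hw hf h
  obtain ⟨C, hC, hest⟩ := exists_forall_l2_negTrunc_le hΩ.isOpen hΩ.isBounded (⟨0, hN⟩ : Fin N)
  have mφ : ∀ n, MemL2 Ω (φ n) := fun n => memL2_of_continuous hΩ.isBounded (hφ n).1.continuous
  have mβφ : ∀ n, MemL2 Ω (fun x => negTrunc (φ n x)) := fun n =>
    memL2_of_continuous hΩ.isBounded (contDiff_negTrunc.comp (hφ n).1).continuous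
  have mβw : MemL2 Ω (fun x => negTrunc (w x)) :=
    memL2_of_abs_le (c := 1) hw (contDiff_negTrunc.continuous.comp_aestronglyMeasurable hw.1)
      (ae_of_all _ fun x => by simpa using abs_negTrunc_le (w x))
  have md : ∀ n, MemL2 Ω (fun x => φ n x - w x) := fun n => (mφ n).sub hw
  have hφb : ∀ n, l2 Ω (φ n) ≤ l2 Ω (fun x => φ n x - w x) + l2 Ω w := fun n => by
    have : φ n = fun x => (φ n x - w x) + w x := by ext x; ring
    conv_lhs => rw [this]
    exact l2_add_le (md n) hw
  have t1 : Tendsto (fun n => C * (l2 Ω (fun x => f x + lap (φ n) x) *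
      (l2 Ω (fun x => φ n x - w x) + l2 Ω w))) atTop (𝓝 0) := by
    simpa using (hlap.mul (hlim.add_const (l2 Ω w))).const_mul C
  -- The residuals tend to zero while the norms of `φ n` stay bounded. The limit passes to `negTrunc
  -- ∘ w` because `negTrunc` is 1-Lipschitz.
  have t2 : Tendsto (fun n => l2 Ω (fun x => negTrunc (φ n x)) ^ 2) atTop (𝓝 0) := by
    refine squeeze_zero (fun _ => sq_nonneg _) (fun n => ?_) t1
    refine (hest _ f (hφ n) hf hf0).trans ?_
    exact mul_le_mul_of_nonneg_left (mul_le_mul_of_nonneg_left (hφb n) l2_nonneg) hC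
  have t3 : Tendsto (fun n => l2 Ω (fun x => negTrunc (φ n x))) atTop (𝓝 0) := by
    have := (Real.continuous_sqrt.tendsto _).comp t2
    rw [Real.sqrt_zero] at this
    exact this.congr fun n => Real.sqrt_sq l2_nonneg
  have hle : ∀ n, l2 Ω (fun x => negTrunc (w x)) ≤
      l2 Ω (fun x => negTrunc (φ n x)) + l2 Ω (fun x => φ n x - w x) := fun n => by
    have e : (fun x => negTrunc (w x)) = fun x =>
        negTrunc (φ n x) - (negTrunc (φ n x) - negTrunc (w x)) := by ext x; ring
    rw [e]
    refine (l2_sub_le (mβφ n) ((mβφ n).sub mβw)).trans (add_le_add le_rfl ?_)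
    have h1 := l2_le_of_abs_le (c := 1) zero_le_one (md n)
      (f := fun x => negTrunc (φ n x) - negTrunc (w x))
      (ae_of_all _ fun x => by simpa using abs_negTrunc_sub_le (φ n x) (w x))
    rwa [one_mul] at h1
  have hz : l2 Ω (fun x => negTrunc (w x)) = 0 := by
    have t4 := t3.add hlim
    rw [add_zero] at t4
    exact le_antisymm (ge_of_tendsto' t4 hle) l2_nonneg
  filter_upwards [l2_eq_zero mβw hz] with x hx using nonneg_of_negTrunc_eq_zero hx

end Positivity
end Biharm

/-! ### Radial mollification kernels. -/

namespace Biharm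

/-- The profile of the mollification kernels. -/
noncomputable def prof (s : ℝ) : ℝ := expNegInvGlue (1 - s)

lemma contDiff_prof : ContDiff ℝ ∞ prof :=
  expNegInvGlue.contDiff.comp (contDiff_const.sub contDiff_id)

lemma prof_nonneg (s : ℝ) : 0 ≤ prof s := expNegInvGlue.nonneg _

lemma hasDerivAt_prof (s : ℝ) : HasDerivAt prof (-(((1 - s)⁻¹) ^ 2 * prof s)) s := by
  have h1 := expNegInvGlue.hasDerivAt_polynomial_eval_inv_mul 1 (1 - s)
  simp only [Polynomial.eval_one, one_mul, Polynomial.derivative_one, sub_zero, mul_one,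
    Polynomial.eval_pow, Polynomial.eval_X] at h1
  have h2 := h1.comp s ((hasDerivAt_id s).const_sub 1)
  simpa [prof, Function.comp_def] using! h2

lemma deriv_prof (s : ℝ) : deriv prof s = -(((1 - s)⁻¹) ^ 2 * prof s) := (hasDerivAt_prof s).deriv

lemma contDiff_deriv_prof : ContDiff ℝ ∞ (deriv prof) :=
  (contDiff_infty_iff_deriv.1 contDiff_prof).2

lemma prof_of_one_le {s : ℝ} (h : 1 ≤ s) : prof s = 0 :=
  expNegInvGlue.zero_of_nonpos (by linarith)

lemma deriv_prof_of_one_le {s : ℝ} (h : 1 ≤ s) : deriv prof s = 0 := by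
  rw [deriv_prof, prof_of_one_le h]; simp

lemma deriv_prof_neg {s : ℝ} (h : s < 1) : deriv prof s < 0 := by
  rw [deriv_prof, neg_lt_zero]
  have h1 : 0 < 1 - s := by linarith
  have h2 : 0 < prof s := expNegInvGlue.pos_of_pos h1
  positivity

lemma deriv_prof_nonpos (s : ℝ) : deriv prof s ≤ 0 := by
  rcases lt_or_ge s 1 with h | h
  · exact (deriv_prof_neg h).le
  · exact (deriv_prof_of_one_le h).le

/-- On `[0, 1)` one has `prof' = -(1-s)⁻² prof` with `0 < 1 - s ≤ 1`. This yields `kerPsi ≤ kerP /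
2`, which closes the differential inequality for the mollifications. -/
lemma prof_le_neg_deriv_prof {s : ℝ} (h0 : 0 ≤ s) : prof s ≤ -deriv prof s := by
  rcases lt_or_ge s 1 with h | h
  · rw [deriv_prof, neg_neg]
    have h1 : 0 < 1 - s := by linarith
    have h2 : 1 ≤ (1 - s)⁻¹ := (one_le_inv₀ h1).2 (by linarith)
    have h3 : 1 ≤ (1 - s)⁻¹ ^ 2 := one_le_pow₀ h2
    have := prof_nonneg s
    nlinarith
  · rw [prof_of_one_le h, deriv_prof_of_one_le h]; simp

lemma exists_neg_deriv_prof_le : ∃ B, 0 < B ∧ ∀ s, 0 ≤ s → -deriv prof s ≤ B := by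
  obtain ⟨B, hB⟩ := (isCompact_Icc (a := (0 : ℝ)) (b := 1)).exists_bound_of_continuousOn
    contDiff_deriv_prof.continuous.continuousOn
  refine ⟨max B 1, by positivity, fun s hs => ?_⟩
  rcases lt_or_ge s 1 with h | h
  · exact (neg_le_abs _).trans ((hB s ⟨hs, h.le⟩).trans (le_max_left _ _))
  · rw [deriv_prof_of_one_le h]; simp

/-- The mollification kernel, as a function of the scale and the squared distance. -/
noncomputable def kerP (N : ℕ) (ε r : ℝ) : ℝ := -2 * (ε ^ N)⁻¹ * deriv prof (r / ε ^ 2)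

/-- The kernel with `∂_ε kerP = ε Δ kerPsi`. -/
noncomputable def kerPsi (N : ℕ) (ε r : ℝ) : ℝ := (ε ^ N)⁻¹ * prof (r / ε ^ 2)

lemma kerP_nonneg {N : ℕ} {ε r : ℝ} (hε : 0 < ε) : 0 ≤ kerP N ε r := by
  have := deriv_prof_nonpos (r / ε ^ 2)
  have h2 : 0 < (ε ^ N)⁻¹ := by positivity
  unfold kerP
  nlinarith

lemma kerP_pos {N : ℕ} {ε r : ℝ} (hε : 0 < ε) (hr : r < ε ^ 2) : 0 < kerP N ε r := by
  have := deriv_prof_neg (s := r / ε ^ 2) ((div_lt_one (by positivity)).2 hr)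
  have h2 : 0 < (ε ^ N)⁻¹ := by positivity
  unfold kerP
  nlinarith

lemma kerP_eq_zero {N : ℕ} {ε r : ℝ} (hε : 0 < ε) (hr : ε ^ 2 ≤ r) : kerP N ε r = 0 := by
  rw [kerP, deriv_prof_of_one_le ((one_le_div (by positivity)).2 hr), mul_zero]

lemma kerPsi_nonneg {N : ℕ} {ε r : ℝ} (hε : 0 < ε) : 0 ≤ kerPsi N ε r :=
  mul_nonneg (by positivity) (prof_nonneg _)

lemma kerPsi_le {N : ℕ} {ε r : ℝ} (hε : 0 < ε) (hr : 0 ≤ r) : kerPsi N ε r ≤ kerP N ε r / 2 := by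
  have := prof_le_neg_deriv_prof (s := r / ε ^ 2) (by positivity)
  have h2 : 0 < (ε ^ N)⁻¹ := by positivity
  unfold kerPsi kerP
  nlinarith

lemma continuous_kerP (N : ℕ) (ε : ℝ) : Continuous (kerP N ε) :=
  continuous_const.mul (contDiff_deriv_prof.continuous.comp (continuous_id.div_const _))

lemma contDiff_kerPsi (N : ℕ) (ε : ℝ) : ContDiff ℝ ∞ (kerPsi N ε) :=
  contDiff_const.mul (contDiff_prof.comp (contDiff_id.div_const _))

/-- The derivative of `kerP` with respect to the scale. -/
noncomputable def kerPDeriv (N : ℕ) (ε r : ℝ) : ℝ :=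
  2 * N * (ε ^ (N + 1))⁻¹ * deriv prof (r / ε ^ 2) +
    4 * (ε ^ (N + 3))⁻¹ * r * deriv (deriv prof) (r / ε ^ 2)

lemma hasDerivAt_kerP (N : ℕ) {ε : ℝ} (hε : 0 < ε) (r : ℝ) :
    HasDerivAt (fun ε => kerP N ε r) (kerPDeriv N ε r) ε := by
  have h1 : HasDerivAt (fun ε : ℝ => (ε ^ N)⁻¹) (-(N * ε ^ (N - 1)) / (ε ^ N) ^ 2) ε :=
    (hasDerivAt_pow N ε).inv (by positivity)
  have h2 : HasDerivAt (fun ε : ℝ => r / ε ^ 2) (r * (-(2 * ε) / (ε ^ 2) ^ 2)) ε := by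
    have := ((hasDerivAt_pow 2 ε).inv (by positivity)).const_mul r
    simpa [div_eq_mul_inv] using! this
  have h3 : HasDerivAt (deriv prof) (deriv (deriv prof) (r / ε ^ 2)) (r / ε ^ 2) :=
    ((contDiff_deriv_prof.differentiable (by simp)) _).hasDerivAt
  have h4 := (h1.const_mul (-2)).mul (h3.comp ε h2)
  refine h4.congr_deriv ?_
  simp only [Function.comp, kerPDeriv]
  -- The derivative of `ε^N` contains `ε^(N-1)` with truncated subtraction, so `N = 0` is treated
  -- apart.
  rcases N with _ | n
  · simp; field_simp; ring
  · simp only [Nat.add_sub_cancel]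
    field_simp
    ring

lemma continuousOn_kerPDeriv (N : ℕ) :
    ContinuousOn (fun p : ℝ × ℝ => kerPDeriv N p.1 p.2) {p | 0 < p.1} := by
  have hd : ContinuousOn (fun p : ℝ × ℝ => p.2 / p.1 ^ 2) {p | 0 < p.1} :=
    continuousOn_snd.div (continuousOn_fst.pow 2) fun p (hp : 0 < p.1) => (pow_pos hp 2).ne'
  have hi : ∀ k : ℕ, ContinuousOn (fun p : ℝ × ℝ => (p.1 ^ k)⁻¹) {p | 0 < p.1} := fun k =>
    (continuousOn_fst.pow k).inv₀ fun p (hp : 0 < p.1) => (pow_pos hp k).ne'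
  have h1 := contDiff_deriv_prof.continuous.comp_continuousOn hd
  have h2 := (contDiff_deriv_prof.continuous_deriv (by simp)).comp_continuousOn hd
  exact ((continuousOn_const.mul (hi _)).mul h1).add
    (((continuousOn_const.mul (hi _)).mul continuousOn_snd).mul h2)

section Radial
variable {N : ℕ}

lemma contDiff_normSq_sub (x : E N) : ContDiff ℝ ∞ fun y : E N => ‖y - x‖ ^ 2 :=
  (contDiff_id.sub contDiff_const).norm_sq ℝ

lemma partialDeriv_normSq_sub (x : E N) (i : Fin N) :
    partialDeriv i (fun y : E N => ‖y - x‖ ^ 2) = fun y => 2 * (y i - x i) := by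
  ext y
  have h1 : HasFDerivAt (fun y : E N => ‖y - x‖ ^ 2) _ y :=
    ((hasFDerivAt_id y).sub_const x).norm_sq
  rw [partialDeriv, h1.fderiv]
  simp [EuclideanSpace.inner_single_right]

lemma lap_radial {γ : ℝ → ℝ} (hγ : ContDiff ℝ ∞ γ) (x y : E N) :
    lap (fun y => γ (‖y - x‖ ^ 2)) y =
      4 * ‖y - x‖ ^ 2 * deriv (deriv γ) (‖y - x‖ ^ 2) + 2 * N * deriv γ (‖y - x‖ ^ 2) := by
  have hγ' : ContDiff ℝ ∞ (deriv γ) := (contDiff_infty_iff_deriv.1 hγ).2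
  have hlin : ∀ i : Fin N, ContDiff ℝ ∞ fun y : E N => 2 * (y i - x i) := fun i =>
    contDiff_const.mul ((contDiff_coord i).sub contDiff_const)
  have h1 : ∀ i, partialDeriv i (partialDeriv i (fun y => γ (‖y - x‖ ^ 2))) y =
      deriv (deriv γ) (‖y - x‖ ^ 2) * (4 * (y i - x i) ^ 2) + 2 * deriv γ (‖y - x‖ ^ 2) := by
    intro i
    rw [partialDeriv_comp_real hγ (contDiff_normSq_sub x), partialDeriv_normSq_sub,
      partialDeriv_mul (f := fun y : E N => deriv γ (‖y - x‖ ^ 2))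
        (hγ'.comp (contDiff_normSq_sub x)) (hlin i),
      partialDeriv_comp_real hγ' (contDiff_normSq_sub x), partialDeriv_normSq_sub]
    have h2 : partialDeriv i (fun y : E N => 2 * (y i - x i)) y = 2 := by
      rw [partialDeriv_const_mul 2 ((contDiff_coord i).sub contDiff_const),
        partialDeriv_sub (contDiff_coord i) contDiff_const]
      simp only [partialDeriv_coord]
      simp [partialDeriv]
    simp only [h2]
    ring
  have h3 : ‖y - x‖ ^ 2 = ∑ i, (y i - x i) ^ 2 := by
    rw [EuclideanSpace.norm_sq_eq]; simp
  simp only [lap, h1, Finset.sum_add_distrib, ← Finset.mul_sum]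
  rw [← h3]
  simp
  ring

/-- Together with `hasDerivAt_kerP` this turns differentiation in the scale into a Laplacian in
space, which can be moved onto the mollified function. -/
lemma lap_kerPsi {ε : ℝ} (hε : 0 < ε) (x y : E N) :
    ε * lap (fun y => kerPsi N ε (‖y - x‖ ^ 2)) y = kerPDeriv N ε (‖y - x‖ ^ 2) := by
  have hdiv : ∀ r : ℝ, HasDerivAt (fun r : ℝ => r / ε ^ 2) (1 / ε ^ 2) r := fun r => by
    simpa using (hasDerivAt_id r).div_const (ε ^ 2)
  have h1 : deriv (kerPsi N ε) = fun r => (ε ^ N)⁻¹ * (deriv prof (r / ε ^ 2) * (1 / ε ^ 2)) := by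
    ext r
    exact ((((contDiff_prof.differentiable (by simp)) _).hasDerivAt.comp r (hdiv r)).const_mul
      _).deriv
  have h2 : deriv (deriv (kerPsi N ε)) = fun r =>
      (ε ^ N)⁻¹ * ((deriv (deriv prof) (r / ε ^ 2) * (1 / ε ^ 2)) * (1 / ε ^ 2)) := by
    rw [h1]
    ext r
    exact (((((contDiff_deriv_prof.differentiable (by simp)) _).hasDerivAt.comp r
      (hdiv r)).mul_const _).const_mul _).deriv
  rw [lap_radial (contDiff_kerPsi N ε), h2, h1, kerPDeriv]
  field_simp
  ring

lemma isTestFunction_kerPsi {Ω : Set (E N)} {ε : ℝ} (hε : 0 < ε) {x : E N}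
    (h : Metric.closedBall x ε ⊆ Ω) : IsTestFunction Ω fun y => kerPsi N ε (‖y - x‖ ^ 2) := by
  have hsub : tsupport (fun y => kerPsi N ε (‖y - x‖ ^ 2)) ⊆ Metric.closedBall x ε := by
    refine closure_minimal (fun y hy => ?_) Metric.isClosed_closedBall
    by_contra hn
    rw [mem_closedBall_iff_norm, not_le] at hn
    refine hy ?_
    have : 1 ≤ ‖y - x‖ ^ 2 / ε ^ 2 := (one_le_div (by positivity)).2 (by gcongr)
    simp [kerPsi, prof_of_one_le this]
  exact ⟨(contDiff_kerPsi N ε).comp (contDiff_normSq_sub x),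
    (isCompact_closedBall x ε).of_isClosed_subset (isClosed_tsupport _) hsub, hsub.trans h⟩

/-- The total mass of the kernels `kerP`. -/
noncomputable def kerMass (N : ℕ) : ℝ := ∫ y : E N, kerP N 1 (‖y‖ ^ 2)

/-- The factor `ε⁻ᴺ` compensates the dilation, so the mass does not depend on the scale. -/
lemma integral_kerP {ε : ℝ} (hε : 0 < ε) (x : E N) :
    ∫ y : E N, kerP N ε (‖y - x‖ ^ 2) = kerMass N := by
  rw [integral_sub_right_eq_self (fun y : E N => kerP N ε (‖y‖ ^ 2)) x]
  have h := Measure.integral_comp_inv_smul (volume : Measure (E N))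
    (fun y : E N => kerP N 1 (‖y‖ ^ 2)) ε
  have h1 : ∀ y : E N, kerP N ε (‖y‖ ^ 2) = (ε ^ N)⁻¹ * kerP N 1 (‖ε⁻¹ • y‖ ^ 2) := fun y => by
    simp only [kerP, norm_smul, norm_inv, Real.norm_of_nonneg hε.le, mul_pow, inv_pow, one_pow,
      inv_one, div_one]
    rw [div_eq_inv_mul]; ring
  simp only [h1]
  rw [integral_const_mul, h, kerMass]
  have : |ε ^ N| = ε ^ N := abs_of_pos (by positivity)
  simp [this]
  rw [inv_mul_cancel_left₀ (by positivity)]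

lemma integrable_kerP {ε : ℝ} (hε : 0 < ε) (x : E N) :
    Integrable fun y : E N => kerP N ε (‖y - x‖ ^ 2) := by
  refine ((continuous_kerP N ε).comp
    (contDiff_normSq_sub x).continuous).integrable_of_hasCompactSupport ?_
  refine HasCompactSupport.of_support_subset_isCompact (isCompact_closedBall x ε) fun y hy => ?_
  by_contra hn
  rw [mem_closedBall_iff_norm, not_le] at hn
  exact hy (kerP_eq_zero hε (pow_le_pow_left₀ hε.le hn.le 2))

lemma kerMass_pos : 0 < kerMass N := by
  have hc : Continuous fun y : E N => kerP N 1 (‖y‖ ^ 2) :=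
    (continuous_kerP N 1).comp (continuous_norm.pow 2)
  refine hc.integral_pos_of_hasCompactSupport_nonneg_nonzero (x := 0) ?_
    (fun y => kerP_nonneg one_pos) ?_
  · refine HasCompactSupport.of_support_subset_isCompact (isCompact_closedBall 0 1) fun y hy => ?_
    by_contra hn
    rw [mem_closedBall_iff_norm, not_le, sub_zero] at hn
    exact hy (kerP_eq_zero one_pos (pow_le_pow_left₀ zero_le_one hn.le 2))
  · exact (kerP_pos one_pos (by simp)).ne'

lemma exists_kerP_le (N : ℕ) : ∃ B, 0 < B ∧ ∀ ε r, 0 < ε → 0 ≤ r → kerP N ε r ≤ B * (ε ^ N)⁻¹ := by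
  obtain ⟨B, hB, h⟩ := exists_neg_deriv_prof_le
  refine ⟨2 * B, by positivity, fun ε r hε hr => ?_⟩
  have h1 := h (r / ε ^ 2) (by positivity)
  have h2 : 0 < (ε ^ N)⁻¹ := by positivity
  unfold kerP
  nlinarith

end Radial
end Biharm

/-! ### Mollifications of distributional solutions and local boundedness. -/

namespace Biharm

/-- The mollification of `z` at scale `ε`, up to the factor `kerMass N`. -/
noncomputable def moll {N : ℕ} (Ω : Set (E N)) (z : E N → ℝ) (x : E N) (ε : ℝ) : ℝ :=
  ∫ y in Ω, z y * kerP N ε (‖y - x‖ ^ 2)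

/-- `-Δz = f` in the sense of distributions in `Ω`. -/
def SolvesPoisson {N : ℕ} (Ω : Set (E N)) (z f : E N → ℝ) : Prop :=
  ∀ η, IsTestFunction Ω η → ∫ y in Ω, z y * lap η y = - ∫ y in Ω, f y * η y

variable {N : ℕ} {Ω : Set (E N)} {z f : E N → ℝ} {x : E N} {ε r : ℝ}

lemma integrableOn_of_memL2 (hb : Bornology.IsBounded Ω) (hz : MemL2 Ω z) : IntegrableOn z Ω := by
  have : IsFiniteMeasure (volume.restrict Ω) := ⟨by
    rw [Measure.restrict_apply_univ]; exact hb.measure_lt_top⟩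
  exact hz.integrable one_le_two

lemma continuous_kerP_normSq (ε : ℝ) (x : E N) : Continuous fun y => kerP N ε (‖y - x‖ ^ 2) :=
  (continuous_kerP N ε).comp (contDiff_normSq_sub x).continuous

lemma continuous_kerPsi_normSq (ε : ℝ) (x : E N) : Continuous fun y => kerPsi N ε (‖y - x‖ ^ 2) :=
  (contDiff_kerPsi N ε).continuous.comp (contDiff_normSq_sub x).continuous

lemma integrable_mul_kerP (hz : IntegrableOn z Ω) (hε : 0 < ε) (x : E N) :
    IntegrableOn (fun y => z y * kerP N ε (‖y - x‖ ^ 2)) Ω := by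
  obtain ⟨B, -, hB⟩ := exists_kerP_le N
  refine Integrable.mul_bdd (c := B * (ε ^ N)⁻¹) hz
    (continuous_kerP_normSq ε x).aestronglyMeasurable (ae_of_all _ fun y => ?_)
  rw [Real.norm_of_nonneg (kerP_nonneg hε)]
  exact hB _ _ hε (by positivity)

lemma integrable_mul_kerPsi (hz : IntegrableOn z Ω) (hε : 0 < ε) (x : E N) :
    IntegrableOn (fun y => z y * kerPsi N ε (‖y - x‖ ^ 2)) Ω := by
  obtain ⟨B, -, hB⟩ := exists_kerP_le N
  refine Integrable.mul_bdd (c := B * (ε ^ N)⁻¹ / 2) hz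
    (continuous_kerPsi_normSq ε x).aestronglyMeasurable (ae_of_all _ fun y => ?_)
  rw [Real.norm_of_nonneg (kerPsi_nonneg hε)]
  refine (kerPsi_le hε (by positivity)).trans ?_
  gcongr
  exact hB _ _ hε (by positivity)

/-- The scale derivative of the kernel is `ε Δ kerPsi`, and `kerPsi` is an admissible test function
as long as the closed ball stays in `Ω`. -/
lemma SolvesPoisson.hasDerivAt_moll (h : SolvesPoisson Ω z f) (hb : Bornology.IsBounded Ω)
    (hz : IntegrableOn z Ω) (hε : 0 < ε) (hx : Metric.closedBall x ε ⊆ Ω) :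
    HasDerivAt (moll Ω z x) (-(ε * ∫ y in Ω, f y * kerPsi N ε (‖y - x‖ ^ 2))) ε := by
  obtain ⟨R, hR⟩ := hb.subset_closedBall x
  -- This contains all pairs (scale near `ε`, squared distance from `x` to a point of `Ω`), giving a
  -- uniform bound for dominated differentiation.
  have hcpt : IsCompact (Set.Icc (ε / 2) (2 * ε) ×ˢ Set.Icc 0 (R ^ 2)) :=
    isCompact_Icc.prod isCompact_Icc
  obtain ⟨M, hM⟩ := hcpt.exists_bound_of_continuousOn ((continuousOn_kerPDeriv N).mono
    fun p hp => lt_of_lt_of_le (by positivity) hp.1.1)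
  have hlap : ∀ y, ε * lap (fun y => kerPsi N ε (‖y - x‖ ^ 2)) y = kerPDeriv N ε (‖y - x‖ ^ 2) :=
    lap_kerPsi hε x
  have hM' : ∀ y ∈ Metric.closedBall x R, ∀ s ∈ Set.Icc (ε / 2) (2 * ε), ‖kerPDeriv N s (‖y - x‖ ^ 2)‖ ≤ M := by
    intro y hy s hs
    refine hM (s, ‖y - x‖ ^ 2) ⟨hs, by positivity, ?_⟩
    exact pow_le_pow_left₀ (norm_nonneg _) (mem_closedBall_iff_norm.1 hy) 2
  have key := (hasDerivAt_integral_of_dominated_loc_of_deriv_le (μ := volume.restrict Ω)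
    (F := fun s y => z y * kerP N s (‖y - x‖ ^ 2))
    (F' := fun s y => z y * kerPDeriv N s (‖y - x‖ ^ 2)) (bound := fun y => ‖z y‖ * M)
    (s := Set.Icc (ε / 2) (2 * ε)) (Icc_mem_nhds (by linarith) (by linarith))
    (Eventually.of_forall fun s => hz.aestronglyMeasurable.mul
      (continuous_kerP_normSq s x).aestronglyMeasurable)
    (integrable_mul_kerP hz hε x)
    (by
      simp only [← hlap]
      exact hz.aestronglyMeasurable.mul (continuous_const.mul
        (contDiff_lap ((contDiff_kerPsi N ε).comp
          (contDiff_normSq_sub x))).continuous).aestronglyMeasurable)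
    ?_ (hz.norm.mul_const M) ?_).2
  · refine key.congr_deriv ?_
    simp only [← hlap]
    rw [← mul_neg, ← h _ (isTestFunction_kerPsi hε hx), ← integral_const_mul]
    congr 1; ext y; ring
  · filter_upwards [ae_restrict_of_ae_restrict_of_subset hR
      (ae_restrict_mem Metric.isClosed_closedBall.measurableSet)] with y hy s hs
    rw [norm_mul]
    exact mul_le_mul_of_nonneg_left (hM' y hy s hs) (norm_nonneg _)
  · refine ae_of_all _ fun y s hs => ?_
    exact (hasDerivAt_kerP N (lt_of_lt_of_le (by positivity) hs.1) _).const_mul _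

lemma continuous_moll (hz : IntegrableOn z Ω) (hε : 0 < ε) : Continuous fun x => moll Ω z x ε := by
  obtain ⟨B, -, hB⟩ := exists_kerP_le N
  refine continuous_of_dominated (bound := fun y => ‖z y‖ * (B * (ε ^ N)⁻¹)) (fun x =>
    (integrable_mul_kerP hz hε x).aestronglyMeasurable) (fun x => ae_of_all _ fun y => ?_)
    (hz.norm.mul_const _) (ae_of_all _ fun y => ?_)
  · rw [norm_mul, Real.norm_of_nonneg (kerP_nonneg hε)]
    gcongr
    exact hB _ _ hε (by positivity)
  · exact continuous_const.mul ((continuous_kerP N ε).comp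
      ((continuous_const.sub continuous_id).norm.pow 2))

/-- The normalised kernels have mass one, live in the ball of radius `ε` and are bounded by a
multiple of its inverse volume, so they converge at Lebesgue points. -/
lemma ae_tendsto_moll (hΩ : IsOpen Ω) (hz : IntegrableOn z Ω) :
    ∀ᵐ x ∂(volume.restrict Ω),
      Tendsto (fun ε => moll Ω z x ε / kerMass N) (𝓝[>] 0) (𝓝 (z x)) := by
  have hi : Integrable (Ω.indicator z) := (integrable_indicator_iff hΩ.measurableSet).2 hz
  obtain ⟨B, hB0, hB⟩ := exists_kerP_le N
  rw [ae_restrict_iff' hΩ.measurableSet]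
  filter_upwards [(Besicovitch.vitaliFamily (volume : Measure (E N))).ae_tendsto_average_norm_sub
    hi.locallyIntegrable] with x hx hxΩ
  have h0 := hx.comp (Besicovitch.tendsto_filterAt volume x)
  have hm := kerMass_pos (N := N)
  have key := tendsto_integral_smul_of_tendsto_average_norm_sub
    (g := fun ε y => kerP N ε (‖y - x‖ ^ 2) / kerMass N)
    (B / kerMass N * volume.real (Metric.closedBall (0 : E N) 1)) h0
    (Eventually.of_forall fun ε => hi.integrableOn) ?_ ?_ ?_
  · rw [Set.indicator_of_mem hxΩ] at key
    refine key.congr fun ε => ?_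
    rw [moll, ← integral_indicator hΩ.measurableSet, ← integral_div]
    congr 1; ext y
    by_cases hy : y ∈ Ω
    · simp [hy]; ring
    · simp [hy]
  · refine tendsto_const_nhds.congr' ?_
    filter_upwards [self_mem_nhdsWithin] with ε (hε : 0 < ε)
    rw [integral_div, integral_kerP hε, div_self hm.ne']
  · filter_upwards [self_mem_nhdsWithin] with ε (hε : 0 < ε) y hy
    by_contra hn
    rw [mem_closedBall_iff_norm, not_le] at hn
    exact hy (by simp [kerP_eq_zero hε (pow_le_pow_left₀ hε.le hn.le 2)])
  · filter_upwards [self_mem_nhdsWithin] with ε (hε : 0 < ε) y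
    have hV : 0 < volume.real (Metric.closedBall (0 : E N) 1) :=
      ENNReal.toReal_pos (Metric.measure_closedBall_pos _ _ one_pos).ne'
        measure_closedBall_lt_top.ne
    rw [abs_of_nonneg (div_nonneg (kerP_nonneg hε) hm.le),
      Measure.addHaar_real_closedBall' _ _ hε.le, finrank_euclideanSpace_fin, mul_div_mul_right _ _ hV.ne', div_div, mul_comm (kerMass N),
      ← div_div]
    gcongr
    rw [div_eq_mul_inv]
    exact hB _ _ hε (by positivity)

lemma SolvesPoisson.continuousOn_moll (h : SolvesPoisson Ω z f) (hb : Bornology.IsBounded Ω)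
    (hz : IntegrableOn z Ω) (hx : Metric.closedBall x r ⊆ Ω) :
    ContinuousOn (moll Ω z x) (Set.Ioc 0 r) := fun _ hs =>
  (h.hasDerivAt_moll hb hz hs.1
    ((Metric.closedBall_subset_closedBall hs.2).trans hx)).continuousAt.continuousWithinAt

lemma SolvesPoisson.antitoneOn_moll (h : SolvesPoisson Ω z f) (hb : Bornology.IsBounded Ω)
    (hz : IntegrableOn z Ω) (hf0 : ∀ᵐ x ∂(volume.restrict Ω), 0 ≤ f x)
    (hx : Metric.closedBall x r ⊆ Ω) : AntitoneOn (moll Ω z x) (Set.Ioc 0 r) := by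
  have hd : ∀ s ∈ Set.Ioo 0 r, HasDerivAt (moll Ω z x) _ s := fun _ hs =>
    h.hasDerivAt_moll hb hz hs.1 ((Metric.closedBall_subset_closedBall hs.2.le).trans hx)
  refine antitoneOn_of_deriv_nonpos (convex_Ioc 0 r) (h.continuousOn_moll hb hz hx) ?_ ?_
  · rw [interior_Ioc]
    exact fun s hs => (hd s hs).differentiableAt.differentiableWithinAt
  · rw [interior_Ioc]
    intro s hs
    rw [(hd s hs).deriv, neg_nonpos]
    refine mul_nonneg hs.1.le (integral_nonneg_of_ae ?_)
    filter_upwards [hf0] with y hy using mul_nonneg hy (kerPsi_nonneg hs.1)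

/-- The derivative of the mollification is `-ε ∫ f kerPsi`, at least `-(Cε/2)` times the
mollification because `f ≤ C z` and `kerPsi ≤ kerP / 2`. The exponential is the corresponding
integrating factor. -/
lemma SolvesPoisson.monotoneOn_exp_mul_moll (h : SolvesPoisson Ω z f)
    (hb : Bornology.IsBounded Ω) (hz : IntegrableOn z Ω) (hf : IntegrableOn f Ω)
    (hz0 : ∀ᵐ x ∂(volume.restrict Ω), 0 ≤ z x) {C : ℝ} (hC : 0 ≤ C)
    (hfz : ∀ᵐ x ∂(volume.restrict Ω), f x ≤ C * z x) (hx : Metric.closedBall x r ⊆ Ω) :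
    MonotoneOn (fun ε => Real.exp (C * ε ^ 2 / 4) * moll Ω z x ε) (Set.Ioc 0 r) := by
  have hd : ∀ s ∈ Set.Ioo 0 r,
      HasDerivAt (fun ε => Real.exp (C * ε ^ 2 / 4) * moll Ω z x ε)
      (Real.exp (C * s ^ 2 / 4) * (C * (2 * s) / 4) * moll Ω z x s + Real.exp (C * s ^ 2 / 4) *
        -(s * ∫ y in Ω, f y * kerPsi N s (‖y - x‖ ^ 2))) s := fun s hs => by
    have h1 := h.hasDerivAt_moll hb hz hs.1
      ((Metric.closedBall_subset_closedBall hs.2.le).trans hx)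
    have h2 : HasDerivAt (fun ε : ℝ => C * ε ^ 2 / 4) (C * (2 * s) / 4) s := by
      simpa using ((hasDerivAt_pow 2 s).const_mul C).div_const 4
    exact h2.exp.mul h1
  refine monotoneOn_of_deriv_nonneg (convex_Ioc 0 r) ?_ ?_ ?_
  · exact (by fun_prop : Continuous fun ε : ℝ => Real.exp (C * ε ^ 2 / 4)).continuousOn.mul
      (h.continuousOn_moll hb hz hx)
  · rw [interior_Ioc]
    exact fun s hs => (hd s hs).differentiableAt.differentiableWithinAt
  · rw [interior_Ioc]
    intro s hs
    have hs0 : 0 < s := hs.1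
    rw [(hd s hs).deriv]
    have h3 : ∫ y in Ω, f y * kerPsi N s (‖y - x‖ ^ 2) ≤ C / 2 * moll Ω z x s := by
      rw [moll, ← integral_const_mul]
      refine integral_mono_ae (integrable_mul_kerPsi hf hs0 x)
        ((integrable_mul_kerP hz hs0 x).const_mul _) ?_
      filter_upwards [hz0, hfz] with y h0 h1
      calc f y * kerPsi N s (‖y - x‖ ^ 2) ≤ C * z y * kerPsi N s (‖y - x‖ ^ 2) :=
            mul_le_mul_of_nonneg_right h1 (kerPsi_nonneg hs0)
        _ ≤ C * z y * (kerP N s (‖y - x‖ ^ 2) / 2) :=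
            mul_le_mul_of_nonneg_left (kerPsi_le hs0 (by positivity)) (by positivity)
        _ = _ := by ring
    have : 0 ≤ Real.exp (C * s ^ 2 / 4) * s * (C / 2 * moll Ω z x s -
        ∫ y in Ω, f y * kerPsi N s (‖y - x‖ ^ 2)) :=
      mul_nonneg (by positivity) (by linarith)
    linarith

/-- Nonnegative solutions of `-Δz ≤ C z` are locally bounded. -/
lemma SolvesPoisson.exists_ae_le (h : SolvesPoisson Ω z f) (hΩ : IsOpen Ω)
    (hb : Bornology.IsBounded Ω) (hz : IntegrableOn z Ω) (hf : IntegrableOn f Ω)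
    (hz0 : ∀ᵐ x ∂(volume.restrict Ω), 0 ≤ z x) {C : ℝ} (hC : 0 ≤ C)
    (hfz : ∀ᵐ x ∂(volume.restrict Ω), f x ≤ C * z x) {x₀ : E N} (hr : 0 < r)
    (hx₀ : Metric.ball x₀ (2 * r) ⊆ Ω) :
    ∃ M, ∀ᵐ x ∂(volume.restrict (Metric.ball x₀ r)), z x ≤ M := by
  obtain ⟨B, hB0, hB⟩ := exists_kerP_le N
  have hm := kerMass_pos (N := N)
  refine ⟨Real.exp (C * r ^ 2 / 4) * ((∫ y in Ω, z y) * (B * (r ^ N)⁻¹)) / kerMass N, ?_⟩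
  have hsub : Metric.ball x₀ r ⊆ Ω := (Metric.ball_subset_ball (by linarith)).trans hx₀
  filter_upwards [ae_restrict_of_ae_restrict_of_subset hsub (ae_tendsto_moll hΩ hz),
    ae_restrict_mem measurableSet_ball] with x hx hxb
  have hxr : Metric.closedBall x r ⊆ Ω := fun y hy => hx₀ <| by
    rw [Metric.mem_closedBall] at hy
    rw [Metric.mem_ball] at hxb ⊢
    linarith [dist_triangle y x x₀]
  refine le_of_tendsto hx ?_
  filter_upwards [Ioc_mem_nhdsGT hr] with ε hε
  have hmono := h.monotoneOn_exp_mul_moll hb hz hf hz0 hC hfz hxr hε ⟨hr, le_rfl⟩ hε.2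
  -- At the fixed scale `r` the kernel is bounded, so the mollification is controlled by the
  -- integral of `z` uniformly in the centre.
  have h1 : moll Ω z x r ≤ (∫ y in Ω, z y) * (B * (r ^ N)⁻¹) := by
    rw [moll, ← integral_mul_const]
    refine integral_mono_ae (integrable_mul_kerP hz hr x) (hz.mul_const _) ?_
    filter_upwards [hz0] with y hy
    exact mul_le_mul_of_nonneg_left (hB _ _ hr (by positivity)) hy
  have h2 : 0 ≤ moll Ω z x ε := integral_nonneg_of_ae <| by
    filter_upwards [hz0] with y hy using mul_nonneg hy (kerP_nonneg hε.1)
  have h3 : 1 ≤ Real.exp (C * ε ^ 2 / 4) := Real.one_le_exp (by positivity)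
  have h4 := mul_le_mul_of_nonneg_left h1 (Real.exp_pos (C * r ^ 2 / 4)).le
  simp only at hmono
  gcongr
  nlinarith

end Biharm

/-! ### The continuous representative and the strong maximum principle. -/

namespace Biharm

variable {N : ℕ} {Ω : Set (E N)} {z f : E N → ℝ} {x : E N} {ε r : ℝ}

lemma kerPsi_eq_zero_of_notMem {y : E N} (hε : 0 < ε) (hy : y ∉ Metric.ball x ε) :
    kerPsi N ε (‖y - x‖ ^ 2) = 0 := by
  rw [mem_ball_iff_norm, not_lt] at hy
  refine le_antisymm ((kerPsi_le hε (by positivity)).trans_eq ?_) (kerPsi_nonneg hε)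
  rw [kerP_eq_zero hε (pow_le_pow_left₀ hε.le hy 2), zero_div]

lemma SolvesPoisson.abs_moll_sub_le (h : SolvesPoisson Ω z f) (hb : Bornology.IsBounded Ω)
    (hz : IntegrableOn z Ω) (hx : Metric.closedBall x r ⊆ Ω) {F : ℝ}
    (hF0 : 0 ≤ F) (hF : ∀ᵐ y ∂(volume.restrict Ω), y ∈ Metric.ball x r → |f y| ≤ F) {s t : ℝ}
    (hs : s ∈ Set.Ioc 0 r) (ht : t ∈ Set.Ioc 0 r) :
    |moll Ω z x t - moll Ω z x s| ≤ r * (F * (kerMass N / 2)) * |t - s| := by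
  refine Convex.norm_image_sub_le_of_norm_hasDerivWithin_le (s := Set.Ioc 0 r)
    (fun s hs => (h.hasDerivAt_moll hb hz hs.1
      ((Metric.closedBall_subset_closedBall hs.2).trans hx)).hasDerivWithinAt)
    (fun s hs => ?_) (convex_Ioc 0 r) hs ht
  have hs0 : 0 < s := hs.1
  have hP := (integrable_kerP hs0 x).const_mul (F / 2)
  rw [norm_neg, norm_mul, Real.norm_of_nonneg hs0.le]
  refine mul_le_mul hs.2 ?_ (norm_nonneg _) (hs0.le.trans hs.2)
  calc ‖∫ y in Ω, f y * kerPsi N s (‖y - x‖ ^ 2)‖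
      ≤ ∫ y in Ω, F / 2 * kerP N s (‖y - x‖ ^ 2) := by
        refine norm_integral_le_of_norm_le hP.integrableOn ?_
        filter_upwards [hF] with y hy
        rw [norm_mul, Real.norm_of_nonneg (kerPsi_nonneg hs0)]
        by_cases hyb : y ∈ Metric.ball x s
        · have h1 := hy (Metric.ball_subset_ball hs.2 hyb)
          calc |f y| * kerPsi N s (‖y - x‖ ^ 2) ≤ F * (kerP N s (‖y - x‖ ^ 2) / 2) :=
                mul_le_mul h1 (kerPsi_le hs0 (by positivity)) (kerPsi_nonneg hs0) hF0
            _ = _ := by ring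
        · rw [kerPsi_eq_zero_of_notMem hs0 hyb, mul_zero]
          exact mul_nonneg (by positivity) (kerP_nonneg hs0)
    _ ≤ ∫ y, F / 2 * kerP N s (‖y - x‖ ^ 2) :=
        setIntegral_le_integral hP
          (ae_of_all _ fun y => mul_nonneg (by positivity) (kerP_nonneg hs0))
    _ = F * (kerMass N / 2) := by rw [integral_const_mul, integral_kerP hs0]; ring

/-- The limit of the mollifications. -/
noncomputable def preciseRep {N : ℕ} (Ω : Set (E N)) (z : E N → ℝ) (x : E N) : ℝ :=
  limUnder (𝓝[>] 0) fun ε => moll Ω z x ε / kerMass N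

/-- `f` is essentially bounded near each point of `Ω`. -/
def LocallyEssBounded {N : ℕ} (Ω : Set (E N)) (f : E N → ℝ) : Prop :=
  ∀ x ∈ Ω, ∃ r F : ℝ, 0 < r ∧ 0 ≤ F ∧ Metric.ball x (2 * r) ⊆ Ω ∧
    ∀ᵐ y ∂(volume.restrict Ω), y ∈ Metric.ball x (2 * r) → |f y| ≤ F

/-- Centres in the ball of radius `r` with scales up to `r` only see the ball of radius `2r`, so the
Lipschitz constant in the scale is the same for all of them. -/
lemma SolvesPoisson.abs_moll_sub_le_of_mem_ball (h : SolvesPoisson Ω z f)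
    (hb : Bornology.IsBounded Ω) (hz : IntegrableOn z Ω) {x₀ : E N}
    {F : ℝ} (hx₀ : Metric.ball x₀ (2 * r) ⊆ Ω) (hF0 : 0 ≤ F)
    (hF : ∀ᵐ y ∂(volume.restrict Ω), y ∈ Metric.ball x₀ (2 * r) → |f y| ≤ F)
    (hx : x ∈ Metric.ball x₀ r) {s t : ℝ} (hs : s ∈ Set.Ioc 0 r) (ht : t ∈ Set.Ioc 0 r) :
    |moll Ω z x t / kerMass N - moll Ω z x s / kerMass N| ≤ r * F / 2 * |t - s| := by
  have hm := kerMass_pos (N := N)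
  have hsub : Metric.closedBall x r ⊆ Metric.ball x₀ (2 * r) := fun y hy => by
    rw [Metric.mem_closedBall] at hy
    rw [Metric.mem_ball] at hx ⊢
    linarith [dist_triangle y x x₀]
  have := h.abs_moll_sub_le hb hz (hsub.trans hx₀) hF0 (by
    filter_upwards [hF] with y hy hyb using hy (hsub (Metric.ball_subset_closedBall hyb))) hs ht
  rw [← sub_div, abs_div, abs_of_pos hm, div_le_iff₀ hm]
  linarith

lemma SolvesPoisson.tendsto_preciseRep (h : SolvesPoisson Ω z f) (hb : Bornology.IsBounded Ω)
    (hz : IntegrableOn z Ω) (hfb : LocallyEssBounded Ω f) (hx : x ∈ Ω) :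
    Tendsto (fun ε => moll Ω z x ε / kerMass N) (𝓝[>] 0) (𝓝 (preciseRep Ω z x)) := by
  obtain ⟨r, F, hr, hF0, hsub, hF⟩ := hfb x hx
  refine tendsto_nhds_limUnder (CompleteSpace.complete (Metric.cauchy_iff.2
    ⟨inferInstance, fun e he => ?_⟩))
  -- The added `1` keeps the divisor positive when `F = 0`.
  have hK : 0 < r * F / 2 + 1 := by positivity
  refine ⟨_, image_mem_map (Ioo_mem_nhdsGT (lt_min hr (div_pos he hK))), ?_⟩
  rintro _ ⟨t, ht, rfl⟩ _ ⟨s, hs, rfl⟩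
  have ht2 := ht.2.trans_le (min_le_right _ _)
  have hs2 := hs.2.trans_le (min_le_right _ _)
  have h1 := h.abs_moll_sub_le_of_mem_ball hb hz hsub hF0 hF (Metric.mem_ball_self hr)
    ⟨hs.1, hs.2.le.trans (min_le_left _ _)⟩ ⟨ht.1, ht.2.le.trans (min_le_left _ _)⟩
  rw [Real.dist_eq]
  have h2 : |t - s| < e / (r * F / 2 + 1) := by
    rw [abs_lt]; constructor <;> linarith [hs.1, ht.1]
  rw [lt_div_iff₀ hK] at h2
  have h3 := abs_nonneg (t - s)
  have : 0 ≤ r * F / 2 := by positivity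
  linarith

/-- Each mollification is continuous in the centre, and the uniform Lipschitz bound in the scale
makes the convergence locally uniform. -/
lemma SolvesPoisson.continuousOn_preciseRep (h : SolvesPoisson Ω z f)
    (hb : Bornology.IsBounded Ω) (hz : IntegrableOn z Ω)
    (hfb : LocallyEssBounded Ω f) : ContinuousOn (preciseRep Ω z) Ω := by
  intro x₀ hx₀
  obtain ⟨r, F, hr, hF0, hsub, hF⟩ := hfb x₀ hx₀
  have hu : TendstoUniformlyOn (fun ε x => moll Ω z x ε / kerMass N) (preciseRep Ω z) (𝓝[>] 0)
      (Metric.ball x₀ r) := by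
    rw [Metric.tendstoUniformlyOn_iff]
    intro e he
    have hK : 0 < r * F / 2 + 1 := by positivity
    filter_upwards [Ioo_mem_nhdsGT (lt_min hr (div_pos he hK))] with t ht x hx
    have hxΩ : x ∈ Ω := hsub (Metric.ball_subset_ball (by linarith) hx)
    have htr : t ≤ r := ht.2.le.trans (min_le_left _ _)
    have ht2 := ht.2.trans_le (min_le_right _ _)
    have hlim := ((h.tendsto_preciseRep hb hz hfb hxΩ).const_sub (moll Ω z x t / kerMass N)).abs
    have hle : |moll Ω z x t / kerMass N - preciseRep Ω z x| ≤ r * F / 2 * t := by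
      -- Let the smaller scale `s` tend to zero in the Lipschitz estimate.
      refine le_of_tendsto hlim ?_
      filter_upwards [Ioo_mem_nhdsGT ht.1] with s hs
      refine (h.abs_moll_sub_le_of_mem_ball hb hz hsub hF0 hF hx
        ⟨hs.1, hs.2.le.trans htr⟩ ⟨ht.1, htr⟩).trans ?_
      gcongr
      rw [abs_of_nonneg (by linarith [hs.2])]
      linarith [hs.1]
    rw [dist_comm, Real.dist_eq]
    rw [lt_div_iff₀ hK] at ht2
    linarith [ht.1]
  have hc := hu.continuousOn (Eventually.frequently (by
    filter_upwards [self_mem_nhdsWithin] with ε (hε : 0 < ε)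
    exact ((continuous_moll hz hε).div_const _).continuousOn))
  exact (hc.continuousAt (Metric.ball_mem_nhds x₀ hr)).continuousWithinAt

lemma SolvesPoisson.ae_eq_preciseRep (h : SolvesPoisson Ω z f) (hΩ : IsOpen Ω)
    (hb : Bornology.IsBounded Ω) (hz : IntegrableOn z Ω)
    (hfb : LocallyEssBounded Ω f) : ∀ᵐ x ∂(volume.restrict Ω), z x = preciseRep Ω z x := by
  filter_upwards [ae_tendsto_moll hΩ hz, ae_restrict_mem hΩ.measurableSet] with x hx hxΩ
  exact tendsto_nhds_unique hx (h.tendsto_preciseRep hb hz hfb hxΩ)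

/-- Strong maximum principle for nonnegative distributional supersolutions. -/
lemma SolvesPoisson.pos_or_eq_zero (h : SolvesPoisson Ω z f) (hΩ : IsOpen Ω)
    (hc : IsPreconnected Ω) (hb : Bornology.IsBounded Ω) (hz : IntegrableOn z Ω)
    (hfb : LocallyEssBounded Ω f)
    (hz0 : ∀ᵐ x ∂(volume.restrict Ω), 0 ≤ z x) (hf0 : ∀ᵐ x ∂(volume.restrict Ω), 0 ≤ f x) :
    (∀ x ∈ Ω, 0 < preciseRep Ω z x) ∨ ∀ x ∈ Ω, preciseRep Ω z x = 0 := by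
  have hm := kerMass_pos (N := N)
  have hcont := h.continuousOn_preciseRep hb hz hfb
  have hae := h.ae_eq_preciseRep hΩ hb hz hfb
  have hmoll0 : ∀ x, ∀ ε > 0, 0 ≤ moll Ω z x ε := fun x ε hε => integral_nonneg_of_ae <| by
    filter_upwards [hz0] with y hy using mul_nonneg hy (kerP_nonneg hε)
  -- Since `f ≥ 0`, mollifications increase as the scale decreases, so the limit dominates each of
  -- them: a mean value inequality.
  have hle : ∀ x ε, 0 < ε → Metric.closedBall x ε ⊆ Ω →
      moll Ω z x ε / kerMass N ≤ preciseRep Ω z x := fun x ε hε hx => by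
    refine ge_of_tendsto (h.tendsto_preciseRep hb hz hfb
      (hx (Metric.mem_closedBall_self hε.le))) ?_
    filter_upwards [Ioc_mem_nhdsGT hε] with s hs
    gcongr
    exact h.antitoneOn_moll hb hz hf0 hx hs ⟨hε, le_rfl⟩ hs.2
  have hnear : ∀ x ∈ Ω, ∃ ε > 0, Metric.closedBall x ε ⊆ Ω := fun x hx =>
    Metric.nhds_basis_closedBall.mem_iff.1 (hΩ.mem_nhds hx)
  have hzero : ∀ x ∈ Ω, preciseRep Ω z x = 0 →
      ∃ ε > 0, Metric.ball x ε ⊆ Ω ∧ ∀ y ∈ Metric.ball x ε, preciseRep Ω z y = 0 := by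
    intro x hx hx0
    obtain ⟨ε, hε, hsub⟩ := hnear x hx
    have hbsub : Metric.ball x ε ⊆ Ω := Metric.ball_subset_closedBall.trans hsub
    refine ⟨ε, hε, hbsub, ?_⟩
    have h1 : moll Ω z x ε = 0 := by
      have := hle x ε hε hsub
      rw [hx0, div_le_iff₀ hm, zero_mul] at this
      exact le_antisymm this (hmoll0 x ε hε)
    -- A vanishing integral of the nonnegative `z · kerP` forces `z = 0` almost everywhere on the
    -- open ball, where the kernel is positive; continuity then gives every point.
    have h2 := (setIntegral_eq_zero_iff_of_nonneg_ae (by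
      filter_upwards [hz0] with y hy using mul_nonneg hy (kerP_nonneg hε))
      (integrable_mul_kerP hz hε x)).1 h1
    have h3 : preciseRep Ω z =ᵐ[volume.restrict (Metric.ball x ε)] fun _ => 0 := by
      filter_upwards [ae_restrict_of_ae_restrict_of_subset hbsub h2,
        ae_restrict_of_ae_restrict_of_subset hbsub hae, ae_restrict_mem measurableSet_ball]
        with y hy hy' hyb
      rw [← hy']
      refine (mul_eq_zero.1 hy).resolve_right (kerP_pos hε ?_).ne'
      exact pow_lt_pow_left₀ (mem_ball_iff_norm.1 hyb) (norm_nonneg _) two_ne_zero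
    exact Measure.eqOn_open_of_ae_eq h3 Metric.isOpen_ball (hcont.mono hbsub) continuousOn_const
  have hnonneg : ∀ x ∈ Ω, 0 ≤ preciseRep Ω z x := fun x hx => by
    obtain ⟨ε, hε, hsub⟩ := hnear x hx
    exact (div_nonneg (hmoll0 x ε hε) hm.le).trans (hle x ε hε hsub)
  by_cases hex : ∃ x ∈ Ω, preciseRep Ω z x = 0
  · right
    obtain ⟨x₀, hx₀, hx₀0⟩ := hex
    have hU : IsOpen {x | x ∈ Ω ∧ preciseRep Ω z x = 0} := by
      rw [Metric.isOpen_iff]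
      rintro x ⟨hx, hx0⟩
      obtain ⟨ε, hε, h1, h2⟩ := hzero x hx hx0
      exact ⟨ε, hε, fun y hy => ⟨h1 hy, h2 y hy⟩⟩
    have hV : IsOpen (Ω ∩ preciseRep Ω z ⁻¹' {0}ᶜ) :=
      hcont.isOpen_inter_preimage hΩ isOpen_compl_singleton
    have := IsPreconnected.subset_left_of_subset_union hU hV
      (Set.disjoint_left.2 fun x hx hx' => hx'.2 hx.2)
      (fun x hx => (em (preciseRep Ω z x = 0)).imp (fun h => ⟨hx, h⟩) fun h => ⟨hx, h⟩)
      ⟨x₀, hx₀, hx₀, hx₀0⟩ hc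
    exact fun x hx => (this hx).2
  · left
    push Not at hex
    exact fun x hx => lt_of_le_of_ne (hnonneg x hx) (hex x hx).symm

end Biharm

/-! ### Application to the Navier problem. -/

namespace Biharm

variable {N : ℕ} {Ω : Set (E N)} {a u φ : E N → ℝ}

lemma IsTestFunction.isDirichlet (hΩ : IsOpen Ω) (hφ : IsTestFunction Ω φ) : IsDirichlet Ω φ :=
  ⟨hφ.1, fun _ hx => image_eq_zero_of_notMem_tsupport fun h =>
    (hΩ.frontier_eq ▸ hx).2 (hφ.3 h)⟩

lemma exists_ae_abs_le {μ : Measure (E N)} (ha : MemLp a ∞ μ) :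
    ∃ C, 0 ≤ C ∧ ∀ᵐ x ∂μ, |a x| ≤ C := by
  refine ⟨(eLpNorm a ∞ μ).toReal, ENNReal.toReal_nonneg, ?_⟩
  filter_upwards [ae_le_eLpNormEssSup (f := a) (μ := μ)] with x hx
  rw [← Real.norm_eq_abs, ← toReal_enorm]
  exact ENNReal.toReal_mono ha.2.ne (by simpa using hx)

/-- Two integrations by parts: the first uses that `u` is in `H¹₀`, the second that `φ` is. -/
lemma MemH.integral_mul_lap_of_memH10 (hΩ : IsOpen Ω) (hb : Bornology.IsBounded Ω)
    (h2 : MemH Ω 2 u) (h10 : MemH10 Ω u) (hφ : IsDirichlet Ω φ) :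
    ∫ x in Ω, u x * lap φ x = ∫ x in Ω, weakLaplacian Ω u x * φ x := by
  have mφ := memL2_of_continuous hb hφ.1.continuous
  have m1 : ∀ i, MemL2 Ω (partialDeriv i φ) := fun i =>
    memL2_of_continuous hb (contDiff_partialDeriv i hφ.1).continuous
  have m2 : ∀ i, MemL2 Ω (partialDeriv i (partialDeriv i φ)) := fun i =>
    memL2_of_continuous hb (contDiff_partialDeriv i (contDiff_partialDeriv i hφ.1)).continuous
  simp only [lap, weakLaplacian, Finset.mul_sum, Finset.sum_mul]
  rw [integral_finsetSum _ fun i _ => integrable_mul_of_memL2 h2.memL2 (m2 i),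
    integral_finsetSum _ fun i _ => integrable_mul_of_memL2 (h2.hasWeakPartial_two hΩ i).2 mφ]
  refine Finset.sum_congr rfl fun i _ => ?_
  have e1 := h10.integral_mul_weakPartial hΩ
    (hasWeakPartial_of_contDiff (contDiff_partialDeriv i hφ.1) i) (m1 i) (m2 i)
  have e2 := (hφ.memH10 hΩ hb).integral_mul_weakPartial hΩ (h2.hasWeakPartial_two hΩ i).1
    (h2.memL2_weakPartial hΩ i) (h2.hasWeakPartial_two hΩ i).2
  have e3 : ∫ x in Ω, weakPartial Ω i u x * weakPartial Ω i φ x =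
      ∫ x in Ω, partialDeriv i φ x * weakPartial Ω i u x := by
    refine integral_congr_ae ?_
    filter_upwards [weakPartial_ae_eq_of_contDiff hΩ hφ.1 i] with x hx
    rw [hx, mul_comm]
  have e4 : ∫ x in Ω, u x * partialDeriv i (partialDeriv i φ) x =
      ∫ x in Ω, partialDeriv i (partialDeriv i φ) x * u x := by
    congr 1; ext x; ring
  rw [e4]
  linarith

/-- The only function in `H² ∩ H¹₀` with vanishing Laplacian is zero. -/
lemma MemH.ae_eq_zero_of_weakLaplacian (hN : 1 ≤ N) (hΩ : IsSmoothBoundedDomain Ω)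
    (h2 : MemH Ω 2 u) (h10 : MemH10 Ω u)
    (h : ∀ᵐ x ∂(volume.restrict Ω), weakLaplacian Ω u x = 0) :
    ∀ᵐ x ∂(volume.restrict Ω), u x = 0 := by
  have key : ∀ φ, IsDirichlet Ω φ → ∫ x in Ω, u x * lap φ x = 0 := fun φ hφ => by
    rw [h2.integral_mul_lap_of_memH10 hΩ.isOpen hΩ.isBounded h10 hφ]
    refine integral_eq_zero_of_ae ?_
    filter_upwards [h] with x hx
    simp [hx]
  have m0 : MemL2 Ω fun _ : E N => (0 : ℝ) := MemLp.zero
  have h1 := ae_nonneg_of_veryWeak hN hΩ h2.memL2 m0 (ae_of_all _ fun _ => le_rfl)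
    fun φ hφ => by simp [key φ hφ]
  have h3 := ae_nonneg_of_veryWeak hN hΩ h2.memL2.neg m0 (ae_of_all _ fun _ => le_rfl)
    fun φ hφ => by simp [integral_neg, key φ hφ]
  filter_upwards [h1, h3] with x hx hx'
  exact le_antisymm (neg_nonneg.1 hx') hx

lemma IsWeakSolution.integral_neg_weakLaplacian_mul_lap (hu : IsWeakSolution Ω a u)
    (hΩ : IsOpen Ω) (hb : Bornology.IsBounded Ω) (hφ : IsDirichlet Ω φ) :
    ∫ x in Ω, -weakLaplacian Ω u x * lap φ x = -∫ x in Ω, a x * u x * φ x := by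
  rw [← hu.integral_eq φ (memH_of_contDiff hb 2 hφ.1) (hφ.memH10 hΩ hb), ← integral_neg]
  refine integral_congr_ae ?_
  filter_upwards [weakLaplacian_ae_eq_of_contDiff hΩ hφ.1] with x hx
  rw [hx, neg_mul]

/-- A nonnegative weak solution of the Navier problem and its Laplacian are locally bounded. -/
lemma IsWeakSolution.locallyEssBounded (hu : IsWeakSolution Ω a u) (hΩ : IsOpen Ω)
    (hb : Bornology.IsBounded Ω) (ha : MemLp a ∞ (volume.restrict Ω))
    (hu0 : ∀ᵐ x ∂(volume.restrict Ω), 0 ≤ u x)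
    (hw0 : ∀ᵐ x ∂(volume.restrict Ω), 0 ≤ -weakLaplacian Ω u x) :
    LocallyEssBounded Ω fun x => a x * u x := by
  obtain ⟨C, hC, haC⟩ := exists_ae_abs_le ha
  have mu : MemL2 Ω u := hu.memH2.memL2
  have mw : MemL2 Ω fun x => -weakLaplacian Ω u x := (hu.memH2.memL2_weakLaplacian hΩ).neg
  have mf : MemL2 Ω fun x => a x * u x := memL2_of_abs_le mu (ha.1.mul mu.1) (by
    filter_upwards [haC] with x hx
    rw [abs_mul]
    exact mul_le_mul_of_nonneg_right hx (abs_nonneg _))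
  -- With `w = -Δu`, neither `-Δu = w` nor `-Δw = a u` bounds the source by a multiple of its own
  -- solution; their sum does.
  have hz : SolvesPoisson Ω (fun x => u x + -weakLaplacian Ω u x)
      (fun x => -weakLaplacian Ω u x + a x * u x) := fun η hη => by
    have e1 := hu.memH2.integral_mul_lap hΩ hη
    have e2 := hu.integral_neg_weakLaplacian_mul_lap hΩ hb (hη.isDirichlet hΩ)
    have ml : MemL2 Ω (lap η) := hη.lap.memL2
    have e3 : ∫ x in Ω, (u x + -weakLaplacian Ω u x) * lap η x =
        (∫ x in Ω, u x * lap η x) + ∫ x in Ω, -weakLaplacian Ω u x * lap η x := by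
      rw [← integral_add (integrable_mul_of_memL2 mu ml) (integrable_mul_of_memL2 mw ml)]
      congr 1; ext x; ring
    have e4 : ∫ x in Ω, (-weakLaplacian Ω u x + a x * u x) * η x =
        (∫ x in Ω, -weakLaplacian Ω u x * η x) + ∫ x in Ω, a x * u x * η x := by
      rw [← integral_add (integrable_mul_of_memL2 mw hη.memL2)
        (integrable_mul_of_memL2 mf hη.memL2)]
      congr 1; ext x; ring
    have e5 : ∫ x in Ω, -weakLaplacian Ω u x * η x = -∫ x in Ω, weakLaplacian Ω u x * η x := by
      simp only [neg_mul, integral_neg]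
    rw [e3, e4, e1, e2, e5]
    ring
  intro x hx
  obtain ⟨R, hR, hsub⟩ := Metric.isOpen_iff.1 hΩ x hx
  -- For nonnegative `u` and `w`, `w + a u ≤ max 1 C · (u + w)`.
  obtain ⟨M, hM⟩ := hz.exists_ae_le (C := max 1 C) hΩ hb
    ((integrableOn_of_memL2 hb mu).add (integrableOn_of_memL2 hb mw))
    ((integrableOn_of_memL2 hb mw).add (integrableOn_of_memL2 hb mf))
    (by filter_upwards [hu0, hw0] with y h1 h2 using add_nonneg h1 h2)
    (le_max_of_le_right hC) (by
      filter_upwards [hu0, hw0, haC] with y h1 h2 h3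
      have h4 : a y ≤ max 1 C := (le_abs_self _).trans (h3.trans (le_max_right _ _))
      have h5 : 1 ≤ max 1 C := le_max_left _ _
      nlinarith [mul_le_mul_of_nonneg_right h4 h1, mul_le_mul_of_nonneg_right h5 h2])
    (r := R / 2) (x₀ := x) (half_pos hR) (by rwa [mul_div_cancel₀ _ two_ne_zero])
  have hball : Metric.ball x (2 * (R / 4)) ⊆ Ω :=
    (Metric.ball_subset_ball (by linarith)).trans hsub
  refine ⟨R / 4, C * max M 0, by positivity, by positivity, hball, ?_⟩
  have hM' := (ae_restrict_iff' measurableSet_ball).1 hM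
  filter_upwards [hu0, hw0, haC, ae_restrict_of_ae hM'] with y h1 h2 h3 h4 hy
  have h5 := h4 (Metric.ball_subset_ball (by linarith) hy)
  rw [abs_mul, abs_of_nonneg h1]
  refine mul_le_mul h3 (le_max_of_le_left ?_) h1 hC
  linarith

end Biharm

theorem lemmal1 (N : ℕ) (hN : 1 ≤ N) (Ω : Set (Biharm.E N))
    (hΩ : Biharm.IsSmoothBoundedDomain Ω)
    (a : Biharm.E N → ℝ) (ha : MemLp a ∞ (volume.restrict Ω))
    (ha0 : ∀ᵐ x ∂(volume.restrict Ω), 0 ≤ a x)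
    (u : Biharm.E N → ℝ) (hu : Biharm.IsWeakSolution Ω a u)
    (hu0 : ∀ᵐ x ∂(volume.restrict Ω), 0 ≤ u x)
    (hu_ne : ¬ ∀ᵐ x ∂(volume.restrict Ω), u x = 0) :
    ∃ v : Biharm.E N → ℝ,
      (∀ᵐ x ∂(volume.restrict Ω), - Biharm.weakLaplacian Ω u x = v x) ∧
      ContinuousOn v Ω ∧ ∀ x ∈ Ω, 0 < v x := by
  have ho := hΩ.isOpen
  have hb := hΩ.isBounded
  obtain ⟨C, hC, haC⟩ := Biharm.exists_ae_abs_le ha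
  have mu := hu.memH2.memL2
  have mw : Biharm.MemL2 Ω fun x => -Biharm.weakLaplacian Ω u x :=
    (hu.memH2.memL2_weakLaplacian ho).neg
  have mf : Biharm.MemL2 Ω fun x => a x * u x := Biharm.memL2_of_abs_le mu (ha.1.mul mu.1) (by
    filter_upwards [haC] with x hx
    rw [abs_mul]
    exact mul_le_mul_of_nonneg_right hx (abs_nonneg _))
  have hf0 : ∀ᵐ x ∂(volume.restrict Ω), 0 ≤ a x * u x := by
    filter_upwards [ha0, hu0] with x h1 h2 using mul_nonneg h1 h2
  have hw0 := Biharm.ae_nonneg_of_veryWeak hN hΩ mw mf hf0 fun φ hφ =>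
    hu.integral_neg_weakLaplacian_mul_lap ho hb hφ
  have hS : Biharm.SolvesPoisson Ω (fun x => -Biharm.weakLaplacian Ω u x) fun x => a x * u x :=
    fun η hη => hu.integral_neg_weakLaplacian_mul_lap ho hb (hη.isDirichlet ho)
  have hfb := hu.locallyEssBounded ho hb ha hu0 hw0
  have hz := Biharm.integrableOn_of_memL2 hb mw
  have hae := hS.ae_eq_preciseRep ho hb hz hfb
  refine ⟨_, hae, hS.continuousOn_preciseRep hb hz hfb, ?_⟩
  -- If the representative vanished identically, then `Δu = 0` almost everywhere, hence `u = 0`.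
  refine (hS.pos_or_eq_zero ho hΩ.isConnected.isPreconnected hb hz hfb hw0 hf0).resolve_right
    fun h => hu_ne (hu.memH2.ae_eq_zero_of_weakLaplacian hN hΩ hu.memH10 ?_)
  filter_upwards [hae, ae_restrict_mem ho.measurableSet] with x hx hxΩ
  rw [h x hxΩ] at hx
  exact neg_eq_zero.1 hx
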